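/- Let $(M,J,g)$ be a smooth almost Hermitian manifold: $g$ is a Riemannian metric and $J$ an almost complex structure on $M$ with $g(JX,JY)=g(X,Y)$. Let $\nabla$ be the Levi-Civita connection of $g$, let $R(X,Y)=[\nabla_X,\nabla_Y]-\nabla_{[X,Y]}$, and for a local orthonormal frame $(e_i)$ put $$\operatorname{div}J=\sum_i(\nabla_{e_i}J)e_i,\qquad \operatorname{Ric}X=\sum_iR(X,e_i)e_i,\qquad \operatorname{tr}\nabla^2X=\sum_i\bigl(\nabla_{e_i}\nabla_{e_i}X-\nabla_{\nabla_{e_i}e_i}X\bigr).$$ Let $T^{\mathbb C}M=T'M\oplus T''M$ be the splitting of the complexified tangent bundle into the $\pm\mathrm i$-eigenspaces of $J$, with components written $X=X'+X''$, and extend $g$ and $\nabla$ complex-linearly. Suppose that the vector field $\sigma=J\operatorname{div}J$ satisfies $$g(\nabla_Z\sigma,W)+g(\nabla_W\sigma,Z)=g(\sigma,Z)\,g(\sigma,W)\qquad\text{for all } Z,W\in T'M,$$ and $$\Bigl(\operatorname{tr}\nabla^2\sigma+\operatorname{Ric}\sigma-\nabla_\sigma\sigma-2\Bigl(\sum_j\bigl(\nabla_{Z_j}(\nabla_{\overline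 Z_j}\sigma)''+\nabla_{(\nabla_{Z_j}\sigma)'}\overline Z_j\bigr)-\nabla_{\sigma'}\sigma''\Bigr)\Bigr)'=0,$$ where around each point $Z_j=\tfrac1{\sqrt2}(e_j-\mathrm iJe_j)$, $j=1,\dots,n$, is a local Hermitian frame, i.e. $(e_1,\dots,e_n,Je_1,\dots,Je_n)$ is a smooth local orthonormal frame (the left-hand side does not depend on its choice). Let $(N,J^N,h)$ be a $(1,2)$-symplectic almost Hermitian manifold, i.e. the $(1,2)$-part of $\mathrm d\Omega$ vanishes for $\Omega(X,Y)=h(X,J^NY)$. Then every holomorphic map $\varphi:M\to N$ (a smooth map with $\mathrm d\varphi\circ J=J^N\circ\mathrm d\varphi$) is biharmonic, i.e. it satisfies the Euler-Lagrange equation of the bienergy, $$\tau_2(\varphi)=\sum_i\Bigl(\nabla^\varphi_{e_i}\nabla^\varphi_{e_i}-\nabla^\varphi_{\nabla_{e_i}e_i}\Bigr)\tau(\varphi)+\sum_iR^N\bigl(\tau(\varphi),\mathrm d\varphi(e_i)\bigr)\mathrm d\varphi(e_i)=0,$$ where $\nabla^\varphi$ is the pull-back connection on $\varphi^{-1}TN$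 and $\tau(\varphi)=\operatorname{tr}\nabla\mathrm d\varphi$ is the tension field. -/

import Mathlib

open Bundle
open scoped Manifold ContDiff Topology

noncomputable section

namespace BiharmonicHolomorphic

/-! ## Riemannian geometry

`M` is a smooth manifold without boundary, modelled on the finite-dimensional real vector space `E`,
with a Riemannian metric `inner ℝ` on its tangent spaces. A tangent vector `v` at `x` is extended
to a smooth local vector field `FiberBundle.extend E v` (with constant components in the chart at
`x`) whenever the value of a tensor at `x` is read off from a formula for vector fields. -/

section Riemannian

variable {E : Type*} [NormedAddCommGroup E] [NormedSpace ℝ E] [FiniteDimensional ℝ E]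
  {M : Type*} [TopologicalSpace M] [ChartedSpace E M] [IsManifold 𝓘(ℝ, E) ∞ M]

instance instFiniteDimensionalTangent (x : M) :
    FiniteDimensional ℝ (TangentSpace 𝓘(ℝ, E) x) :=
  inferInstanceAs (FiniteDimensional ℝ E)

variable (E M) in
/-- Vector fields on `M` (no regularity built in). -/
abbrev VectorField : Type _ := Π x : M, TangentSpace 𝓘(ℝ, E) x

/-- Smoothness of a vector field on a set. -/
def SmoothOn (X : VectorField E M) (U : Set M) : Prop :=
  ContMDiffOn 𝓘(ℝ, E) (𝓘(ℝ, E).prod 𝓘(ℝ, E)) ∞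
    (fun x ↦ Bundle.TotalSpace.mk' E x (X x) : M → TangentBundle 𝓘(ℝ, E) M) U

/-- The local extension of a tangent vector to a vector field. -/
abbrev localExt {x : M} (v : TangentSpace 𝓘(ℝ, E) x) : VectorField E M := FiberBundle.extend E v

variable [RiemannianBundle (fun x : M ↦ TangentSpace 𝓘(ℝ, E) x)]

/-- The Koszul expression, equal to `g(∇_X Y, Z)` at `x` for the Levi-Civita connection `∇`. -/
def koszul (X Y Z : VectorField E M) (x : M) : ℝ :=
  (1 / 2) *
    (mvfderiv 𝓘(ℝ, E) (fun y ↦ inner ℝ (Y y) (Z y)) x (X x)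
      + mvfderiv 𝓘(ℝ, E) (fun y ↦ inner ℝ (X y) (Z y)) x (Y x)
      - mvfderiv 𝓘(ℝ, E) (fun y ↦ inner ℝ (X y) (Y y)) x (Z x)
      + inner ℝ (VectorField.mlieBracket 𝓘(ℝ, E) X Y x) (Z x)
      - inner ℝ (VectorField.mlieBracket 𝓘(ℝ, E) X Z x) (Y x)
      - inner ℝ (VectorField.mlieBracket 𝓘(ℝ, E) Y Z x) (X x))

/-- An orthonormal basis of the tangent space at `x`, used to write metric traces. -/
abbrev onb (x : M) :
    OrthonormalBasis (Fin (Module.finrank ℝ (TangentSpace 𝓘(ℝ, E) x))) ℝ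
      (TangentSpace 𝓘(ℝ, E) x) :=
  stdOrthonormalBasis ℝ (TangentSpace 𝓘(ℝ, E) x)

/-- The Levi-Civita connection of the metric: `nabla Y x v` is `∇_v Y`, the tangent vector at `x`
determined by the Koszul formula. -/
def nabla (Y : VectorField E M) (x : M) (v : TangentSpace 𝓘(ℝ, E) x) :
    TangentSpace 𝓘(ℝ, E) x :=
  ∑ i, koszul (localExt v) Y (localExt (onb x i)) x • onb x i

/-- The curvature tensor `R(u, v) w`, from
`R(X, Y) Z = ∇_X ∇_Y Z - ∇_Y ∇_X Z - ∇_[X, Y] Z`. -/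
def curvature (x : M) (u v w : TangentSpace 𝓘(ℝ, E) x) : TangentSpace 𝓘(ℝ, E) x :=
  nabla (fun y ↦ nabla (localExt w) y (localExt v y)) x u
    - nabla (fun y ↦ nabla (localExt w) y (localExt u y)) x v
    - nabla (localExt w) x (VectorField.mlieBracket 𝓘(ℝ, E) (localExt u) (localExt v) x)

/-- The Ricci operator `Ric v = ∑ R(v, e_i) e_i`. -/
def ricci (x : M) (v : TangentSpace 𝓘(ℝ, E) x) : TangentSpace 𝓘(ℝ, E) x :=
  ∑ i, curvature x v (onb x i) (onb x i)

/-- The rough Laplacian `tr ∇² Y`, the metric trace of the tensor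
`(u, V) ↦ ∇_u ∇_V Y - ∇_{∇_u V} Y`. -/
def roughLaplacian (Y : VectorField E M) (x : M) : TangentSpace 𝓘(ℝ, E) x :=
  ∑ i, (nabla (fun y ↦ nabla Y y (localExt (onb x i) y)) x (onb x i)
    - nabla Y x (nabla (localExt (onb x i)) x (onb x i)))

end Riemannian

/-! ## Maps between Riemannian manifolds -/

section Maps

variable {E : Type*} [NormedAddCommGroup E] [NormedSpace ℝ E] [FiniteDimensional ℝ E]
  {M : Type*} [TopologicalSpace M] [ChartedSpace E M] [IsManifold 𝓘(ℝ, E) ∞ M]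
  [RiemannianBundle (fun x : M ↦ TangentSpace 𝓘(ℝ, E) x)]
  {F : Type*} [NormedAddCommGroup F] [NormedSpace ℝ F] [FiniteDimensional ℝ F]
  {N : Type*} [TopologicalSpace N] [ChartedSpace F N] [IsManifold 𝓘(ℝ, F) ∞ N]
  [RiemannianBundle (fun p : N ↦ TangentSpace 𝓘(ℝ, F) p)]

variable (E F) in
/-- The differential of `φ` at `x`. -/
abbrev dmap (φ : M → N) (x : M) :
    TangentSpace 𝓘(ℝ, E) x →L[ℝ] TangentSpace 𝓘(ℝ, F) (φ x) :=
  mfderiv 𝓘(ℝ, E) 𝓘(ℝ, F) φ x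

/-- The pull-back `∇^φ_v V` of the Levi-Civita connection of `N` to sections `V` of `φ⁻¹TN`.
Writing `V = ∑ V^k (E_k ∘ φ)` in the coordinate frame `E_k` of the chart of `N` at `φ x`, it is
`∑ (dV^k(v) E_k + V^k ∇_{dφ(v)} E_k)`; the first sum is the derivative of `V` read in the
trivialization of `TN` at `φ x`. -/
def nablaAlong (φ : M → N) (V : Π x : M, TangentSpace 𝓘(ℝ, F) (φ x)) (x : M)
    (v : TangentSpace 𝓘(ℝ, E) x) : TangentSpace 𝓘(ℝ, F) (φ x) :=
  (trivializationAt F (TangentSpace 𝓘(ℝ, F) : N → Type _) (φ x)).symm (φ x)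
      (mvfderiv 𝓘(ℝ, E)
        (fun y ↦ (trivializationAt F (TangentSpace 𝓘(ℝ, F) : N → Type _) (φ x)
          ⟨φ y, V y⟩).2) x v)
    + nabla (localExt (V x)) (φ x) (dmap E F φ x v)

/-- The second fundamental form
`∇dφ(u, v) = ∇^φ_u (dφ(V)) - dφ(∇_u V)`, where `V` extends `v`. -/
def secondFundamentalForm (φ : M → N) (x : M) (u v : TangentSpace 𝓘(ℝ, E) x) :
    TangentSpace 𝓘(ℝ, F) (φ x) :=
  nablaAlong φ (fun y ↦ dmap E F φ y (localExt v y)) x u - dmap E F φ x (nabla (localExt v) x u)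

variable (E F) in
/-- The tension field `τ(φ) = tr ∇dφ`. -/
def tension (φ : M → N) (x : M) : TangentSpace 𝓘(ℝ, F) (φ x) :=
  ∑ i, secondFundamentalForm φ x (onb x i : TangentSpace 𝓘(ℝ, E) x) (onb x i)

variable (E) in
/-- The rough Laplacian `tr (∇^φ)² V` of a section `V` of `φ⁻¹TN`, the metric trace of
`(u, W) ↦ ∇^φ_u ∇^φ_W V - ∇^φ_{∇_u W} V`. -/
def roughLaplacianAlong (φ : M → N) (V : Π x : M, TangentSpace 𝓘(ℝ, F) (φ x)) (x : M) :
    TangentSpace 𝓘(ℝ, F) (φ x) :=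
  ∑ i, (nablaAlong φ (fun y ↦ nablaAlong φ V y
        (localExt (onb x i : TangentSpace 𝓘(ℝ, E) x) y)) x (onb x i)
    - nablaAlong φ V x (nabla (localExt (onb x i)) x (onb x i)))

variable (E) in
/-- The operator `Ric^φ v = ∑ R^N(v, dφ(e_i)) dφ(e_i)`. -/
def ricciAlong (φ : M → N) (x : M) (v : TangentSpace 𝓘(ℝ, F) (φ x)) :
    TangentSpace 𝓘(ℝ, F) (φ x) :=
  ∑ i, curvature (φ x) v (dmap E F φ x (onb x i)) (dmap E F φ x (onb x i))

variable (E F) in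
/-- The bitension field `τ₂(φ) = (tr (∇^φ)² + Ric^φ)(τ(φ))`. -/
def bitension (φ : M → N) (x : M) : TangentSpace 𝓘(ℝ, F) (φ x) :=
  roughLaplacianAlong E φ (tension E F φ) x + ricciAlong E φ x (tension E F φ x)

variable (E F) in
/-- `φ` is biharmonic: it satisfies the Euler-Lagrange equation `τ₂(φ) = 0` of the bienergy. -/
def IsBiharmonic (φ : M → N) : Prop :=
  ∀ x : M, bitension E F φ x = 0

end Maps

/-! ## Almost Hermitian geometry -/

section AlmostHermitian

variable {E : Type*} [NormedAddCommGroup E] [NormedSpace ℝ E] [FiniteDimensional ℝ E]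
  {M : Type*} [TopologicalSpace M] [ChartedSpace E M] [IsManifold 𝓘(ℝ, E) ∞ M]

variable (E M) in
/-- Fields of endomorphisms of the tangent spaces. -/
abbrev EndField : Type _ :=
  Π x : M, TangentSpace 𝓘(ℝ, E) x →L[ℝ] TangentSpace 𝓘(ℝ, E) x

/-- A vector `a + i b` of the complexified tangent space `T_x M ⊗ ℂ`, stored as the pair
`(a, b)` of its real and imaginary parts. -/
abbrev CTangent (x : M) : Type _ := TangentSpace 𝓘(ℝ, E) x × TangentSpace 𝓘(ℝ, E) x

variable (E M) in
/-- Complex vector fields, that is, sections of `TM ⊗ ℂ`. -/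
abbrev CVectorField : Type _ := Π x : M, CTangent (E := E) x

/-- A real tangent vector as a complex one. -/
def ofReal {x : M} (v : TangentSpace 𝓘(ℝ, E) x) : CTangent (E := E) x := (v, 0)

/-- Complex conjugation. -/
def cconj {x : M} (z : CTangent (E := E) x) : CTangent (E := E) x := (z.1, -z.2)

/-- Multiplication by the imaginary unit. -/
def mulI {x : M} (z : CTangent (E := E) x) : CTangent (E := E) x := (-z.2, z.1)

/-- The complex linear extension of `J`. -/
def complexJ (J : EndField E M) {x : M} (z : CTangent (E := E) x) : CTangent (E := E) x :=
  (J x z.1, J x z.2)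

/-- `z ∈ T'M`, the `i`-eigenspace of `J`. -/
def MemT' (J : EndField E M) {x : M} (z : CTangent (E := E) x) : Prop :=
  complexJ J z = mulI z

/-- `z ∈ T''M`, the `(-i)`-eigenspace of `J`. -/
def MemT'' (J : EndField E M) {x : M} (z : CTangent (E := E) x) : Prop :=
  complexJ J z = -mulI z

/-- The `T'M`-component `z' = (z - i J z) / 2`. -/
def part' (J : EndField E M) {x : M} (z : CTangent (E := E) x) : CTangent (E := E) x :=
  (1 / 2 : ℝ) • (z - mulI (complexJ J z))

/-- The `T''M`-component `z'' = (z + i J z) / 2`. -/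
def part'' (J : EndField E M) {x : M} (z : CTangent (E := E) x) : CTangent (E := E) x :=
  (1 / 2 : ℝ) • (z + mulI (complexJ J z))

variable [RiemannianBundle (fun x : M ↦ TangentSpace 𝓘(ℝ, E) x)]

/-- The complex bilinear extension of the metric `g`. -/
def complexMetric {x : M} (z w : CTangent (E := E) x) : ℂ :=
  ⟨inner ℝ z.1 w.1 - inner ℝ z.2 w.2, inner ℝ z.1 w.2 + inner ℝ z.2 w.1⟩

/-- The complex bilinear extension `∇_z W` of the Levi-Civita connection. -/
def cnabla (W : CVectorField E M) (x : M) (z : CTangent (E := E) x) : CTangent (E := E) x :=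
  (nabla (fun y ↦ (W y).1) x z.1 - nabla (fun y ↦ (W y).2) x z.2,
   nabla (fun y ↦ (W y).2) x z.1 + nabla (fun y ↦ (W y).1) x z.2)

/-- `(M, J, g)` is almost Hermitian: `J` is a smooth almost complex structure and an isometry. -/
structure IsAlmostHermitian (J : EndField E M) : Prop where
  smooth : ContMDiff 𝓘(ℝ, E) (𝓘(ℝ, E).prod 𝓘(ℝ, E →L[ℝ] E)) ∞
    (fun x ↦ Bundle.TotalSpace.mk' (E →L[ℝ] E)
      (E := fun x : M ↦ TangentSpace 𝓘(ℝ, E) x →L[ℝ] TangentSpace 𝓘(ℝ, E) x) x (J x))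
  sq_eq_neg : ∀ (x : M) (v : TangentSpace 𝓘(ℝ, E) x), J x (J x v) = -v
  isometry : ∀ (x : M) (v w : TangentSpace 𝓘(ℝ, E) x),
    inner ℝ (J x v) (J x w) = inner ℝ v w

/-- The covariant derivative `(∇_u J) v = ∇_u (J V) - J ∇_u V`, where `V` extends `v`. -/
def nablaJ (J : EndField E M) (x : M) (u v : TangentSpace 𝓘(ℝ, E) x) :
    TangentSpace 𝓘(ℝ, E) x :=
  nabla (fun y ↦ J y (localExt v y)) x u - J x (nabla (localExt v) x u)

/-- The divergence `div J = ∑ (∇_{e_i} J) e_i`. -/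
def divJ (J : EndField E M) : VectorField E M :=
  fun x ↦ ∑ i, nablaJ J x (onb x i) (onb x i)

/-- The vector field `σ = J div J`. -/
def sigma (J : EndField E M) : VectorField E M :=
  fun x ↦ J x (divJ J x)

/-- The fundamental two-form `Ω(X, Y) = g(X, J Y)`. -/
def fundamentalForm (J : EndField E M) (x : M) (u v : TangentSpace 𝓘(ℝ, E) x) : ℝ :=
  inner ℝ u (J x v)

/-- The exterior derivative of the fundamental form at `x`:
`dΩ(X, Y, Z) = X Ω(Y, Z) - Y Ω(X, Z) + Z Ω(X, Y) - Ω([X, Y], Z) + Ω([X, Z], Y) - Ω([Y, Z], X)`,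
where `X, Y, Z` extend `u, v, w`. -/
def dFundamentalForm (J : EndField E M) (x : M) (u v w : TangentSpace 𝓘(ℝ, E) x) : ℝ :=
  mvfderiv 𝓘(ℝ, E) (fun y ↦ fundamentalForm J y (localExt v y) (localExt w y)) x u
    - mvfderiv 𝓘(ℝ, E) (fun y ↦ fundamentalForm J y (localExt u y) (localExt w y)) x v
    + mvfderiv 𝓘(ℝ, E) (fun y ↦ fundamentalForm J y (localExt u y) (localExt v y)) x w
    - fundamentalForm J x (VectorField.mlieBracket 𝓘(ℝ, E) (localExt u) (localExt v) x) w
    + fundamentalForm J x (VectorField.mlieBracket 𝓘(ℝ, E) (localExt u) (localExt w) x) v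
    - fundamentalForm J x (VectorField.mlieBracket 𝓘(ℝ, E) (localExt v) (localExt w) x) u

/-- The complex trilinear extension of `dΩ`. -/
def complexDFundamentalForm (J : EndField E M) (x : M) (z₁ z₂ z₃ : CTangent (E := E) x) : ℂ :=
  ⟨dFundamentalForm J x z₁.1 z₂.1 z₃.1 - dFundamentalForm J x z₁.1 z₂.2 z₃.2
      - dFundamentalForm J x z₁.2 z₂.1 z₃.2 - dFundamentalForm J x z₁.2 z₂.2 z₃.1,
   dFundamentalForm J x z₁.2 z₂.1 z₃.1 + dFundamentalForm J x z₁.1 z₂.2 z₃.1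
      + dFundamentalForm J x z₁.1 z₂.1 z₃.2 - dFundamentalForm J x z₁.2 z₂.2 z₃.2⟩

/-- `(M, J, g)` is `(1,2)`-symplectic: the `(1,2)`-part of `dΩ` vanishes. -/
def IsOneTwoSymplectic (J : EndField E M) : Prop :=
  ∀ (x : M) (z w₁ w₂ : CTangent (E := E) x), MemT' J z → MemT'' J w₁ → MemT'' J w₂ →
    complexDFundamentalForm J x z w₁ w₂ = 0

/-- The first-order condition
`g(∇_Z σ, W) + g(∇_W σ, Z) = g(σ, Z) g(σ, W)` for all `Z, W` in `T'M`. -/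
def SymmetricCondition (J : EndField E M) : Prop :=
  ∀ (x : M) (z w : CTangent (E := E) x), MemT' J z → MemT' J w →
    complexMetric (cnabla (fun y ↦ ofReal (sigma J y)) x z) w
      + complexMetric (cnabla (fun y ↦ ofReal (sigma J y)) x w) z
    = complexMetric (ofReal (sigma J x)) z * complexMetric (ofReal (sigma J x)) w

/-- `e₁, …, eₙ` are smooth vector fields on `U` such that `e₁, …, eₙ, J e₁, …, J eₙ` is an
orthonormal basis of the tangent space at each point of `U`. -/
structure IsAdaptedFrameOn (J : EndField E M) {n : ℕ} (e : Fin n → VectorField E M)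
    (U : Set M) : Prop where
  smooth : ∀ j, SmoothOn (e j) U
  orthonormal : ∀ y ∈ U, Orthonormal ℝ
    (Sum.elim (fun j ↦ e j y) (fun j ↦ J y (e j y)) : Fin n ⊕ Fin n → TangentSpace 𝓘(ℝ, E) y)
  card : 2 * n = Module.finrank ℝ E

/-- The member `Z = (e - i J e) / √2` of the Hermitian frame built on an adapted frame. -/
def hermitianVector (J : EndField E M) (e : VectorField E M) : CVectorField E M :=
  fun y ↦ (Real.sqrt 2)⁻¹ • (ofReal (e y) - mulI (ofReal (J y (e y))))

/-- The third-order condition at `x`, with respect to the Hermitian frame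
`Z_j = (e_j - i J e_j) / √2`: the `T'M`-component of
`tr ∇²σ + Ric σ - ∇_σ σ
  - 2 (∑ (∇_{Z_j} (∇_{conj Z_j} σ)'' + ∇_{(∇_{Z_j} σ)'} (conj Z_j)) - ∇_{σ'} σ'')` vanishes. -/
def VectorConditionAt (J : EndField E M) {n : ℕ} (e : Fin n → VectorField E M) (x : M) : Prop :=
  let σ : CVectorField E M := fun y ↦ ofReal (sigma J y)
  let Z : Fin n → CVectorField E M := fun j ↦ hermitianVector J (e j)
  part' J
    (ofReal (roughLaplacian (sigma J) x + ricci x (sigma J x) - nabla (sigma J) x (sigma J x))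
      - (2 : ℝ) •
        ((∑ j, (cnabla (fun y ↦ part'' J (cnabla σ y (cconj (Z j y)))) x (Z j x)
            + cnabla (fun y ↦ cconj (Z j y)) x (part' J (cnabla σ x (Z j x)))))
          - cnabla (fun y ↦ part'' J (σ y)) x (part' J (σ x)))) = 0

/-- The third-order condition holds on `M`: around every point it holds with respect to a local
Hermitian frame. -/
def VectorCondition (J : EndField E M) : Prop :=
  ∀ x : M, ∃ (U : Set M) (n : ℕ) (e : Fin n → VectorField E M),
    IsOpen U ∧ x ∈ U ∧ IsAdaptedFrameOn J e U ∧ VectorConditionAt J e x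

end AlmostHermitian

section Holomorphic

variable {E : Type*} [NormedAddCommGroup E] [NormedSpace ℝ E]
  {M : Type*} [TopologicalSpace M] [ChartedSpace E M]
  {F : Type*} [NormedAddCommGroup F] [NormedSpace ℝ F]
  {N : Type*} [TopologicalSpace N] [ChartedSpace F N]

/-- A holomorphic map of almost complex manifolds: a smooth map with `dφ ∘ J = J ∘ dφ`. -/
structure IsHolomorphic (JM : EndField E M) (JN : EndField F N) (φ : M → N) : Prop where
  smooth : ContMDiff 𝓘(ℝ, E) 𝓘(ℝ, F) ∞ φ
  commutes : ∀ (x : M) (v : TangentSpace 𝓘(ℝ, E) x),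
    mfderiv 𝓘(ℝ, E) 𝓘(ℝ, F) φ x (JM x v) = JN (φ x) (mfderiv 𝓘(ℝ, E) 𝓘(ℝ, F) φ x v)

end Holomorphic

end BiharmonicHolomorphic

end

open BiharmonicHolomorphic

set_option linter.unusedSectionVars false

/-! Write `B = ∇dφ` for the second fundamental form and `D(u,v) = J(∇_u J)v + (∇_{Ju} J)v` for
`quasiKaehlerForm`. The tensor `D` vanishes on a (1,2)-symplectic manifold, and on any almost
Hermitian manifold its trace is `2σ`. Differentiating `dφ ∘ J = J^N ∘ dφ` and using `D^N = 0` gives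
`2(B(u,v) + B(Ju,Jv)) = -dφ(D(u,v) + D(v,u))` (`secondFundamentalForm_add_end`): the `J`-invariant
part of `B` is determined by `dφ` and the geometry of `M`. Its trace is `τ(φ) = -dφ(σ)`
(`tension_eq`).

For any map with `τ(φ) = -dφ(σ)`, commuting derivatives by the Codazzi equation makes the curvature
of `N` cancel, and `τ₂(φ) = -dφ(tr ∇²σ + Ric σ - ∇_σ σ) - P(B)` (`bitension_eq`), where `P(b) = ∑
(b(e_i, ∇_{e_i}σ) + b(∇_{e_i}σ, e_i)) - b(σ,σ)` is `symmPairing`. The `J`-anti-invariant part of `B`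
is not controlled, but the first-order condition says that the symmetric form behind `P` is
`J`-invariant, so that part drops out and `2P(B) = -dφ(P(D))` (`symmPairing_sffBilin`).

The `T'M`-component of the derivative of a `T''M`-field in a `T'M`-direction is algebraic in the
field and given by `D`. Hence the third-order condition reads `2(tr ∇²σ + Ric σ - ∇_σ σ) = P(D)`
(`VectorConditionAt.eq_symmPairing`), and `τ₂(φ) = 0` follows.

The definitions choose extensions, orthonormal bases and charts point by point. The classical
coordinate formulas, above all `toCoord_nabla` and `toCoord_nablaAlong`, are what show that the
resulting objects are tensorial and can be differentiated. -/

namespace BiharmonicHolomorphic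

/-! ### Vector fields and Lie brackets in a chart -/

section Coordinates

variable {E : Type*} [NormedAddCommGroup E] [NormedSpace ℝ E]
  {M : Type*} [TopologicalSpace M] [ChartedSpace E M] [IsManifold 𝓘(ℝ, E) ∞ M]

/-- The components of tangent vectors at `y` in the chart at `x₀`. -/
noncomputable def toCoord (x₀ y : M) : TangentSpace 𝓘(ℝ, E) y →L[ℝ] E :=
  (trivializationAt E (TangentSpace 𝓘(ℝ, E)) x₀).continuousLinearMapAt ℝ y

/-- The tangent vector at `y` with given components in the chart at `x₀`. -/
noncomputable def ofCoord (x₀ y : M) : E →L[ℝ] TangentSpace 𝓘(ℝ, E) y :=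
  (trivializationAt E (TangentSpace 𝓘(ℝ, E)) x₀).symmL ℝ y

lemma ofCoord_apply {x₀ y : M} (hy : y ∈ (chartAt E x₀).source) (u : E) :
    ofCoord x₀ y u = (trivializationAt E (TangentSpace 𝓘(ℝ, E)) x₀).symm y u :=
  Trivialization.symmL_apply _ hy _

lemma ofCoord_toCoord {x₀ y : M} (hy : y ∈ (chartAt E x₀).source)
    (v : TangentSpace 𝓘(ℝ, E) y) : ofCoord x₀ y (toCoord x₀ y v) = v :=
  (trivializationAt E (TangentSpace 𝓘(ℝ, E)) x₀).symmL_continuousLinearMapAt hy v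

lemma toCoord_ofCoord {x₀ y : M} (hy : y ∈ (chartAt E x₀).source) (u : E) :
    toCoord x₀ y (ofCoord x₀ y u) = u :=
  (trivializationAt E (TangentSpace 𝓘(ℝ, E)) x₀).continuousLinearMapAt_symmL hy u

lemma toCoord_injective {x₀ y : M} (hy : y ∈ (chartAt E x₀).source) :
    Function.Injective (toCoord (E := E) x₀ y) :=
  Function.LeftInverse.injective (ofCoord_toCoord hy)

lemma trivializationAt_snd {x₀ y : M} (hy : y ∈ (chartAt E x₀).source)
    (v : TangentSpace 𝓘(ℝ, E) y) :
    (trivializationAt E (TangentSpace 𝓘(ℝ, E)) x₀ ⟨y, v⟩).2 = toCoord x₀ y v := by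
  rw [toCoord, Trivialization.continuousLinearMapAt_apply,
    Trivialization.coe_linearMapAt_of_mem _ hy]

lemma mfderiv_chartAt {x₀ y : M} (hy : y ∈ (chartAt E x₀).source) :
    mfderiv 𝓘(ℝ, E) 𝓘(ℝ, E) (chartAt E x₀) y = toCoord x₀ y := by
  rw [toCoord, TangentBundle.continuousLinearMapAt_trivializationAt hy]
  simp only [mfld_simps]

lemma mvfderiv_eq_fderiv {F : Type*} [NormedAddCommGroup F] [NormedSpace ℝ F] {x₀ y : M}
    (hy : y ∈ (chartAt E x₀).source) {f : M → F} {f' : E → F}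
    (hf : f' =ᶠ[𝓝 (chartAt E x₀ y)] fun p ↦ f ((chartAt E x₀).symm p))
    (hd : DifferentiableAt ℝ f' (chartAt E x₀ y)) (v : TangentSpace 𝓘(ℝ, E) y) :
    mvfderiv 𝓘(ℝ, E) f y v = fderiv ℝ f' (chartAt E x₀ y) (toCoord x₀ y v) := by
  have h1 : f =ᶠ[𝓝 y] f' ∘ chartAt E x₀ := by
    have := ((chartAt E x₀).continuousAt hy).eventually hf
    filter_upwards [this, (chartAt E x₀).open_source.mem_nhds hy] with z hz hz'
    simp [hz, (chartAt E x₀).left_inv hz']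
  have h2 : mfderiv 𝓘(ℝ, E) 𝓘(ℝ, F) f y
      = mfderiv 𝓘(ℝ, E) 𝓘(ℝ, F) (f' ∘ chartAt E x₀) y := h1.mfderiv_eq
  have hc : MDifferentiableAt 𝓘(ℝ, E) 𝓘(ℝ, E) (chartAt E x₀) y :=
    mdifferentiableAt_atlas (chart_mem_atlas E x₀) hy
  have h3 : mfderiv 𝓘(ℝ, E) 𝓘(ℝ, F) (f' ∘ chartAt E x₀) y
      = (mfderiv 𝓘(ℝ, E) 𝓘(ℝ, F) f' (chartAt E x₀ y)).comp
        (mfderiv 𝓘(ℝ, E) 𝓘(ℝ, E) (chartAt E x₀) y) :=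
    mfderiv_comp y hd.mdifferentiableAt hc
  rw [h3, mfderiv_chartAt hy, mfderiv_eq_fderiv] at h2
  change mfderiv 𝓘(ℝ, E) 𝓘(ℝ, F) f y v = _
  rw [h2]
  rfl

/-- A vector field read in the chart at `x₀`. -/
noncomputable def coordRep (x₀ : M) (Y : VectorField E M) (p : E) : E :=
  toCoord x₀ ((chartAt E x₀).symm p) (Y ((chartAt E x₀).symm p))

lemma coordRep_chartAt {x₀ y : M} (hy : y ∈ (chartAt E x₀).source) (Y : VectorField E M) :
    coordRep x₀ Y (chartAt E x₀ y) = toCoord x₀ y (Y y) := by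
  rw [coordRep, (chartAt E x₀).left_inv hy]

lemma contDiffAt_of_contMDiffAt {F : Type*} [NormedAddCommGroup F] [NormedSpace ℝ F]
    {x₀ : M} {p : E} (hp : p ∈ (chartAt E x₀).target) {f : M → F} {f' : E → F}
    (hf : f' =ᶠ[𝓝 p] fun p ↦ f ((chartAt E x₀).symm p))
    (h : ContMDiffAt 𝓘(ℝ, E) 𝓘(ℝ, F) ∞ f ((chartAt E x₀).symm p)) :
    ContDiffAt ℝ ∞ f' p := by
  have h1 : ContMDiffAt 𝓘(ℝ, E) 𝓘(ℝ, E) ∞ (chartAt E x₀).symm p :=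
    contMDiffOn_chart_symm.contMDiffAt ((chartAt E x₀).open_target.mem_nhds hp)
  exact (h.comp p h1).contDiffAt.congr_of_eventuallyEq hf

lemma contMDiffAt_of_contDiffAt {F : Type*} [NormedAddCommGroup F] [NormedSpace ℝ F]
    {x₀ y : M} (hy : y ∈ (chartAt E x₀).source) {f : M → F} {f' : E → F}
    (hf : f' =ᶠ[𝓝 (chartAt E x₀ y)] fun p ↦ f ((chartAt E x₀).symm p))
    (h : ContDiffAt ℝ ∞ f' (chartAt E x₀ y)) :
    ContMDiffAt 𝓘(ℝ, E) 𝓘(ℝ, F) ∞ f y := by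
  have h1 : f =ᶠ[𝓝 y] f' ∘ chartAt E x₀ := by
    have := ((chartAt E x₀).continuousAt hy).eventually hf
    filter_upwards [this, (chartAt E x₀).open_source.mem_nhds hy] with z hz hz'
    simp [hz, (chartAt E x₀).left_inv hz']
  have h2 : ContMDiffAt 𝓘(ℝ, E) 𝓘(ℝ, E) ∞ (chartAt E x₀) y :=
    contMDiffOn_chart.contMDiffAt ((chartAt E x₀).open_source.mem_nhds hy)
  exact (h.contMDiffAt.comp y h2).congr_of_eventuallyEq h1

/-- Smoothness of a vector field at a point. -/
abbrev SmoothAt (Y : VectorField E M) (y : M) : Prop :=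
  ContMDiffAt 𝓘(ℝ, E) (𝓘(ℝ, E).prod 𝓘(ℝ, E)) ∞
    (fun x ↦ Bundle.TotalSpace.mk' E x (Y x) : M → TangentBundle 𝓘(ℝ, E) M) y

lemma coordRep_eventuallyEq {x₀ : M} {p : E} (hp : p ∈ (chartAt E x₀).target)
    (Y : VectorField E M) : coordRep x₀ Y =ᶠ[𝓝 p] fun p ↦
      (fun y ↦ (trivializationAt E (TangentSpace 𝓘(ℝ, E)) x₀
        (Bundle.TotalSpace.mk' E y (Y y))).2) ((chartAt E x₀).symm p) := by
  filter_upwards [(chartAt E x₀).open_target.mem_nhds hp] with q hq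
  exact (trivializationAt_snd ((chartAt E x₀).map_target hq) _).symm

lemma SmoothAt.contDiffAt {x₀ : M} {p : E} (hp : p ∈ (chartAt E x₀).target)
    {Y : VectorField E M} (h : SmoothAt Y ((chartAt E x₀).symm p)) :
    ContDiffAt ℝ ∞ (coordRep x₀ Y) p :=
  contDiffAt_of_contMDiffAt hp (coordRep_eventuallyEq hp Y)
    (((trivializationAt E (TangentSpace 𝓘(ℝ, E)) x₀).contMDiffAt_section_iff
      ((chartAt E x₀).map_target hp)).1 h)

lemma SmoothAt.contDiffAt_coordRep {x₀ y : M} (hy : y ∈ (chartAt E x₀).source)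
    {Y : VectorField E M} (h : SmoothAt Y y) :
    ContDiffAt ℝ ∞ (coordRep x₀ Y) (chartAt E x₀ y) :=
  SmoothAt.contDiffAt ((chartAt E x₀).map_source hy)
    (by rwa [(chartAt E x₀).left_inv hy])

lemma smoothAt_of_contDiffAt {x₀ y : M} (hy : y ∈ (chartAt E x₀).source)
    {Y : VectorField E M} (h : ContDiffAt ℝ ∞ (coordRep x₀ Y) (chartAt E x₀ y)) :
    SmoothAt Y y :=
  ((trivializationAt E (TangentSpace 𝓘(ℝ, E)) x₀).contMDiffAt_section_iff hy).2
    (contMDiffAt_of_contDiffAt hy (coordRep_eventuallyEq ((chartAt E x₀).map_source hy) Y) h)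

lemma coordRep_localExt {x : M} (v : TangentSpace 𝓘(ℝ, E) x) {p : E}
    (hp : p ∈ (chartAt E x).target) : coordRep x (localExt v) p = toCoord x x v := by
  have hq := (chartAt E x).map_target hp
  rw [coordRep, ← trivializationAt_snd hq, localExt, FiberBundle.extend,
    ← trivializationAt_snd (mem_chart_source E x)]
  have h := congrArg Prod.snd ((trivializationAt E (TangentSpace 𝓘(ℝ, E)) x).apply_mk_symm hq
    (trivializationAt E (TangentSpace 𝓘(ℝ, E)) x ⟨x, v⟩).2)
  exact h

lemma localExt_self {x : M} (v : TangentSpace 𝓘(ℝ, E) x) : localExt v x = v :=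
  FiberBundle.extend_apply_self E v

lemma smoothAt_localExt {x y : M} (v : TangentSpace 𝓘(ℝ, E) x)
    (hy : y ∈ (chartAt E x).source) : SmoothAt (localExt v) y := by
  refine smoothAt_of_contDiffAt hy (contDiffAt_const (c := toCoord x x v) |>.congr_of_eventuallyEq ?_)
  filter_upwards [(chartAt E x).open_target.mem_nhds ((chartAt E x).map_source hy)] with p hp
  exact coordRep_localExt v hp

lemma smoothAt_ofCoord {x₀ y : M} (hy : y ∈ (chartAt E x₀).source) (u : E) :
    SmoothAt (fun z ↦ ofCoord x₀ z u) y := by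
  refine smoothAt_of_contDiffAt hy (contDiffAt_const (c := u) |>.congr_of_eventuallyEq ?_)
  filter_upwards [(chartAt E x₀).open_target.mem_nhds ((chartAt E x₀).map_source hy)] with p hp
  exact toCoord_ofCoord ((chartAt E x₀).map_target hp) u

/-- The Lie bracket commutes with pull-back under the inverse chart, so it becomes the bracket of
the component functions. -/
lemma toCoord_mlieBracket {x₀ y : M} (hy : y ∈ (chartAt E x₀).source) [CompleteSpace E]
    {X Y : VectorField E M} (hX : SmoothAt X y) (hY : SmoothAt Y y) :
    toCoord x₀ y (VectorField.mlieBracket 𝓘(ℝ, E) X Y y)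
      = fderiv ℝ (coordRep x₀ Y) (chartAt E x₀ y) (toCoord x₀ y (X y))
        - fderiv ℝ (coordRep x₀ X) (chartAt E x₀ y) (toCoord x₀ y (Y y)) := by
  have hX' : MDifferentiableAt 𝓘(ℝ, E) 𝓘(ℝ, E).tangent (fun x ↦ Bundle.TotalSpace.mk' E x (X x))
      ((chartAt E x₀).symm (chartAt E x₀ y)) := by
    rw [(chartAt E x₀).left_inv hy]
    exact hX.mdifferentiableAt (by simp)
  have hY' : MDifferentiableAt 𝓘(ℝ, E) 𝓘(ℝ, E).tangent (fun x ↦ Bundle.TotalSpace.mk' E x (Y x))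
      ((chartAt E x₀).symm (chartAt E x₀ y)) := by
    rw [(chartAt E x₀).left_inv hy]
    exact hY.mdifferentiableAt (by simp)
  have hp := (chartAt E x₀).map_source hy
  have hc : ContMDiffAt 𝓘(ℝ, E) 𝓘(ℝ, E) ∞ (chartAt E x₀).symm (chartAt E x₀ y) :=
    contMDiffOn_chart_symm.contMDiffAt ((chartAt E x₀).open_target.mem_nhds hp)
  have h2 : minSmoothness ℝ 2 ≤ ∞ := by
    rw [minSmoothness_of_isRCLikeNormedField]; exact WithTop.coe_le_coe.2 le_top
  have : IsManifold 𝓘(ℝ, E) (minSmoothness ℝ 3) M := by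
    rw [minSmoothness_of_isRCLikeNormedField]; infer_instance
  have key := VectorField.mpullback_mlieBracket hX' hY' hc h2
  -- Pull-back under the inverse chart applies the inverse of its differential, which is the
  -- differential of the chart, i.e. `toCoord`.
  have hpull : ∀ Z : VectorField E M, ∀ p ∈ (chartAt E x₀).target,
      VectorField.mpullback 𝓘(ℝ, E) 𝓘(ℝ, E) (chartAt E x₀).symm Z p = coordRep x₀ Z p := by
    intro Z p hp
    have hq := (chartAt E x₀).map_target hp
    have hm := mdifferentiable_chart (I := 𝓘(ℝ, E)) x₀
    have h1 := hm.symm_comp_deriv hq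
    have h3 := hm.comp_symm_deriv hp
    rw [(chartAt E x₀).right_inv hp] at h1
    rw [VectorField.mpullback_apply, ContinuousLinearMap.inverse_eq h1 h3, mfderiv_chartAt hq]
    rfl
  rw [hpull _ _ hp, coordRep_chartAt hy] at key
  rw [key]
  have e : ∀ Z : VectorField E M,
      VectorField.mpullback 𝓘(ℝ, E) 𝓘(ℝ, E) (chartAt E x₀).symm Z
        =ᶠ[𝓝 (chartAt E x₀ y)] coordRep x₀ Z := fun Z ↦ by
    filter_upwards [(chartAt E x₀).open_target.mem_nhds hp] with p hp using hpull Z p hp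
  rw [(e X).mlieBracket_vectorField_eq (e Y)]
  have h5 (V W : Π p : E, TangentSpace 𝓘(ℝ, E) p) (p : E) :
      VectorField.mlieBracket 𝓘(ℝ, E) V W p = VectorField.lieBracket ℝ V W p := by
    rw [← VectorField.mlieBracketWithin_univ,
      VectorField.mlieBracketWithin_eq_lieBracketWithin]
    exact congrFun VectorField.lieBracketWithin_univ p
  refine (h5 _ _ _).trans ?_
  rw [VectorField.lieBracket, coordRep_chartAt hy, coordRep_chartAt hy]


end Coordinates

/-! ### Normed structure on bilinear maps -/

section Instances

variable {E F G : Type*} [NormedAddCommGroup E] [NormedSpace ℝ E]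
  [NormedAddCommGroup F] [NormedSpace ℝ F] [NormedAddCommGroup G] [NormedSpace ℝ G]

noncomputable instance instNormedAddCommGroupBilin : NormedAddCommGroup (E →L[ℝ] F →L[ℝ] G) :=
  ContinuousLinearMap.toNormedAddCommGroup

noncomputable instance instNormedSpaceBilin : NormedSpace ℝ (E →L[ℝ] F →L[ℝ] G) :=
  ContinuousLinearMap.toNormedSpace

end Instances

/-! ### Christoffel symbols of a metric on a vector space -/

section Christoffel

variable {E : Type*} [NormedAddCommGroup E] [NormedSpace ℝ E] [FiniteDimensional ℝ E]

/-- The Christoffel symbols of the first kind of a metric `G` on an open subset of `E`. -/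
noncomputable def christoffelLower (G : E → E →L[ℝ] E →L[ℝ] ℝ) (p u v : E) : E →L[ℝ] ℝ :=
  (1 / 2 : ℝ) • (fderiv ℝ G p u v + fderiv ℝ G p v u - ((fderiv ℝ G p).flip u).flip v)

lemma christoffelLower_apply (G : E → E →L[ℝ] E →L[ℝ] ℝ) (p u v w : E) :
    christoffelLower G p u v w
      = (1 / 2) * (fderiv ℝ G p u v w + fderiv ℝ G p v u w - fderiv ℝ G p w u v) := by
  simp [christoffelLower]

/-- The Christoffel symbols of a metric `G` on an open subset of `E`. -/
noncomputable def christoffel (G : E → E →L[ℝ] E →L[ℝ] ℝ) (p : E) : E →L[ℝ] E →L[ℝ] E :=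
  (LinearMap.mk₂ ℝ (fun u v ↦ (G p).inverse (christoffelLower G p u v))
    (fun u u' v ↦ by rw [← map_add]; congr 1; ext w; simp [christoffelLower_apply]; ring)
    (fun c u v ↦ by rw [← map_smul]; congr 1; ext w; simp [christoffelLower_apply]; ring)
    (fun u v v' ↦ by rw [← map_add]; congr 1; ext w; simp [christoffelLower_apply]; ring)
    (fun c u v ↦ by rw [← map_smul]; congr 1; ext w; simp [christoffelLower_apply]; ring)
    ).toContinuousBilinearMap

lemma christoffel_apply (G : E → E →L[ℝ] E →L[ℝ] ℝ) (p u v : E) :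
    christoffel G p u v = (G p).inverse (christoffelLower G p u v) := rfl

lemma metric_christoffel {G : E → E →L[ℝ] E →L[ℝ] ℝ} {p : E} (hG : (G p).IsInvertible) (u v w : E) :
    G p (christoffel G p u v) w = christoffelLower G p u v w := by
  obtain ⟨e, he⟩ := hG
  simp [christoffel_apply, ← he]

lemma contDiffOn_christoffel {G : E → E →L[ℝ] E →L[ℝ] ℝ} {s : Set E} (hs : IsOpen s)
    (hG : ∀ p ∈ s, (G p).IsInvertible) (h : ContDiffOn ℝ ∞ G s) :
    ContDiffOn ℝ ∞ (christoffel G) s := by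
  have h1 : ContDiffOn ℝ ∞ (fderiv ℝ G) s := h.fderiv_of_isOpen hs (by simp)
  have h2 (u v w : E) : ContDiffOn ℝ ∞ (fun p ↦ fderiv ℝ G p u v w) s :=
    ((h1.clm_apply contDiffOn_const).clm_apply contDiffOn_const).clm_apply contDiffOn_const
  rw [contDiffOn_clm_apply]
  intro u
  rw [contDiffOn_clm_apply]
  intro v
  have h3 : ContDiffOn ℝ ∞ (fun p ↦ (G p).inverse) s := fun p hp ↦
    (hG p hp).contDiffAt_map_inverse.comp_contDiffWithinAt p (h p hp)
  simp_rw [christoffel_apply]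
  refine h3.clm_apply ?_
  rw [contDiffOn_clm_apply]
  intro w
  simp_rw [christoffelLower_apply]
  exact contDiffOn_const.mul (((h2 u v w).add (h2 v u w)).sub (h2 w u v))

end Christoffel

/-! ### The Levi-Civita connection in a chart -/

section Metric

variable {E : Type*} [NormedAddCommGroup E] [NormedSpace ℝ E] [FiniteDimensional ℝ E]
  {M : Type*} [TopologicalSpace M] [ChartedSpace E M] [IsManifold 𝓘(ℝ, E) ∞ M]
  [RiemannianBundle (fun x : M ↦ TangentSpace 𝓘(ℝ, E) x)]

/-- The metric read in the chart at `x₀`. -/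
noncomputable def metricCoord (x₀ : M) (p : E) : E →L[ℝ] E →L[ℝ] ℝ :=
  (innerSL ℝ).bilinearComp (ofCoord x₀ ((chartAt E x₀).symm p))
    (ofCoord x₀ ((chartAt E x₀).symm p))

lemma metricCoord_apply (x₀ : M) (p u v : E) : metricCoord x₀ p u v
    = inner ℝ (ofCoord x₀ ((chartAt E x₀).symm p) u) (ofCoord x₀ ((chartAt E x₀).symm p) v) := rfl

lemma metricCoord_comm (x₀ : M) (p u v : E) : metricCoord x₀ p u v = metricCoord x₀ p v u := by
  rw [metricCoord_apply, metricCoord_apply, real_inner_comm]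

lemma metricCoord_toCoord {x₀ y : M} (hy : y ∈ (chartAt E x₀).source)
    (v w : TangentSpace 𝓘(ℝ, E) y) :
    metricCoord x₀ (chartAt E x₀ y) (toCoord x₀ y v) (toCoord x₀ y w) = inner ℝ v w := by
  rw [metricCoord_apply, (chartAt E x₀).left_inv hy, ofCoord_toCoord hy, ofCoord_toCoord hy]

/-- Positive definiteness gives injectivity, and `E` and its dual have the same dimension. -/
lemma isInvertible_metricCoord {x₀ : M} {p : E} (hp : p ∈ (chartAt E x₀).target) :
    (metricCoord x₀ p).IsInvertible := by
  have hinj : Function.Injective (metricCoord x₀ p).toLinearMap := by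
    rw [← LinearMap.ker_eq_bot, LinearMap.ker_eq_bot']
    intro u hu
    have h := congrArg (fun f : E →L[ℝ] ℝ ↦ f u) hu
    have h' : inner ℝ (ofCoord x₀ ((chartAt E x₀).symm p) u)
      (ofCoord x₀ ((chartAt E x₀).symm p) u) = (0 : ℝ) := h
    rw [inner_self_eq_zero] at h'
    rw [← toCoord_ofCoord ((chartAt E x₀).map_target hp) u, h', map_zero]
  have hdim : Module.finrank ℝ E = Module.finrank ℝ (E →L[ℝ] ℝ) := by
    rw [← (LinearMap.toContinuousLinearMap (𝕜 := ℝ) (E := E) (F' := ℝ)).finrank_eq]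
    exact Subspace.dual_finrank_eq.symm
  exact ⟨(LinearEquiv.ofInjectiveOfFinrankEq _ hinj hdim).toContinuousLinearEquiv, by ext; rfl⟩

variable [IsContMDiffRiemannianBundle 𝓘(ℝ, E) ∞ E (fun x : M ↦ TangentSpace 𝓘(ℝ, E) x)]

lemma contDiffOn_metricCoord (x₀ : M) : ContDiffOn ℝ ∞ (metricCoord (E := E) x₀) (chartAt E x₀).target := by
  rw [contDiffOn_clm_apply]
  intro u
  rw [contDiffOn_clm_apply]
  intro v p hp
  have hq := (chartAt E x₀).map_target hp
  have h : ContMDiffAt 𝓘(ℝ, E) 𝓘(ℝ, ℝ) ∞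
      (fun z : M ↦ inner ℝ (ofCoord x₀ z u) (ofCoord x₀ z v)) ((chartAt E x₀).symm p) :=
    ContMDiffAt.inner_bundle (F := E) (E := fun x : M ↦ TangentSpace 𝓘(ℝ, E) x) (b := id)
      (smoothAt_ofCoord hq u) (smoothAt_ofCoord hq v)
  exact (contDiffAt_of_contMDiffAt hp (Filter.EventuallyEq.refl _ _) h).contDiffWithinAt

lemma contDiffAt_metricCoord {x₀ : M} {p : E} (hp : p ∈ (chartAt E x₀).target) :
    ContDiffAt ℝ ∞ (metricCoord (E := E) x₀) p :=
  (contDiffOn_metricCoord x₀).contDiffAt ((chartAt E x₀).open_target.mem_nhds hp)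

/-- The Christoffel symbols in the chart at `x₀`. -/
noncomputable def chr (x₀ : M) : E → E →L[ℝ] E →L[ℝ] E := christoffel (metricCoord x₀)

lemma contDiffAt_chr {x₀ : M} {p : E} (hp : p ∈ (chartAt E x₀).target) :
    ContDiffAt ℝ ∞ (chr (E := E) x₀) p :=
  (contDiffOn_christoffel (chartAt E x₀).open_target (fun _ ↦ isInvertible_metricCoord)
    (contDiffOn_metricCoord x₀)).contDiffAt ((chartAt E x₀).open_target.mem_nhds hp)

lemma fderiv_metricCoord_comm {x₀ : M} {p : E} (hp : p ∈ (chartAt E x₀).target) (u v w : E) :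
    fderiv ℝ (metricCoord x₀) p u v w = fderiv ℝ (metricCoord x₀) p u w v := by
  have hd : DifferentiableAt ℝ (metricCoord x₀) p :=
    (contDiffAt_metricCoord hp).differentiableAt (by simp)
  have h (a b : E) : fderiv ℝ (metricCoord x₀) p u a b
      = fderiv ℝ (fun p ↦ metricCoord x₀ p a b) p u := by
    rw [fderiv_clm_apply (by fun_prop) (by fun_prop), fderiv_clm_apply (by fun_prop) (by fun_prop)]
    simp
  rw [h, h]
  simp_rw [metricCoord_comm x₀ _ v w]

lemma metricCoord_chr {x₀ : M} {p : E} (hp : p ∈ (chartAt E x₀).target) (u v w : E) :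
    metricCoord x₀ p (chr x₀ p u v) w = (1 / 2) * (fderiv ℝ (metricCoord x₀) p u v w
      + fderiv ℝ (metricCoord x₀) p v u w - fderiv ℝ (metricCoord x₀) p w u v) := by
  rw [chr, metric_christoffel (isInvertible_metricCoord hp), christoffelLower_apply]

lemma chr_comm {x₀ : M} {p : E} (hp : p ∈ (chartAt E x₀).target) (u v : E) :
    chr x₀ p u v = chr x₀ p v u := by
  obtain ⟨e, he⟩ := isInvertible_metricCoord (x₀ := x₀) hp
  apply e.injective
  ext w
  have h := metricCoord_chr (x₀ := x₀) hp u v w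
  have h' := metricCoord_chr (x₀ := x₀) hp v u w
  rw [← he] at h h'
  rw [ContinuousLinearEquiv.coe_coe] at h h'
  rw [h, h', fderiv_metricCoord_comm hp w u v]
  ring

/-- This is `∇g = 0` in coordinates: in the sum of the two Koszul-type expressions every term but
the derivative in the direction `u` cancels. -/
lemma fderiv_metricCoord {x₀ : M} {p : E} (hp : p ∈ (chartAt E x₀).target) (u v w : E) :
    fderiv ℝ (metricCoord x₀) p u v w
      = metricCoord x₀ p (chr x₀ p u v) w + metricCoord x₀ p v (chr x₀ p u w) := by
  rw [metricCoord_comm x₀ p v, metricCoord_chr hp, metricCoord_chr hp,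
    fderiv_metricCoord_comm hp w u v, fderiv_metricCoord_comm hp v u w,
    fderiv_metricCoord_comm hp u w v]
  ring

lemma mvfderiv_inner_eq {x₀ y : M} (hy : y ∈ (chartAt E x₀).source) {V W : VectorField E M}
    (hV : SmoothAt V y) (hW : SmoothAt W y) (v : TangentSpace 𝓘(ℝ, E) y) :
    mvfderiv 𝓘(ℝ, E) (fun y ↦ inner ℝ (V y) (W y)) y v
      = fderiv ℝ (metricCoord x₀) (chartAt E x₀ y) (toCoord x₀ y v) (toCoord x₀ y (V y))
          (toCoord x₀ y (W y))
        + metricCoord x₀ (chartAt E x₀ y)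
          (fderiv ℝ (coordRep x₀ V) (chartAt E x₀ y) (toCoord x₀ y v)) (toCoord x₀ y (W y))
        + metricCoord x₀ (chartAt E x₀ y) (toCoord x₀ y (V y))
          (fderiv ℝ (coordRep x₀ W) (chartAt E x₀ y) (toCoord x₀ y v)) := by
  have hp := (chartAt E x₀).map_source hy
  have hd : DifferentiableAt ℝ (metricCoord x₀) (chartAt E x₀ y) :=
    (contDiffAt_metricCoord hp).differentiableAt (by simp)
  have hV' := (hV.contDiffAt_coordRep hy).differentiableAt (by simp)
  have hW' := (hW.contDiffAt_coordRep hy).differentiableAt (by simp)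
  rw [mvfderiv_eq_fderiv hy (f' := fun p ↦ metricCoord x₀ p (coordRep x₀ V p) (coordRep x₀ W p))
    _ (by fun_prop)]
  · rw [fderiv_clm_apply (by fun_prop) (by fun_prop), fderiv_clm_apply (by fun_prop) (by fun_prop)]
    simp [coordRep_chartAt hy]
    ring
  · filter_upwards [(chartAt E x₀).open_target.mem_nhds hp] with p hp
    have hq := (chartAt E x₀).map_target hp
    rw [metricCoord_apply, coordRep, coordRep, ofCoord_toCoord hq, ofCoord_toCoord hq]

/-- The bracket terms cancel the derivatives of `X` and `Z` that come from the product rule. Only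
the derivative of `Y` survives, so the expression is tensorial in `X` and `Z`. -/
lemma koszul_eq {x₀ y : M} (hy : y ∈ (chartAt E x₀).source) {X Y Z : VectorField E M}
    (hX : SmoothAt X y) (hY : SmoothAt Y y) (hZ : SmoothAt Z y) :
    koszul X Y Z y = metricCoord x₀ (chartAt E x₀ y)
      (fderiv ℝ (coordRep x₀ Y) (chartAt E x₀ y) (toCoord x₀ y (X y))
        + chr x₀ (chartAt E x₀ y) (toCoord x₀ y (X y)) (toCoord x₀ y (Y y))) (toCoord x₀ y (Z y)) := by
  have hp := (chartAt E x₀).map_source hy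
  rw [koszul, mvfderiv_inner_eq hy hY hZ, mvfderiv_inner_eq hy hX hZ, mvfderiv_inner_eq hy hX hY, map_add, _root_.add_apply,
    metricCoord_chr hp, ← metricCoord_toCoord hy, ← metricCoord_toCoord hy, ← metricCoord_toCoord hy,
    toCoord_mlieBracket hy hX hY, toCoord_mlieBracket hy hX hZ, toCoord_mlieBracket hy hY hZ]
  simp only [map_sub, _root_.sub_apply]
  rw [metricCoord_comm x₀ _ (toCoord x₀ y (Y y)) (fderiv ℝ (coordRep x₀ Z) _ _),
    metricCoord_comm x₀ _ (toCoord x₀ y (X y)) (fderiv ℝ (coordRep x₀ Z) _ _),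
    metricCoord_comm x₀ _ (toCoord x₀ y (X y)) (fderiv ℝ (coordRep x₀ Y) _ _)]
  ring

/-- The classical formula for `∇_v Y`, in any chart around `y`. It frees `nabla` from the
orthonormal basis and the extensions in its definition and underlies all later computations. -/
theorem toCoord_nabla {x₀ y : M} (hy : y ∈ (chartAt E x₀).source) {Y : VectorField E M}
    (hY : SmoothAt Y y) (v : TangentSpace 𝓘(ℝ, E) y) :
    toCoord x₀ y (nabla Y y v) = fderiv ℝ (coordRep x₀ Y) (chartAt E x₀ y) (toCoord x₀ y v)
      + chr x₀ (chartAt E x₀ y) (toCoord x₀ y v) (toCoord x₀ y (Y y)) := by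
  set ξ := fderiv ℝ (coordRep x₀ Y) (chartAt E x₀ y) (toCoord x₀ y v)
      + chr x₀ (chartAt E x₀ y) (toCoord x₀ y v) (toCoord x₀ y (Y y)) with hξ
  have hs := mem_chart_source E y
  -- The coefficients in `nabla` are the inner products with the vector of components `ξ`, so the
  -- defining sum is its expansion in the orthonormal basis.
  have h (i) : koszul (localExt v) Y (localExt (onb y i)) y = inner ℝ (onb y i) (ofCoord x₀ y ξ) := by
    rw [koszul_eq hy (smoothAt_localExt v hs) hY (smoothAt_localExt _ hs), localExt_self,
      localExt_self, ← hξ, real_inner_comm,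
      ← metricCoord_toCoord hy, toCoord_ofCoord hy]
  rw [nabla]
  simp_rw [h]
  rw [OrthonormalBasis.sum_repr' , toCoord_ofCoord hy]

/-- The Levi-Civita connection is compatible with the metric. -/
lemma mvfderiv_inner {y : M} {V W : VectorField E M} (hV : SmoothAt V y) (hW : SmoothAt W y)
    (v : TangentSpace 𝓘(ℝ, E) y) :
    mvfderiv 𝓘(ℝ, E) (fun y ↦ inner ℝ (V y) (W y)) y v
      = inner ℝ (nabla V y v) (W y) + inner ℝ (V y) (nabla W y v) := by
  have hy := mem_chart_source E y
  rw [mvfderiv_inner_eq hy hV hW, ← metricCoord_toCoord hy, ← metricCoord_toCoord hy,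
    toCoord_nabla hy hV, toCoord_nabla hy hW, fderiv_metricCoord ((chartAt E y).map_source hy)]
  simp only [map_add, _root_.add_apply]
  ring

end Metric

/-! ### Change of charts for tangent vectors -/

section TransitionMaps

variable {F : Type*} [NormedAddCommGroup F] [NormedSpace ℝ F] [FiniteDimensional ℝ F]
  {N : Type*} [TopologicalSpace N] [ChartedSpace F N] [IsManifold 𝓘(ℝ, F) ∞ N]

/-- The change of components of tangent vectors from the chart at `q` to the chart at `q'`, as a
function of the coordinates of the base point in the chart at `q₀`. -/
noncomputable def transCoord (q₀ q q' : N) (r : F) : F →L[ℝ] F :=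
  (toCoord q' ((chartAt F q₀).symm r)).comp (ofCoord q ((chartAt F q₀).symm r))

lemma transCoord_chartAt {q₀ w : N} (hw : w ∈ (chartAt F q₀).source) (q q' : N) (u : F) :
    transCoord q₀ q q' (chartAt F q₀ w) u = toCoord q' w (ofCoord q w u) := by
  rw [transCoord, (chartAt F q₀).left_inv hw, ContinuousLinearMap.comp_apply]

lemma contDiffAt_transCoord {q₀ q q' w : N} (h₀ : w ∈ (chartAt F q₀).source)
    (h : w ∈ (chartAt F q).source) (h' : w ∈ (chartAt F q').source) :
    ContDiffAt ℝ ∞ (transCoord (F := F) q₀ q q') (chartAt F q₀ w) := by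
  set s : Set F := (chartAt F q₀).target ∩ (chartAt F q₀).symm ⁻¹'
    ((chartAt F q).source ∩ (chartAt F q').source)
  have hs : IsOpen s := (chartAt F q₀).isOpen_inter_preimage_symm
    ((chartAt F q).open_source.inter (chartAt F q').open_source)
  have hw : chartAt F q₀ w ∈ s := by
    refine ⟨(chartAt F q₀).map_source h₀, ?_⟩
    simp only [Set.mem_preimage, (chartAt F q₀).left_inv h₀]
    exact ⟨h, h'⟩
  suffices ContDiffOn ℝ ∞ (transCoord (F := F) q₀ q q') s from this.contDiffAt (hs.mem_nhds hw)
  rw [contDiffOn_clm_apply]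
  intro u r hr
  have h1 := ((trivializationAt F (TangentSpace 𝓘(ℝ, F)) q').contMDiffAt_section_iff
      (s := fun z ↦ ofCoord q z u) hr.2.2).1 (smoothAt_ofCoord hr.2.1 u)
  refine (contDiffAt_of_contMDiffAt hr.1 ?_ h1).contDiffWithinAt
  filter_upwards [hs.mem_nhds hr] with r hr
  exact (trivializationAt_snd hr.2.2 _).symm

lemma coordRep_localExt_eq {q₀ q : N} (v : TangentSpace 𝓘(ℝ, F) q) {r : F}
    (hr : (chartAt F q₀).symm r ∈ (chartAt F q).source) :
    coordRep q₀ (localExt v) r = transCoord q₀ q q₀ r (toCoord q q v) := by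
  rw [← trivializationAt_snd (mem_chart_source F q), coordRep, localExt, FiberBundle.extend,
    transCoord, ContinuousLinearMap.comp_apply, ofCoord_apply hr]

end TransitionMaps

/-! ### The pull-back connection in charts -/

section Along

variable {E : Type*} [NormedAddCommGroup E] [NormedSpace ℝ E] [FiniteDimensional ℝ E]
  {M : Type*} [TopologicalSpace M] [ChartedSpace E M] [IsManifold 𝓘(ℝ, E) ∞ M]
  {F : Type*} [NormedAddCommGroup F] [NormedSpace ℝ F] [FiniteDimensional ℝ F]
  {N : Type*} [TopologicalSpace N] [ChartedSpace F N] [IsManifold 𝓘(ℝ, F) ∞ N]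

/-- The domain in `E` on which a map is read in the charts at `x₀` and `q₀`. -/
def coordDomain (x₀ : M) (q₀ : N) (φ : M → N) : Set E :=
  (chartAt E x₀).target ∩ (chartAt E x₀).symm ⁻¹' (φ ⁻¹' (chartAt F q₀).source)

lemma isOpen_coordDomain (x₀ : M) (q₀ : N) {φ : M → N} (hφ : Continuous φ) :
    IsOpen (coordDomain (E := E) (F := F) x₀ q₀ φ) :=
  (chartAt E x₀).isOpen_inter_preimage_symm ((chartAt F q₀).open_source.preimage hφ)

lemma mem_coordDomain {x₀ y : M} {q₀ : N} {φ : M → N} (hy : y ∈ (chartAt E x₀).source)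
    (hy' : φ y ∈ (chartAt F q₀).source) : chartAt E x₀ y ∈ coordDomain (E := E) (F := F) x₀ q₀ φ :=
  ⟨(chartAt E x₀).map_source hy, by simpa [(chartAt E x₀).left_inv hy] using hy'⟩

/-- A map read in the charts at `x₀` and `q₀`. -/
noncomputable def mapCoord (x₀ : M) (q₀ : N) (φ : M → N) (p : E) : F :=
  chartAt F q₀ (φ ((chartAt E x₀).symm p))

/-- A section of `φ⁻¹TN` read in the charts at `x₀` and `q₀`. -/
noncomputable def alongRep (x₀ : M) (q₀ : N) (φ : M → N)
    (V : Π x : M, TangentSpace 𝓘(ℝ, F) (φ x)) (p : E) : F :=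
  toCoord q₀ (φ ((chartAt E x₀).symm p)) (V ((chartAt E x₀).symm p))

lemma mapCoord_chartAt {x₀ y : M} (hy : y ∈ (chartAt E x₀).source) (q₀ : N) (φ : M → N) :
    mapCoord (E := E) (F := F) x₀ q₀ φ (chartAt E x₀ y) = chartAt F q₀ (φ y) := by
  rw [mapCoord, (chartAt E x₀).left_inv hy]

lemma alongRep_chartAt {x₀ y : M} (hy : y ∈ (chartAt E x₀).source) (q₀ : N) (φ : M → N)
    (V : Π x : M, TangentSpace 𝓘(ℝ, F) (φ x)) :
    alongRep (E := E) x₀ q₀ φ V (chartAt E x₀ y) = toCoord q₀ (φ y) (V y) := by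
  rw [alongRep, (chartAt E x₀).left_inv hy]

lemma contDiffAt_mapCoord {x₀ : M} {q₀ : N} {φ : M → N} (hφ : ContMDiff 𝓘(ℝ, E) 𝓘(ℝ, F) ∞ φ) {p : E}
    (hp : p ∈ coordDomain (E := E) (F := F) x₀ q₀ φ) :
    ContDiffAt ℝ ∞ (mapCoord (E := E) (F := F) x₀ q₀ φ) p := by
  have h1 : ContMDiffAt 𝓘(ℝ, F) 𝓘(ℝ, F) ∞ (chartAt F q₀) (φ ((chartAt E x₀).symm p)) :=
    contMDiffOn_chart.contMDiffAt ((chartAt F q₀).open_source.mem_nhds hp.2)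
  exact contDiffAt_of_contMDiffAt hp.1 (Filter.EventuallyEq.refl _ _)
    (h1.comp _ (hφ ((chartAt E x₀).symm p)))

lemma toCoord_dmap {x₀ y : M} {q₀ : N} {φ : M → N} (hφ : ContMDiff 𝓘(ℝ, E) 𝓘(ℝ, F) ∞ φ)
    (hy : y ∈ (chartAt E x₀).source) (hy' : φ y ∈ (chartAt F q₀).source)
    (v : TangentSpace 𝓘(ℝ, E) y) :
    toCoord q₀ (φ y) (dmap E F φ y v)
      = fderiv ℝ (mapCoord x₀ q₀ φ) (chartAt E x₀ y) (toCoord x₀ y v) := by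
  rw [← mvfderiv_eq_fderiv hy (f := fun z ↦ chartAt F q₀ (φ z)) (f' := mapCoord x₀ q₀ φ) (Filter.EventuallyEq.refl _ _)
    ((contDiffAt_mapCoord hφ (mem_coordDomain hy hy')).differentiableAt (by simp)) v]
  have hc : MDifferentiableAt 𝓘(ℝ, F) 𝓘(ℝ, F) (chartAt F q₀) (φ y) :=
    mdifferentiableAt_atlas (chart_mem_atlas F q₀) hy'
  have h3 : mfderiv 𝓘(ℝ, E) 𝓘(ℝ, F) (chartAt F q₀ ∘ φ) y
      = (mfderiv 𝓘(ℝ, F) 𝓘(ℝ, F) (chartAt F q₀) (φ y)).comp (mfderiv 𝓘(ℝ, E) 𝓘(ℝ, F) φ y) :=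
    mfderiv_comp y hc ((hφ y).mdifferentiableAt (by simp))
  change _ = mfderiv 𝓘(ℝ, E) 𝓘(ℝ, F) (chartAt F q₀ ∘ φ) y v
  rw [h3, mfderiv_chartAt hy']
  rfl

variable [RiemannianBundle (fun p : N ↦ TangentSpace 𝓘(ℝ, F) p)]
  [IsContMDiffRiemannianBundle 𝓘(ℝ, F) ∞ F (fun p : N ↦ TangentSpace 𝓘(ℝ, F) p)]

/-- The definition at `y` uses the chart of `N` at `φ y`, which moves with `y`; second derivatives
need a formula in one fixed chart `q₀`. In passing to `q₀`, the derivative of the transition matrix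
that the product rule produces is the derivative of the components of the extension `localExt (V
y)`. -/
theorem toCoord_nablaAlong {x₀ y : M} {q₀ : N} {φ : M → N} (hφ : ContMDiff 𝓘(ℝ, E) 𝓘(ℝ, F) ∞ φ)
    (hy : y ∈ (chartAt E x₀).source) (hy' : φ y ∈ (chartAt F q₀).source)
    {V : Π x : M, TangentSpace 𝓘(ℝ, F) (φ x)}
    (hV : DifferentiableAt ℝ (alongRep (E := E) x₀ q₀ φ V) (chartAt E x₀ y))
    (v : TangentSpace 𝓘(ℝ, E) y) :
    toCoord q₀ (φ y) (nablaAlong φ V y v)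
      = fderiv ℝ (alongRep x₀ q₀ φ V) (chartAt E x₀ y) (toCoord x₀ y v)
        + chr q₀ (chartAt F q₀ (φ y))
          (fderiv ℝ (mapCoord x₀ q₀ φ) (chartAt E x₀ y) (toCoord x₀ y v))
          (toCoord q₀ (φ y) (V y)) := by
  have hq := mem_chart_source F (φ y)
  have hφd : DifferentiableAt ℝ (mapCoord (F := F) x₀ q₀ φ) (chartAt E x₀ y) :=
    (contDiffAt_mapCoord hφ (mem_coordDomain hy hy')).differentiableAt (by simp)
  have hA : DifferentiableAt ℝ (transCoord (F := F) q₀ q₀ (φ y)) (mapCoord x₀ q₀ φ (chartAt E x₀ y)) := by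
    rw [mapCoord_chartAt hy]
    exact (contDiffAt_transCoord hy' hy' hq).differentiableAt (by simp)
  have hB : DifferentiableAt ℝ (transCoord (F := F) q₀ (φ y) q₀) (mapCoord x₀ q₀ φ (chartAt E x₀ y)) := by
    rw [mapCoord_chartAt hy]
    exact (contDiffAt_transCoord hy' hq hy').differentiableAt (by simp)
  have hdom : coordDomain (E := E) (F := F) x₀ q₀ φ ∩ coordDomain (E := E) (F := F) x₀ (φ y) φ
      ∈ 𝓝 (chartAt E x₀ y) :=
    ((isOpen_coordDomain x₀ q₀ hφ.continuous).inter
      (isOpen_coordDomain x₀ (φ y) hφ.continuous)).mem_nhds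
      ⟨mem_coordDomain hy hy', mem_coordDomain hy hq⟩
  -- The components of `V` in the chart at `φ y`, written through those in the chart at `q₀` so that
  -- differentiability is inherited from `hV`.
  set f : E → F := fun p ↦ transCoord q₀ q₀ (φ y) (mapCoord x₀ q₀ φ p) (alongRep x₀ q₀ φ V p)
    with hf_def
  have hf : DifferentiableAt ℝ f (chartAt E x₀ y) :=
    (hA.comp (chartAt E x₀ y) hφd).clm_apply hV
  have hf1 : f =ᶠ[𝓝 (chartAt E x₀ y)] alongRep x₀ (φ y) φ V := by
    filter_upwards [hdom] with p hp
    simp only [hf_def, mapCoord, alongRep]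
    rw [transCoord_chartAt hp.1.2, ofCoord_toCoord hp.1.2]
  have hf2 : f =ᶠ[𝓝 (chartAt E x₀ y)] fun p ↦ (fun z ↦
      (trivializationAt F (TangentSpace 𝓘(ℝ, F) : N → Type _) (φ y) ⟨φ z, V z⟩).2)
        ((chartAt E x₀).symm p) := by
    filter_upwards [hf1, hdom] with p hp hp'
    rw [hp, trivializationAt_snd hp'.2.2]
    rfl
  have hV1 : alongRep x₀ q₀ φ V =ᶠ[𝓝 (chartAt E x₀ y)]
      fun p ↦ transCoord q₀ (φ y) q₀ (mapCoord x₀ q₀ φ p) (f p) := by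
    filter_upwards [hf1, hdom] with p hp hp'
    rw [hp, mapCoord, transCoord_chartAt hp'.1.2, alongRep, alongRep, ofCoord_toCoord hp'.2.2]
  have hfy : f (chartAt E x₀ y) = toCoord (φ y) (φ y) (V y) := by
    rw [hf1.self_of_nhds, alongRep_chartAt hy]
  -- The extension has constant components in the chart at `φ y`, so its components at `q₀` vary
  -- only through the transition matrix.
  have hloc : coordRep q₀ (localExt (V y)) =ᶠ[𝓝 (chartAt F q₀ (φ y))]
      fun r ↦ transCoord q₀ (φ y) q₀ r (f (chartAt E x₀ y)) := by
    have hs := ((chartAt F q₀).continuousAt_symm ((chartAt F q₀).map_source hy')).preimage_mem_nhds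
      ((chartAt F (φ y)).open_source.mem_nhds (by rwa [(chartAt F q₀).left_inv hy']))
    filter_upwards [hs] with r hr
    rw [coordRep_localExt_eq _ hr, hfy]
  have hsymm (w : F) : toCoord q₀ (φ y)
      ((trivializationAt F (TangentSpace 𝓘(ℝ, F) : N → Type _) (φ y)).symm (φ y) w)
      = transCoord q₀ (φ y) q₀ (chartAt F q₀ (φ y)) w := by
    rw [transCoord_chartAt hy', ofCoord_apply hq]
  have hBφ : DifferentiableAt ℝ (fun p ↦ transCoord q₀ (φ y) q₀ (mapCoord x₀ q₀ φ p))
    (chartAt E x₀ y) := hB.comp _ hφd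
  rw [nablaAlong, map_add, hsymm, mvfderiv_eq_fderiv hy hf2 hf,
    toCoord_nabla hy' (smoothAt_localExt _ hq), toCoord_dmap hφ hy hy', localExt_self, hloc.fderiv_eq,
    hV1.fderiv_eq, fderiv_clm_apply hBφ hf, ← mapCoord_chartAt hy,
    fderiv_clm_apply hB (by fun_prop)]
  have hcomp : fderiv ℝ (fun p ↦ transCoord q₀ (φ y) q₀ (mapCoord x₀ q₀ φ p)) (chartAt E x₀ y)
    = (fderiv ℝ (transCoord (F := F) q₀ (φ y) q₀) (mapCoord x₀ q₀ φ (chartAt E x₀ y))).comp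
      (fderiv ℝ (mapCoord x₀ q₀ φ) (chartAt E x₀ y)) := fderiv_comp _ hB hφd
  rw [hcomp]
  simp
  abel

end Along

/-! ### Hessians and the Codazzi equation on vector spaces -/

section Calculus

variable {E F : Type*} [NormedAddCommGroup E] [NormedSpace ℝ E]
  [NormedAddCommGroup F] [NormedSpace ℝ F]

/-- The Hessian of a map between open subsets of vector spaces, with respect to connections with
Christoffel symbols `Γ` and `Γ'`. -/
noncomputable def hess (Γ : E → E →L[ℝ] E →L[ℝ] E) (Γ' : F → F →L[ℝ] F →L[ℝ] F) (φ : E → F) (p : E) :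
    E →L[ℝ] E →L[ℝ] F :=
  fderiv ℝ (fderiv ℝ φ) p + (Γ' (φ p)).bilinearComp (fderiv ℝ φ p) (fderiv ℝ φ p)
    - (ContinuousLinearMap.compL ℝ E E F (fderiv ℝ φ p)).comp (Γ p)

variable {Γ : E → E →L[ℝ] E →L[ℝ] E} {Γ' : F → F →L[ℝ] F →L[ℝ] F} {φ : E → F} {p : E}

lemma hess_apply (u v : E) : hess Γ Γ' φ p u v = fderiv ℝ (fderiv ℝ φ) p u v
    + Γ' (φ p) (fderiv ℝ φ p u) (fderiv ℝ φ p v) - fderiv ℝ φ p (Γ p u v) := by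
  simp [hess]

/-- Second derivatives commute and both connections are torsion-free. -/
lemma hess_comm (hφ : ContDiffAt ℝ ∞ φ p) (hΓ : ∀ u v, Γ p u v = Γ p v u)
    (hΓ' : ∀ u v, Γ' (φ p) u v = Γ' (φ p) v u) (u v : E) :
    hess Γ Γ' φ p u v = hess Γ Γ' φ p v u := by
  have h := hφ.isSymmSndFDerivAt (by rw [minSmoothness_of_isRCLikeNormedField]; exact WithTop.coe_le_coe.2 le_top)
  rw [hess_apply, hess_apply, h.eq u v, hΓ, hΓ']

/-- The curvature of a connection with Christoffel symbols `Γ`. -/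
noncomputable def curv (Γ : E → E →L[ℝ] E →L[ℝ] E) (p u v w : E) : E :=
  fderiv ℝ Γ p u v w - fderiv ℝ Γ p v u w + Γ p u (Γ p v w) - Γ p v (Γ p u w)

/-- The covariant derivative of the Hessian. -/
noncomputable def hessDeriv (Γ : E → E →L[ℝ] E →L[ℝ] E) (Γ' : F → F →L[ℝ] F →L[ℝ] F) (φ : E → F)
    (p u v w : E) : F :=
  fderiv ℝ (fun p ↦ hess Γ Γ' φ p v w) p u + Γ' (φ p) (fderiv ℝ φ p u) (hess Γ Γ' φ p v w)
    - hess Γ Γ' φ p (Γ p u v) w - hess Γ Γ' φ p v (Γ p u w)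

lemma hessDeriv_comm (hs : ∀ᶠ p in 𝓝 p, ∀ u v, hess Γ Γ' φ p u v = hess Γ Γ' φ p v u) (u v w : E) :
    hessDeriv Γ Γ' φ p u v w = hessDeriv Γ Γ' φ p u w v := by
  have h1 : (fun p ↦ hess Γ Γ' φ p v w) =ᶠ[𝓝 p] fun p ↦ hess Γ Γ' φ p w v :=
    hs.mono fun q hq ↦ hq v w
  have h2 := hs.self_of_nhds
  rw [hessDeriv, hessDeriv, h1.fderiv_eq, h2 v w, h2 (Γ p u v) w, h2 v (Γ p u w)]
  abel

lemma differentiableAt_hess_apply (hφ : ContDiffAt ℝ ∞ φ p) (hΓ : DifferentiableAt ℝ Γ p)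
    (hΓ' : DifferentiableAt ℝ Γ' (φ p)) {X Y : E → E} (hX : DifferentiableAt ℝ X p)
    (hY : DifferentiableAt ℝ Y p) : DifferentiableAt ℝ (fun p ↦ hess Γ Γ' φ p (X p) (Y p)) p := by
  have h0 : DifferentiableAt ℝ φ p := hφ.differentiableAt (by simp)
  have h1 : DifferentiableAt ℝ (fderiv ℝ φ) p :=
    (hφ.fderiv_right (m := ∞) (by simp)).differentiableAt (by simp)
  have h2 : DifferentiableAt ℝ (fderiv ℝ (fderiv ℝ φ)) p :=
    ((hφ.fderiv_right (m := ∞) (by simp)).fderiv_right (m := ∞) (by simp)).differentiableAt (by simp)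
  have h3 : DifferentiableAt ℝ (fun p ↦ Γ' (φ p)) p := hΓ'.comp p h0
  simp_rw [hess_apply]
  fun_prop

-- The fully expanded product and chain rule. The terms that differentiate `X` and `Y` are again
-- values of the Hessian and are kept apart, so that the case of constant fields can be subtracted
-- in `fderiv_hess_apply`.
set_option synthInstance.maxHeartbeats 100000 in
lemma fderiv_hess (hφ : ContDiffAt ℝ ∞ φ p) (hΓ : DifferentiableAt ℝ Γ p)
    (hΓ' : DifferentiableAt ℝ Γ' (φ p)) {X Y : E → E} (hX : DifferentiableAt ℝ X p)
    (hY : DifferentiableAt ℝ Y p) (u : E) :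
    fderiv ℝ (fun p ↦ hess Γ Γ' φ p (X p) (Y p)) p u
      = fderiv ℝ (fderiv ℝ (fderiv ℝ φ)) p u (X p) (Y p)
      + fderiv ℝ Γ' (φ p) (fderiv ℝ φ p u) (fderiv ℝ φ p (X p)) (fderiv ℝ φ p (Y p))
      + Γ' (φ p) (fderiv ℝ (fderiv ℝ φ) p u (X p)) (fderiv ℝ φ p (Y p))
      + Γ' (φ p) (fderiv ℝ φ p (X p)) (fderiv ℝ (fderiv ℝ φ) p u (Y p))
      - fderiv ℝ (fderiv ℝ φ) p u (Γ p (X p) (Y p)) - fderiv ℝ φ p (fderiv ℝ Γ p u (X p) (Y p))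
      + hess Γ Γ' φ p (fderiv ℝ X p u) (Y p) + hess Γ Γ' φ p (X p) (fderiv ℝ Y p u) := by
  have h0 : DifferentiableAt ℝ φ p := hφ.differentiableAt (by simp)
  have h1 : DifferentiableAt ℝ (fderiv ℝ φ) p :=
    (hφ.fderiv_right (m := ∞) (by simp)).differentiableAt (by simp)
  have h2 : DifferentiableAt ℝ (fderiv ℝ (fderiv ℝ φ)) p :=
    ((hφ.fderiv_right (m := ∞) (by simp)).fderiv_right (m := ∞) (by simp)).differentiableAt (by simp)
  have h3 : DifferentiableAt ℝ (fun p ↦ Γ' (φ p)) p := hΓ'.comp p h0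
  have h4 : fderiv ℝ (fun p ↦ Γ' (φ p)) p = (fderiv ℝ Γ' (φ p)).comp (fderiv ℝ φ p) :=
    fderiv_comp p hΓ' h0
  simp_rw [hess_apply]
  rw [fderiv_fun_sub (by fun_prop) (by fun_prop), fderiv_fun_add (by fun_prop) (by fun_prop)]
  simp only [_root_.sub_apply, _root_.add_apply]
  rw [fderiv_clm_apply (c := fun p ↦ fderiv ℝ (fderiv ℝ φ) p (X p)) (by fun_prop) (by fun_prop),
    fderiv_clm_apply (c := fun p ↦ fderiv ℝ (fderiv ℝ φ) p) (by fun_prop) (by fun_prop),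
    fderiv_clm_apply (c := fun p ↦ Γ' (φ p) (fderiv ℝ φ p (X p))) (by fun_prop) (by fun_prop),
    fderiv_clm_apply (c := fun p ↦ Γ' (φ p)) (by fun_prop) (by fun_prop),
    fderiv_clm_apply (c := fun p ↦ fderiv ℝ φ p) (u := X) (by fun_prop) (by fun_prop),
    fderiv_clm_apply (c := fun p ↦ fderiv ℝ φ p) (u := Y) (by fun_prop) (by fun_prop),
    fderiv_clm_apply (c := fun p ↦ fderiv ℝ φ p) (u := fun p ↦ Γ p (X p) (Y p)) (by fun_prop)
      (by fun_prop),
    fderiv_clm_apply (c := fun p ↦ Γ p (X p)) (by fun_prop) (by fun_prop),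
    fderiv_clm_apply (c := fun p ↦ Γ p) (by fun_prop) (by fun_prop), h4]
  simp only [_root_.add_apply, ContinuousLinearMap.comp_apply, ContinuousLinearMap.flip_apply,
    map_add]
  abel

lemma fderiv_hess_const (hφ : ContDiffAt ℝ ∞ φ p) (hΓ : DifferentiableAt ℝ Γ p)
    (hΓ' : DifferentiableAt ℝ Γ' (φ p)) (u v w : E) :
    fderiv ℝ (fun p ↦ hess Γ Γ' φ p v w) p u = fderiv ℝ (fderiv ℝ (fderiv ℝ φ)) p u v w
      + fderiv ℝ Γ' (φ p) (fderiv ℝ φ p u) (fderiv ℝ φ p v) (fderiv ℝ φ p w)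
      + Γ' (φ p) (fderiv ℝ (fderiv ℝ φ) p u v) (fderiv ℝ φ p w)
      + Γ' (φ p) (fderiv ℝ φ p v) (fderiv ℝ (fderiv ℝ φ) p u w)
      - fderiv ℝ (fderiv ℝ φ) p u (Γ p v w) - fderiv ℝ φ p (fderiv ℝ Γ p u v w) := by
  rw [fderiv_hess hφ hΓ hΓ' (X := fun _ ↦ v) (Y := fun _ ↦ w) (differentiableAt_const v)
    (differentiableAt_const w)]
  simp

/-- The Codazzi equation. -/
theorem hessDeriv_sub (hφ : ContDiffAt ℝ ∞ φ p) (hΓ : DifferentiableAt ℝ Γ p)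
    (hΓ' : DifferentiableAt ℝ Γ' (φ p)) (hsΓ : ∀ u v, Γ p u v = Γ p v u)
    (u v w : E) :
    hessDeriv Γ Γ' φ p u v w - hessDeriv Γ Γ' φ p v u w
      = curv Γ' (φ p) (fderiv ℝ φ p u) (fderiv ℝ φ p v) (fderiv ℝ φ p w)
        - fderiv ℝ φ p (curv Γ p u v w) := by
  have hmin : minSmoothness ℝ 2 ≤ ∞ := by
    rw [minSmoothness_of_isRCLikeNormedField]; exact WithTop.coe_le_coe.2 le_top
  have hs2 : fderiv ℝ (fderiv ℝ φ) p u v = fderiv ℝ (fderiv ℝ φ) p v u :=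
    (hφ.isSymmSndFDerivAt hmin).eq u v
  have hs3 : fderiv ℝ (fderiv ℝ (fderiv ℝ φ)) p u v = fderiv ℝ (fderiv ℝ (fderiv ℝ φ)) p v u :=
    ((hφ.fderiv_right (m := ∞) (by simp)).isSymmSndFDerivAt hmin).eq u v
  rw [hessDeriv, hessDeriv, fderiv_hess_const hφ hΓ hΓ', fderiv_hess_const hφ hΓ hΓ', curv, curv,
    hsΓ u v, hs2, hs3]
  simp only [hess_apply, map_add, map_sub]
  abel

/-- The Leibniz rule for the covariant derivative of `hess`: the Christoffel corrections subtracted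
in `hessDeriv` complete the derivatives of `X` and `Y` to covariant ones. -/
lemma fderiv_hess_apply (hφ : ContDiffAt ℝ ∞ φ p) (hΓ : DifferentiableAt ℝ Γ p)
    (hΓ' : DifferentiableAt ℝ Γ' (φ p)) {X Y : E → E} (hX : DifferentiableAt ℝ X p)
    (hY : DifferentiableAt ℝ Y p) (u : E) :
    fderiv ℝ (fun p ↦ hess Γ Γ' φ p (X p) (Y p)) p u
      + Γ' (φ p) (fderiv ℝ φ p u) (hess Γ Γ' φ p (X p) (Y p))
      = hessDeriv Γ Γ' φ p u (X p) (Y p)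
        + hess Γ Γ' φ p (fderiv ℝ X p u + Γ p u (X p)) (Y p)
        + hess Γ Γ' φ p (X p) (fderiv ℝ Y p u + Γ p u (Y p)) := by
  rw [hessDeriv, fderiv_hess hφ hΓ hΓ' hX hY, fderiv_hess_const hφ hΓ hΓ']
  simp only [map_add, _root_.add_apply]
  abel

/-- The derivative along `φ` of the push-forward of a vector field. -/
lemma fderiv_fderiv_apply (hφ : ContDiffAt ℝ ∞ φ p) {Y : E → E} (hY : DifferentiableAt ℝ Y p) (u : E) :
    fderiv ℝ (fun p ↦ fderiv ℝ φ p (Y p)) p u + Γ' (φ p) (fderiv ℝ φ p u) (fderiv ℝ φ p (Y p))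
      = hess Γ Γ' φ p u (Y p) + fderiv ℝ φ p (fderiv ℝ Y p u + Γ p u (Y p)) := by
  have h1 : DifferentiableAt ℝ (fderiv ℝ φ) p :=
    (hφ.fderiv_right (m := ∞) (by simp)).differentiableAt (by simp)
  rw [fderiv_clm_apply h1 hY, hess_apply]
  simp
  abel

end Calculus

/-! ### The covariant derivative of `J` and the exterior derivative of the fundamental form -/

section Endomorphisms

variable {E : Type*} [NormedAddCommGroup E] [NormedSpace ℝ E] [FiniteDimensional ℝ E]
  {M : Type*} [TopologicalSpace M] [ChartedSpace E M] [IsManifold 𝓘(ℝ, E) ∞ M]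
  [RiemannianBundle (fun x : M ↦ TangentSpace 𝓘(ℝ, E) x)]
  {J : EndField E M}

lemma IsAlmostHermitian.smoothAt_apply (hJ : IsAlmostHermitian J) {Y : VectorField E M} {y : M}
    (hY : SmoothAt Y y) : SmoothAt (fun z ↦ J z (Y z)) y :=
  ContMDiffAt.clm_bundle_apply (F₁ := E) (F₂ := E) (E₁ := fun x : M ↦ TangentSpace 𝓘(ℝ, E) x)
    (E₂ := fun x : M ↦ TangentSpace 𝓘(ℝ, E) x) (b := fun z : M ↦ z) (ϕ := J) (v := Y)
    (hJ.smooth y) hY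

/-- A field of endomorphisms read in the chart at `x₀`. -/
noncomputable def endCoord (J : EndField E M) (x₀ : M) (p : E) : E →L[ℝ] E :=
  (toCoord x₀ ((chartAt E x₀).symm p)).comp
    ((J ((chartAt E x₀).symm p)).comp (ofCoord x₀ ((chartAt E x₀).symm p)))

lemma endCoord_apply (J : EndField E M) (x₀ : M) (p u : E) : endCoord J x₀ p u
    = toCoord x₀ ((chartAt E x₀).symm p) (J _ (ofCoord x₀ ((chartAt E x₀).symm p) u)) := rfl

lemma contDiffAt_endCoord (hJ : IsAlmostHermitian J) {x₀ : M} {p : E}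
    (hp : p ∈ (chartAt E x₀).target) : ContDiffAt ℝ ∞ (endCoord J x₀) p := by
  suffices ContDiffOn ℝ ∞ (endCoord J x₀) (chartAt E x₀).target from
    this.contDiffAt ((chartAt E x₀).open_target.mem_nhds hp)
  rw [contDiffOn_clm_apply]
  intro u r hr
  exact (SmoothAt.contDiffAt hr (hJ.smoothAt_apply
    (smoothAt_ofCoord ((chartAt E x₀).map_target hr) u))).contDiffWithinAt

lemma toCoord_end {x₀ y : M} (hy : y ∈ (chartAt E x₀).source) (v : TangentSpace 𝓘(ℝ, E) y) :
    toCoord x₀ y (J y v) = endCoord J x₀ (chartAt E x₀ y) (toCoord x₀ y v) := by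
  rw [endCoord_apply, (chartAt E x₀).left_inv hy, ofCoord_toCoord hy]

lemma coordRep_end {x₀ : M} {p : E} (hp : p ∈ (chartAt E x₀).target) (Y : VectorField E M) :
    coordRep x₀ (fun z ↦ J z (Y z)) p = endCoord J x₀ p (coordRep x₀ Y p) := by
  rw [endCoord_apply, coordRep, coordRep, ofCoord_toCoord ((chartAt E x₀).map_target hp)]

lemma endCoord_endCoord (hJ : IsAlmostHermitian J) {x₀ : M} {p : E}
    (hp : p ∈ (chartAt E x₀).target) (u : E) : endCoord J x₀ p (endCoord J x₀ p u) = -u := by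
  have h := (chartAt E x₀).map_target hp
  rw [endCoord_apply, endCoord_apply, ofCoord_toCoord h, hJ.sq_eq_neg, map_neg, toCoord_ofCoord h]

lemma IsAlmostHermitian.inner_apply (hJ : IsAlmostHermitian J) (x : M)
    (v w : TangentSpace 𝓘(ℝ, E) x) : inner ℝ (J x v) w = -inner ℝ v (J x w) := by
  rw [← hJ.isometry x (J x v) w, hJ.sq_eq_neg, inner_neg_left]

lemma metricCoord_endCoord (hJ : IsAlmostHermitian J) {x₀ : M} {p : E}
    (hp : p ∈ (chartAt E x₀).target) (u v : E) :
    metricCoord x₀ p (endCoord J x₀ p u) v = -metricCoord x₀ p u (endCoord J x₀ p v) := by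
  have h := (chartAt E x₀).map_target hp
  rw [endCoord_apply, endCoord_apply, metricCoord_apply, metricCoord_apply, ofCoord_toCoord h,
    ofCoord_toCoord h, hJ.inner_apply]

variable [IsContMDiffRiemannianBundle 𝓘(ℝ, E) ∞ E (fun x : M ↦ TangentSpace 𝓘(ℝ, E) x)]

/-- The derivatives of `Y` cancel, so the difference depends only on the value of `Y` at `y`. Hence
`nablaJ` does not depend on the extension used to define it. -/
lemma toCoord_nabla_end (hJ : IsAlmostHermitian J) {x₀ y : M} (hy : y ∈ (chartAt E x₀).source)
    {Y : VectorField E M} (hY : SmoothAt Y y) (u : TangentSpace 𝓘(ℝ, E) y) :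
    toCoord x₀ y (nabla (fun z ↦ J z (Y z)) y u - J y (nabla Y y u))
      = fderiv ℝ (endCoord J x₀) (chartAt E x₀ y) (toCoord x₀ y u) (toCoord x₀ y (Y y))
        + chr x₀ (chartAt E x₀ y) (toCoord x₀ y u)
          (endCoord J x₀ (chartAt E x₀ y) (toCoord x₀ y (Y y)))
        - endCoord J x₀ (chartAt E x₀ y)
          (chr x₀ (chartAt E x₀ y) (toCoord x₀ y u) (toCoord x₀ y (Y y))) := by
  have hp := (chartAt E x₀).map_source hy
  have h1 : coordRep x₀ (fun z ↦ J z (Y z)) =ᶠ[𝓝 (chartAt E x₀ y)]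
      fun p ↦ endCoord J x₀ p (coordRep x₀ Y p) := by
    filter_upwards [(chartAt E x₀).open_target.mem_nhds hp] with p hp using coordRep_end hp Y
  rw [map_sub, toCoord_nabla hy (hJ.smoothAt_apply hY), toCoord_end hy, toCoord_end hy,
    toCoord_nabla hy hY, h1.fderiv_eq,
    fderiv_clm_apply ((contDiffAt_endCoord hJ hp).differentiableAt (by simp))
      ((hY.contDiffAt_coordRep hy).differentiableAt (by simp)), ← coordRep_chartAt hy Y]
  simp only [_root_.add_apply, ContinuousLinearMap.comp_apply, ContinuousLinearMap.flip_apply,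
    map_add]
  abel

lemma toCoord_nablaJ (hJ : IsAlmostHermitian J) {x₀ y : M} (hy : y ∈ (chartAt E x₀).source)
    (u v : TangentSpace 𝓘(ℝ, E) y) :
    toCoord x₀ y (nablaJ J y u v)
      = fderiv ℝ (endCoord J x₀) (chartAt E x₀ y) (toCoord x₀ y u) (toCoord x₀ y v)
        + chr x₀ (chartAt E x₀ y) (toCoord x₀ y u) (endCoord J x₀ (chartAt E x₀ y) (toCoord x₀ y v))
        - endCoord J x₀ (chartAt E x₀ y)
          (chr x₀ (chartAt E x₀ y) (toCoord x₀ y u) (toCoord x₀ y v)) := by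
  have h := toCoord_nabla_end hJ hy (smoothAt_localExt v (mem_chart_source E y)) u
  rw [localExt_self] at h
  exact h

/-- The Leibniz rule for `J`. -/
lemma nabla_end (hJ : IsAlmostHermitian J) {y : M} {Y : VectorField E M} (hY : SmoothAt Y y)
    (u : TangentSpace 𝓘(ℝ, E) y) :
    nabla (fun z ↦ J z (Y z)) y u = nablaJ J y u (Y y) + J y (nabla Y y u) := by
  have hy := mem_chart_source E y
  rw [← sub_eq_iff_eq_add]
  apply toCoord_injective hy
  rw [toCoord_nabla_end hJ hy hY, toCoord_nablaJ hJ hy]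

/-- Differentiate `J² = -1`. -/
lemma nablaJ_end (hJ : IsAlmostHermitian J) (y : M) (u v : TangentSpace 𝓘(ℝ, E) y) :
    nablaJ J y u (J y v) = -J y (nablaJ J y u v) := by
  have hy := mem_chart_source E y
  have hp := (chartAt E y).map_source hy
  apply toCoord_injective hy
  rw [map_neg, toCoord_end hy, toCoord_nablaJ hJ hy, toCoord_nablaJ hJ hy, toCoord_end hy]
  have hd : DifferentiableAt ℝ (endCoord J y) (chartAt E y y) :=
    (contDiffAt_endCoord hJ hp).differentiableAt (by simp)
  have h1 : (fun p ↦ endCoord J y p (endCoord J y p (toCoord y y v)))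
      =ᶠ[𝓝 (chartAt E y y)] fun _ ↦ -toCoord y y v := by
    filter_upwards [(chartAt E y).open_target.mem_nhds hp] with p hp using endCoord_endCoord hJ hp _
  have h2 := congrArg (fun f : E →L[ℝ] E ↦ f (toCoord y y u)) h1.fderiv_eq
  rw [fderiv_clm_apply hd (by fun_prop), fderiv_clm_apply hd (by fun_prop)] at h2
  simp at h2
  simp only [map_add, map_sub, endCoord_endCoord hJ hp, map_neg]
  rw [eq_neg_of_add_eq_zero_right h2]
  abel

/-- The extensions have constant components near `y`, so their brackets vanish there. The
Christoffel terms in the alternating sum cancel because the connection is torsion-free and `J` is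
skew. -/
lemma dFundamentalForm_eq (hJ : IsAlmostHermitian J) (y : M) (u v w : TangentSpace 𝓘(ℝ, E) y) :
    dFundamentalForm J y u v w = inner ℝ v (nablaJ J y u w) - inner ℝ u (nablaJ J y v w)
      + inner ℝ u (nablaJ J y w v) := by
  have hy := mem_chart_source E y
  have hp := (chartAt E y).map_source hy
  have hd : DifferentiableAt ℝ (endCoord J y) (chartAt E y y) :=
    (contDiffAt_endCoord hJ hp).differentiableAt (by simp)
  have hd' : DifferentiableAt ℝ (metricCoord (E := E) y) (chartAt E y y) :=
    (contDiffAt_metricCoord hp).differentiableAt (by simp)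
  have hconst (a : TangentSpace 𝓘(ℝ, E) y) :
      coordRep y (localExt a) =ᶠ[𝓝 (chartAt E y y)] fun _ ↦ toCoord y y a := by
    filter_upwards [(chartAt E y).open_target.mem_nhds hp] with p hp using coordRep_localExt a hp
  have hbr (a b : TangentSpace 𝓘(ℝ, E) y) :
      VectorField.mlieBracket 𝓘(ℝ, E) (localExt a) (localExt b) y = 0 := by
    apply toCoord_injective hy
    rw [toCoord_mlieBracket hy (smoothAt_localExt a hy) (smoothAt_localExt b hy),
      (hconst a).fderiv_eq, (hconst b).fderiv_eq]
    simp
  have key (a b c : TangentSpace 𝓘(ℝ, E) y) :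
      mvfderiv 𝓘(ℝ, E) (fun z ↦ fundamentalForm J z (localExt a z) (localExt b z)) y c
        = metricCoord y (chartAt E y y) (chr y (chartAt E y y) (toCoord y y c) (toCoord y y a))
            (endCoord J y (chartAt E y y) (toCoord y y b))
          + metricCoord y (chartAt E y y) (toCoord y y a)
            (endCoord J y (chartAt E y y) (chr y (chartAt E y y) (toCoord y y c) (toCoord y y b)))
          + inner ℝ a (nablaJ J y c b) := by
    rw [mvfderiv_eq_fderiv hy
      (f' := fun p ↦ metricCoord y p (toCoord y y a) (endCoord J y p (toCoord y y b))) _ (by fun_prop),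
      fderiv_clm_apply (by fun_prop) (by fun_prop), fderiv_clm_apply (by fun_prop) (by fun_prop),
      fderiv_clm_apply hd' (by fun_prop), ← metricCoord_toCoord hy, toCoord_nablaJ hJ hy]
    · simp [fderiv_metricCoord hp]
      ring
    · filter_upwards [(chartAt E y).open_target.mem_nhds hp] with p hp
      have hq := (chartAt E y).map_target hp
      rw [← coordRep_localExt a hp, ← coordRep_localExt b hp, ← coordRep_end hp, metricCoord_apply,
        coordRep, coordRep, ofCoord_toCoord hq, ofCoord_toCoord hq]
      rfl
  simp only [dFundamentalForm, key]
  simp only [hbr, fundamentalForm, inner_zero_left, sub_zero, add_zero]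
  rw [chr_comm hp (toCoord y y v) (toCoord y y u), chr_comm hp (toCoord y y w) (toCoord y y u),
    chr_comm hp (toCoord y y w) (toCoord y y v)]
  have h := metricCoord_endCoord hJ hp (chr y (chartAt E y y) (toCoord y y u) (toCoord y y w))
    (toCoord y y v)
  rw [metricCoord_comm] at h
  linarith

/-- `∇J` at a point as a bilinear map. -/
noncomputable def nablaJBilin (J : EndField E M) (hJ : IsAlmostHermitian J) (x : M) :
    TangentSpace 𝓘(ℝ, E) x →ₗ[ℝ] TangentSpace 𝓘(ℝ, E) x →ₗ[ℝ] TangentSpace 𝓘(ℝ, E) x :=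
  LinearMap.mk₂ ℝ (nablaJ J x)
    (fun u u' v ↦ toCoord_injective (mem_chart_source E x) (by
      simp only [toCoord_nablaJ hJ (mem_chart_source E x), map_add, _root_.add_apply]; abel))
    (fun c u v ↦ toCoord_injective (mem_chart_source E x) (by
      simp only [toCoord_nablaJ hJ (mem_chart_source E x), map_smul, _root_.smul_apply,
        smul_add, smul_sub]))
    (fun u v v' ↦ toCoord_injective (mem_chart_source E x) (by
      simp only [toCoord_nablaJ hJ (mem_chart_source E x), map_add]; abel))
    (fun c u v ↦ toCoord_injective (mem_chart_source E x) (by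
      simp only [toCoord_nablaJ hJ (mem_chart_source E x), map_smul, smul_add, smul_sub]))

lemma nablaJBilin_apply (hJ : IsAlmostHermitian J) (x : M) (u v : TangentSpace 𝓘(ℝ, E) x) :
    nablaJBilin J hJ x u v = nablaJ J x u v := rfl

end Endomorphisms

/-! ### Smoothness of covariant derivatives, and the curvature in a chart -/

section Connection

variable {E : Type*} [NormedAddCommGroup E] [NormedSpace ℝ E] [FiniteDimensional ℝ E]
  {M : Type*} [TopologicalSpace M] [ChartedSpace E M] [IsManifold 𝓘(ℝ, E) ∞ M]
  [RiemannianBundle (fun x : M ↦ TangentSpace 𝓘(ℝ, E) x)]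
  [IsContMDiffRiemannianBundle 𝓘(ℝ, E) ∞ E (fun x : M ↦ TangentSpace 𝓘(ℝ, E) x)]

lemma eventually_symm {x₀ y : M} (hy : y ∈ (chartAt E x₀).source) {P : M → Prop}
    (h : ∀ᶠ z in 𝓝 y, P z) : ∀ᶠ p in 𝓝 (chartAt E x₀ y), P ((chartAt E x₀).symm p) := by
  have hc := (chartAt E x₀).continuousAt_symm ((chartAt E x₀).map_source hy)
  rw [ContinuousAt, (chartAt E x₀).left_inv hy] at hc
  exact hc.eventually h

lemma coordRep_nabla {x₀ : M} {p : E} (hp : p ∈ (chartAt E x₀).target) {Y : VectorField E M}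
    (hY : SmoothAt Y ((chartAt E x₀).symm p)) (X : VectorField E M) :
    coordRep x₀ (fun z ↦ nabla Y z (X z)) p = fderiv ℝ (coordRep x₀ Y) p (coordRep x₀ X p)
      + chr x₀ p (coordRep x₀ X p) (coordRep x₀ Y p) := by
  rw [coordRep, toCoord_nabla ((chartAt E x₀).map_target hp) hY, (chartAt E x₀).right_inv hp]
  rfl

lemma smoothAt_nabla {y : M} {X Y : VectorField E M} (hX : SmoothAt X y)
    (hY : ∀ᶠ z in 𝓝 y, SmoothAt Y z) : SmoothAt (fun z ↦ nabla Y z (X z)) y := by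
  have hy := mem_chart_source E y
  have hp := (chartAt E y).map_source hy
  apply smoothAt_of_contDiffAt hy
  have hX' := hX.contDiffAt_coordRep hy
  have hY' := hY.self_of_nhds.contDiffAt_coordRep hy
  have h : ContDiffAt ℝ ∞ (fun p ↦ fderiv ℝ (coordRep y Y) p (coordRep y X p)
      + chr y p (coordRep y X p) (coordRep y Y p)) (chartAt E y y) :=
    ((hY'.fderiv_right (m := ∞) (by simp)).clm_apply hX').add
      (((contDiffAt_chr hp).clm_apply hX').clm_apply hY')
  refine h.congr_of_eventuallyEq ?_
  filter_upwards [(chartAt E y).open_target.mem_nhds hp, eventually_symm hy hY] with p hp hp'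
  exact coordRep_nabla hp hp' X

lemma coordRep_localExt_eventuallyEq {x : M} (v : TangentSpace 𝓘(ℝ, E) x) :
    coordRep x (localExt v) =ᶠ[𝓝 (chartAt E x x)] fun _ ↦ toCoord x x v := by
  filter_upwards [(chartAt E x).open_target.mem_nhds ((chartAt E x).map_source
    (mem_chart_source E x))] with p hp using coordRep_localExt v hp

lemma eventually_smoothAt_localExt {x : M} (v : TangentSpace 𝓘(ℝ, E) x) :
    ∀ᶠ z in 𝓝 x, SmoothAt (localExt v) z := by
  filter_upwards [(chartAt E x).open_source.mem_nhds (mem_chart_source E x)] with z hz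
  exact smoothAt_localExt v hz

-- Extensions with constant components commute, which leaves the classical formula; in particular
-- the curvature is tensorial.
set_option synthInstance.maxHeartbeats 100000 in
lemma toCoord_curvature (x : M) (u v w : TangentSpace 𝓘(ℝ, E) x) :
    toCoord x x (curvature x u v w)
      = curv (chr x) (chartAt E x x) (toCoord x x u) (toCoord x x v) (toCoord x x w) := by
  have hy := mem_chart_source E x
  have hp := (chartAt E x).map_source hy
  have hΓ : DifferentiableAt ℝ (chr (E := E) x) (chartAt E x x) :=
    (contDiffAt_chr hp).differentiableAt (by simp)
  have hbr : VectorField.mlieBracket 𝓘(ℝ, E) (localExt u) (localExt v) x = 0 := by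
    apply toCoord_injective hy
    rw [toCoord_mlieBracket hy (smoothAt_localExt u hy) (smoothAt_localExt v hy),
      (coordRep_localExt_eventuallyEq u).fderiv_eq, (coordRep_localExt_eventuallyEq v).fderiv_eq]
    simp
  have key (a b c : TangentSpace 𝓘(ℝ, E) x) :
      toCoord x x (nabla (fun y ↦ nabla (localExt c) y (localExt b y)) x a)
        = fderiv ℝ (chr x) (chartAt E x x) (toCoord x x a) (toCoord x x b) (toCoord x x c)
          + chr x (chartAt E x x) (toCoord x x a)
            (chr x (chartAt E x x) (toCoord x x b) (toCoord x x c)) := by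
    have h1 : coordRep x (fun y ↦ nabla (localExt c) y (localExt b y)) =ᶠ[𝓝 (chartAt E x x)]
        fun p ↦ chr x p (toCoord x x b) (toCoord x x c) := by
      filter_upwards [(chartAt E x).open_target.mem_nhds hp,
        (coordRep_localExt_eventuallyEq c).eventuallyEq_nhds] with p hp hc
      rw [coordRep_nabla hp (smoothAt_localExt c ((chartAt E x).map_target hp)), hc.fderiv_eq,
        coordRep_localExt b hp, coordRep_localExt c hp]
      simp
    rw [toCoord_nabla hy (smoothAt_nabla (smoothAt_localExt b hy) (eventually_smoothAt_localExt c)),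
      ← coordRep_chartAt hy (fun y ↦ nabla (localExt c) y (localExt b y)), h1.fderiv_eq,
      h1.self_of_nhds, fderiv_clm_apply (c := fun p ↦ chr x p (toCoord x x b)) (by fun_prop)
      (by fun_prop), fderiv_clm_apply hΓ (by fun_prop)]
    simp
  rw [curvature, map_sub, map_sub, key, key, hbr,
    toCoord_nabla hy (smoothAt_localExt w hy), map_zero, curv]
  simp
  abel

end Connection

/-! ### The second fundamental form and its covariant derivative -/

section Maps

variable {E : Type*} [NormedAddCommGroup E] [NormedSpace ℝ E] [FiniteDimensional ℝ E]
  {M : Type*} [TopologicalSpace M] [ChartedSpace E M] [IsManifold 𝓘(ℝ, E) ∞ M]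
  [RiemannianBundle (fun x : M ↦ TangentSpace 𝓘(ℝ, E) x)]
  [IsContMDiffRiemannianBundle 𝓘(ℝ, E) ∞ E (fun x : M ↦ TangentSpace 𝓘(ℝ, E) x)]
  {F : Type*} [NormedAddCommGroup F] [NormedSpace ℝ F] [FiniteDimensional ℝ F]
  {N : Type*} [TopologicalSpace N] [ChartedSpace F N] [IsManifold 𝓘(ℝ, F) ∞ N]
  [RiemannianBundle (fun p : N ↦ TangentSpace 𝓘(ℝ, F) p)]
  [IsContMDiffRiemannianBundle 𝓘(ℝ, F) ∞ F (fun p : N ↦ TangentSpace 𝓘(ℝ, F) p)]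
  {φ : M → N}

lemma alongRep_dmap (hφ : ContMDiff 𝓘(ℝ, E) 𝓘(ℝ, F) ∞ φ) {x₀ : M} {q₀ : N} {p : E}
    (hp : p ∈ coordDomain (E := E) (F := F) x₀ q₀ φ) (Y : VectorField E M) :
    alongRep x₀ q₀ φ (fun z ↦ dmap E F φ z (Y z)) p
      = fderiv ℝ (mapCoord x₀ q₀ φ) p (coordRep x₀ Y p) := by
  rw [alongRep, toCoord_dmap hφ ((chartAt E x₀).map_target hp.1) hp.2,
    (chartAt E x₀).right_inv hp.1]
  rfl

/-- The second fundamental form read in the charts at `x₀` and `q₀`. -/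
noncomputable abbrev sffCoord (x₀ : M) (q₀ : N) (φ : M → N) : E → E →L[ℝ] E →L[ℝ] F :=
  hess (chr x₀) (chr q₀) (mapCoord x₀ q₀ φ)

lemma alongRep_dmap_eventuallyEq (hφ : ContMDiff 𝓘(ℝ, E) 𝓘(ℝ, F) ∞ φ) {x₀ y : M} {q₀ : N}
    (hy : y ∈ (chartAt E x₀).source) (hy' : φ y ∈ (chartAt F q₀).source) (Y : VectorField E M) :
    alongRep x₀ q₀ φ (fun z ↦ dmap E F φ z (Y z)) =ᶠ[𝓝 (chartAt E x₀ y)]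
      fun p ↦ fderiv ℝ (mapCoord x₀ q₀ φ) p (coordRep x₀ Y p) := by
  filter_upwards [(isOpen_coordDomain x₀ q₀ hφ.continuous).mem_nhds (mem_coordDomain hy hy')]
    with p hp using alongRep_dmap hφ hp Y

lemma differentiableAt_alongRep_dmap (hφ : ContMDiff 𝓘(ℝ, E) 𝓘(ℝ, F) ∞ φ) {x₀ y : M} {q₀ : N}
    (hy : y ∈ (chartAt E x₀).source) (hy' : φ y ∈ (chartAt F q₀).source) {Y : VectorField E M}
    (hY : SmoothAt Y y) :
    DifferentiableAt ℝ (alongRep x₀ q₀ φ (fun z ↦ dmap E F φ z (Y z))) (chartAt E x₀ y) := by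
  have h1 := contDiffAt_mapCoord hφ (mem_coordDomain hy hy')
  exact (((h1.fderiv_right (m := ∞) (by simp)).differentiableAt (by simp)).clm_apply
    ((hY.contDiffAt_coordRep hy).differentiableAt (by simp))).congr_of_eventuallyEq
      (alongRep_dmap_eventuallyEq hφ hy hy' Y)

/-- The Hessian depends on `Y` only through its value at `y`. This makes the second fundamental form
tensorial and yields the Leibniz rule `nablaAlong_dmap`. -/
lemma toCoord_nablaAlong_dmap (hφ : ContMDiff 𝓘(ℝ, E) 𝓘(ℝ, F) ∞ φ) {x₀ y : M} {q₀ : N}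
    (hy : y ∈ (chartAt E x₀).source) (hy' : φ y ∈ (chartAt F q₀).source) {Y : VectorField E M}
    (hY : SmoothAt Y y) (u : TangentSpace 𝓘(ℝ, E) y) :
    toCoord q₀ (φ y) (nablaAlong φ (fun z ↦ dmap E F φ z (Y z)) y u)
      = sffCoord x₀ q₀ φ (chartAt E x₀ y) (toCoord x₀ y u) (toCoord x₀ y (Y y))
        + toCoord q₀ (φ y) (dmap E F φ y (nabla Y y u)) := by
  have h1 := contDiffAt_mapCoord hφ (mem_coordDomain hy hy')
  have hY' := (hY.contDiffAt_coordRep hy).differentiableAt (by simp)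
  rw [toCoord_nablaAlong hφ hy hy' (differentiableAt_alongRep_dmap hφ hy hy' hY),
    (alongRep_dmap_eventuallyEq hφ hy hy' Y).fderiv_eq, toCoord_dmap hφ hy hy',
    toCoord_dmap hφ hy hy', toCoord_nabla hy hY, ← coordRep_chartAt hy Y,
    ← mapCoord_chartAt hy]
  exact fderiv_fderiv_apply h1 hY' _

lemma toCoord_secondFundamentalForm (hφ : ContMDiff 𝓘(ℝ, E) 𝓘(ℝ, F) ∞ φ) {x₀ y : M} {q₀ : N}
    (hy : y ∈ (chartAt E x₀).source) (hy' : φ y ∈ (chartAt F q₀).source)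
    (u v : TangentSpace 𝓘(ℝ, E) y) :
    toCoord q₀ (φ y) (secondFundamentalForm (F := F) φ y u v)
      = sffCoord x₀ q₀ φ (chartAt E x₀ y) (toCoord x₀ y u) (toCoord x₀ y v) := by
  rw [secondFundamentalForm, map_sub, toCoord_nablaAlong_dmap hφ hy hy'
    (smoothAt_localExt v (mem_chart_source E y)), localExt_self, add_sub_cancel_right]

lemma nablaAlong_dmap (hφ : ContMDiff 𝓘(ℝ, E) 𝓘(ℝ, F) ∞ φ) {y : M} {Y : VectorField E M}
    (hY : SmoothAt Y y) (u : TangentSpace 𝓘(ℝ, E) y) :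
    nablaAlong φ (fun z ↦ dmap E F φ z (Y z)) y u
      = secondFundamentalForm (F := F) φ y u (Y y) + dmap E F φ y (nabla Y y u) := by
  have hy := mem_chart_source E y
  have hy' := mem_chart_source F (φ y)
  apply toCoord_injective hy'
  rw [toCoord_nablaAlong_dmap hφ hy hy' hY, map_add, toCoord_secondFundamentalForm hφ hy hy']

/-- The second fundamental form at a point as a bilinear map. -/
noncomputable def sffBilin (hφ : ContMDiff 𝓘(ℝ, E) 𝓘(ℝ, F) ∞ φ) (x : M) :
    TangentSpace 𝓘(ℝ, E) x →ₗ[ℝ] TangentSpace 𝓘(ℝ, E) x →ₗ[ℝ] TangentSpace 𝓘(ℝ, F) (φ x) :=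
  LinearMap.mk₂ ℝ (secondFundamentalForm (F := F) φ x)
    (fun u u' v ↦ toCoord_injective (mem_chart_source F (φ x)) (by
      simp only [toCoord_secondFundamentalForm hφ (mem_chart_source E x) (mem_chart_source F (φ x)),
        map_add, _root_.add_apply]))
    (fun c u v ↦ toCoord_injective (mem_chart_source F (φ x)) (by
      simp only [toCoord_secondFundamentalForm hφ (mem_chart_source E x) (mem_chart_source F (φ x)),
        map_smul, _root_.smul_apply]))
    (fun u v v' ↦ toCoord_injective (mem_chart_source F (φ x)) (by
      simp only [toCoord_secondFundamentalForm hφ (mem_chart_source E x) (mem_chart_source F (φ x)),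
        map_add]))
    (fun c u v ↦ toCoord_injective (mem_chart_source F (φ x)) (by
      simp only [toCoord_secondFundamentalForm hφ (mem_chart_source E x) (mem_chart_source F (φ x)),
        map_smul]))

lemma sffCoord_comm (hφ : ContMDiff 𝓘(ℝ, E) 𝓘(ℝ, F) ∞ φ) {x₀ : M} {q₀ : N} {p : E}
    (hp : p ∈ coordDomain (E := E) (F := F) x₀ q₀ φ) (u v : E) :
    sffCoord (F := F) x₀ q₀ φ p u v = sffCoord x₀ q₀ φ p v u :=
  hess_comm (contDiffAt_mapCoord hφ hp) (chr_comm hp.1)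
    (chr_comm ((chartAt F q₀).map_source hp.2)) u v

lemma secondFundamentalForm_comm (hφ : ContMDiff 𝓘(ℝ, E) 𝓘(ℝ, F) ∞ φ) (x : M)
    (u v : TangentSpace 𝓘(ℝ, E) x) :
    secondFundamentalForm (F := F) φ x u v = secondFundamentalForm (F := F) φ x v u := by
  have hy := mem_chart_source E x
  have hy' := mem_chart_source F (φ x)
  apply toCoord_injective hy'
  rw [toCoord_secondFundamentalForm hφ hy hy', toCoord_secondFundamentalForm hφ hy hy',
    sffCoord_comm hφ (mem_coordDomain hy hy')]

/-- The covariant derivative of the second fundamental form. -/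
noncomputable def sffDeriv (φ : M → N) (x : M) (u v w : TangentSpace 𝓘(ℝ, E) x) :
    TangentSpace 𝓘(ℝ, F) (φ x) :=
  ofCoord (φ x) (φ x) (hessDeriv (chr x) (chr (φ x)) (mapCoord x (φ x) φ) (chartAt E x x)
    (toCoord x x u) (toCoord x x v) (toCoord x x w))

lemma sffDeriv_comm (hφ : ContMDiff 𝓘(ℝ, E) 𝓘(ℝ, F) ∞ φ) (x : M) (u v w : TangentSpace 𝓘(ℝ, E) x) :
    sffDeriv (F := F) φ x u v w = sffDeriv φ x u w v := by
  rw [sffDeriv, sffDeriv, hessDeriv_comm]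
  filter_upwards [(isOpen_coordDomain x (φ x) hφ.continuous).mem_nhds
    (mem_coordDomain (mem_chart_source E x) (mem_chart_source F (φ x)))] with p hp
    using sffCoord_comm hφ hp

/-- The Codazzi equation on the manifolds, transported from `hessDeriv_sub`. -/
lemma sffDeriv_sub (hφ : ContMDiff 𝓘(ℝ, E) 𝓘(ℝ, F) ∞ φ) (x : M) (u v w : TangentSpace 𝓘(ℝ, E) x) :
    sffDeriv (F := F) φ x u v w - sffDeriv φ x v u w
      = curvature (φ x) (dmap E F φ x u) (dmap E F φ x v) (dmap E F φ x w)
        - dmap E F φ x (curvature x u v w) := by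
  have hy := mem_chart_source E x
  have hy' := mem_chart_source F (φ x)
  have hp := mem_coordDomain hy hy'
  apply toCoord_injective hy'
  rw [map_sub, map_sub, toCoord_curvature, toCoord_dmap hφ hy hy', toCoord_dmap hφ hy hy',
    toCoord_dmap hφ hy hy', toCoord_dmap hφ hy hy', toCoord_curvature, sffDeriv, sffDeriv,
    toCoord_ofCoord hy', toCoord_ofCoord hy', ← mapCoord_chartAt hy]
  refine hessDeriv_sub (contDiffAt_mapCoord hφ hp)
    ((contDiffAt_chr hp.1).differentiableAt (by simp)) ?_ (chr_comm hp.1) _ _ _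
  rw [mapCoord_chartAt hy]
  exact (contDiffAt_chr ((chartAt F (φ x)).map_source hy')).differentiableAt (by simp)

end Maps

/-! ### Locality and additivity of the pull-back connection -/

section Along

variable {E : Type*} [NormedAddCommGroup E] [NormedSpace ℝ E] [FiniteDimensional ℝ E]
  {M : Type*} [TopologicalSpace M] [ChartedSpace E M] [IsManifold 𝓘(ℝ, E) ∞ M]
  {F : Type*} [NormedAddCommGroup F] [NormedSpace ℝ F] [FiniteDimensional ℝ F]
  {N : Type*} [TopologicalSpace N] [ChartedSpace F N] [IsManifold 𝓘(ℝ, F) ∞ N]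
  [RiemannianBundle (fun p : N ↦ TangentSpace 𝓘(ℝ, F) p)]
  [IsContMDiffRiemannianBundle 𝓘(ℝ, F) ∞ F (fun p : N ↦ TangentSpace 𝓘(ℝ, F) p)]
  {φ : M → N} {x : M} {V W : Π x : M, TangentSpace 𝓘(ℝ, F) (φ x)}

lemma nablaAlong_congr (h : ∀ᶠ y in 𝓝 x, V y = W y) (u : TangentSpace 𝓘(ℝ, E) x) :
    nablaAlong φ V x u = nablaAlong φ W x u := by
  have h1 : (fun y ↦ (trivializationAt F (TangentSpace 𝓘(ℝ, F) : N → Type _) (φ x) ⟨φ y, V y⟩).2)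
      =ᶠ[𝓝 x] fun y ↦ (trivializationAt F (TangentSpace 𝓘(ℝ, F) : N → Type _) (φ x) ⟨φ y, W y⟩).2 := by
    filter_upwards [h] with y hy
    rw [hy]
  have h2 : mvfderiv 𝓘(ℝ, E)
      (fun y ↦ (trivializationAt F (TangentSpace 𝓘(ℝ, F) : N → Type _) (φ x) ⟨φ y, V y⟩).2) x u
      = mvfderiv 𝓘(ℝ, E)
      (fun y ↦ (trivializationAt F (TangentSpace 𝓘(ℝ, F) : N → Type _) (φ x) ⟨φ y, W y⟩).2) x u := by
    simp only [mvfderiv]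
    rw [h1.mfderiv_eq]
    rfl
  rw [nablaAlong, nablaAlong, h2, h.self_of_nhds]

variable (φ x V) in
/-- Differentiability at `x` of a section of `φ⁻¹TN`. -/
def AlongDiffAt : Prop := DifferentiableAt ℝ (alongRep (E := E) x (φ x) φ V) (chartAt E x x)

lemma AlongDiffAt.add (hV : AlongDiffAt (E := E) φ x V) (hW : AlongDiffAt (E := E) φ x W) :
    AlongDiffAt (E := E) φ x (fun y ↦ V y + W y) := by
  have h : alongRep (E := E) x (φ x) φ (fun y ↦ V y + W y)
      = fun p ↦ alongRep x (φ x) φ V p + alongRep x (φ x) φ W p := by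
    funext p; exact map_add _ _ _
  rw [AlongDiffAt, h]
  exact DifferentiableAt.fun_add hV hW

lemma AlongDiffAt.sum {ι : Type*} {s : Finset ι} {V : ι → Π x : M, TangentSpace 𝓘(ℝ, F) (φ x)}
    (hV : ∀ i ∈ s, AlongDiffAt (E := E) φ x (V i)) :
    AlongDiffAt (E := E) φ x (fun y ↦ ∑ i ∈ s, V i y) := by
  have h : alongRep (E := E) x (φ x) φ (fun y ↦ ∑ i ∈ s, V i y)
      = fun p ↦ ∑ i ∈ s, alongRep x (φ x) φ (V i) p := by
    funext p; exact map_sum _ _ _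
  rw [AlongDiffAt, h]
  exact DifferentiableAt.fun_sum hV

lemma nablaAlong_add (hφ : ContMDiff 𝓘(ℝ, E) 𝓘(ℝ, F) ∞ φ) (hV : AlongDiffAt (E := E) φ x V)
    (hW : AlongDiffAt (E := E) φ x W) (u : TangentSpace 𝓘(ℝ, E) x) :
    nablaAlong φ (fun y ↦ V y + W y) x u = nablaAlong φ V x u + nablaAlong φ W x u := by
  have hy := mem_chart_source E x
  have hy' := mem_chart_source F (φ x)
  apply toCoord_injective hy'
  have h : alongRep (E := E) x (φ x) φ (fun y ↦ V y + W y)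
      = fun p ↦ alongRep x (φ x) φ V p + alongRep x (φ x) φ W p := by
    funext p; exact map_add _ _ _
  rw [map_add, toCoord_nablaAlong hφ hy hy' hV, toCoord_nablaAlong hφ hy hy' hW,
    toCoord_nablaAlong hφ hy hy' (hV.add hW), h, fderiv_fun_add hV hW]
  simp only [map_add, _root_.add_apply]
  abel

lemma nablaAlong_sum (hφ : ContMDiff 𝓘(ℝ, E) 𝓘(ℝ, F) ∞ φ) {ι : Type*} {s : Finset ι}
    {V : ι → Π x : M, TangentSpace 𝓘(ℝ, F) (φ x)}
    (hV : ∀ i ∈ s, AlongDiffAt (E := E) φ x (V i)) (u : TangentSpace 𝓘(ℝ, E) x) :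
    nablaAlong φ (fun y ↦ ∑ i ∈ s, V i y) x u = ∑ i ∈ s, nablaAlong φ (V i) x u := by
  have hy := mem_chart_source E x
  have hy' := mem_chart_source F (φ x)
  apply toCoord_injective hy'
  have h : alongRep (E := E) x (φ x) φ (fun y ↦ ∑ i ∈ s, V i y)
      = fun p ↦ ∑ i ∈ s, alongRep x (φ x) φ (V i) p := by
    funext p; exact map_sum _ _ _
  rw [map_sum, Finset.sum_congr rfl fun i hi ↦ toCoord_nablaAlong hφ hy hy' (hV i hi) u,
    toCoord_nablaAlong hφ hy hy' (AlongDiffAt.sum hV), h, fderiv_fun_sum hV, Finset.sum_add_distrib]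
  simp only [map_sum, _root_.sum_apply]

lemma nablaAlong_neg (hφ : ContMDiff 𝓘(ℝ, E) 𝓘(ℝ, F) ∞ φ) (hV : AlongDiffAt (E := E) φ x V)
    (u : TangentSpace 𝓘(ℝ, E) x) :
    nablaAlong φ (fun y ↦ -V y) x u = -nablaAlong φ V x u := by
  have hy := mem_chart_source E x
  have hy' := mem_chart_source F (φ x)
  apply toCoord_injective hy'
  have h : alongRep (E := E) x (φ x) φ (fun y ↦ -V y) = fun p ↦ -alongRep x (φ x) φ V p := by
    funext p; exact map_neg _ _
  have hV' : AlongDiffAt (E := E) φ x (fun y ↦ -V y) := by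
    rw [AlongDiffAt, h]
    exact DifferentiableAt.fun_neg hV
  rw [map_neg, toCoord_nablaAlong hφ hy hy' hV, toCoord_nablaAlong hφ hy hy' hV', h, fderiv_fun_neg]
  simp only [map_neg, _root_.neg_apply]
  abel

end Along

/-! ### Second derivatives along a map, and holomorphy differentiated -/

section SecondOrder

variable {E : Type*} [NormedAddCommGroup E] [NormedSpace ℝ E] [FiniteDimensional ℝ E]
  {M : Type*} [TopologicalSpace M] [ChartedSpace E M] [IsManifold 𝓘(ℝ, E) ∞ M]
  [RiemannianBundle (fun x : M ↦ TangentSpace 𝓘(ℝ, E) x)]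
  [IsContMDiffRiemannianBundle 𝓘(ℝ, E) ∞ E (fun x : M ↦ TangentSpace 𝓘(ℝ, E) x)]
  {F : Type*} [NormedAddCommGroup F] [NormedSpace ℝ F] [FiniteDimensional ℝ F]
  {N : Type*} [TopologicalSpace N] [ChartedSpace F N] [IsManifold 𝓘(ℝ, F) ∞ N]
  [RiemannianBundle (fun p : N ↦ TangentSpace 𝓘(ℝ, F) p)]
  [IsContMDiffRiemannianBundle 𝓘(ℝ, F) ∞ F (fun p : N ↦ TangentSpace 𝓘(ℝ, F) p)]
  {φ : M → N} {x : M} {X Y : VectorField E M}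

lemma alongDiffAt_dmap (hφ : ContMDiff 𝓘(ℝ, E) 𝓘(ℝ, F) ∞ φ) (hY : SmoothAt Y x) :
    AlongDiffAt (E := E) (F := F) φ x (fun z ↦ dmap E F φ z (Y z)) :=
  differentiableAt_alongRep_dmap hφ (mem_chart_source E x) (mem_chart_source F (φ x)) hY

lemma alongRep_sff_eventuallyEq (hφ : ContMDiff 𝓘(ℝ, E) 𝓘(ℝ, F) ∞ φ) (x : M) (X Y : VectorField E M) :
    alongRep x (φ x) φ (fun z ↦ secondFundamentalForm (F := F) φ z (X z) (Y z))
      =ᶠ[𝓝 (chartAt E x x)] fun p ↦ sffCoord x (φ x) φ p (coordRep x X p) (coordRep x Y p) := by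
  filter_upwards [(isOpen_coordDomain x (φ x) hφ.continuous).mem_nhds
    (mem_coordDomain (mem_chart_source E x) (mem_chart_source F (φ x)))] with p hp
  rw [alongRep, toCoord_secondFundamentalForm hφ ((chartAt E x).map_target hp.1) hp.2,
    (chartAt E x).right_inv hp.1]
  rfl

lemma alongDiffAt_sff (hφ : ContMDiff 𝓘(ℝ, E) 𝓘(ℝ, F) ∞ φ) (hX : SmoothAt X x) (hY : SmoothAt Y x) :
    AlongDiffAt (E := E) φ x (fun z ↦ secondFundamentalForm (F := F) φ z (X z) (Y z)) := by
  have hy := mem_chart_source E x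
  have hy' := mem_chart_source F (φ x)
  have hp := mem_coordDomain hy hy'
  refine (differentiableAt_hess_apply (contDiffAt_mapCoord hφ hp)
    ((contDiffAt_chr hp.1).differentiableAt (by simp)) ?_
    ((hX.contDiffAt_coordRep hy).differentiableAt (by simp))
    ((hY.contDiffAt_coordRep hy).differentiableAt (by simp))).congr_of_eventuallyEq
    (alongRep_sff_eventuallyEq hφ x X Y)
  rw [mapCoord_chartAt hy]
  exact (contDiffAt_chr ((chartAt F (φ x)).map_source hy')).differentiableAt (by simp)

/-- The Leibniz rule for the second fundamental form. -/
lemma nablaAlong_sff (hφ : ContMDiff 𝓘(ℝ, E) 𝓘(ℝ, F) ∞ φ) (hX : SmoothAt X x) (hY : SmoothAt Y x)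
    (u : TangentSpace 𝓘(ℝ, E) x) :
    nablaAlong φ (fun z ↦ secondFundamentalForm (F := F) φ z (X z) (Y z)) x u
      = sffDeriv φ x u (X x) (Y x) + secondFundamentalForm (F := F) φ x (nabla X x u) (Y x)
        + secondFundamentalForm (F := F) φ x (X x) (nabla Y x u) := by
  have hy := mem_chart_source E x
  have hy' := mem_chart_source F (φ x)
  have hp := mem_coordDomain hy hy'
  have hΓ' : DifferentiableAt ℝ (chr (E := F) (φ x)) (mapCoord x (φ x) φ (chartAt E x x)) := by
    rw [mapCoord_chartAt hy]
    exact (contDiffAt_chr ((chartAt F (φ x)).map_source hy')).differentiableAt (by simp)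
  have h := fderiv_hess_apply (contDiffAt_mapCoord hφ hp)
    ((contDiffAt_chr hp.1).differentiableAt (by simp)) hΓ'
    ((hX.contDiffAt_coordRep hy).differentiableAt (by simp))
    ((hY.contDiffAt_coordRep hy).differentiableAt (by simp)) (toCoord x x u)
  apply toCoord_injective hy'
  rw [map_add, map_add, toCoord_nablaAlong hφ hy hy' (alongDiffAt_sff hφ hX hY),
    (alongRep_sff_eventuallyEq hφ x X Y).fderiv_eq, toCoord_secondFundamentalForm hφ hy hy',
    toCoord_secondFundamentalForm hφ hy hy', toCoord_secondFundamentalForm hφ hy hy',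
    sffDeriv, toCoord_ofCoord hy', toCoord_nabla hy hX, toCoord_nabla hy hY]
  rw [coordRep_chartAt hy, coordRep_chartAt hy] at h
  rw [mapCoord_chartAt hy] at h
  exact h

/-- The Hessian of `dφ(Y)`. -/
lemma nablaAlong_nablaAlong_dmap (hφ : ContMDiff 𝓘(ℝ, E) 𝓘(ℝ, F) ∞ φ)
    (hY : ∀ᶠ y in 𝓝 x, SmoothAt Y y) (u v : TangentSpace 𝓘(ℝ, E) x) :
    nablaAlong φ (fun y ↦ nablaAlong φ (fun z ↦ dmap E F φ z (Y z)) y (localExt v y)) x u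
      - nablaAlong φ (fun z ↦ dmap E F φ z (Y z)) x (nabla (localExt v) x u)
      = sffDeriv φ x u v (Y x) + secondFundamentalForm (F := F) φ x v (nabla Y x u)
        + secondFundamentalForm (F := F) φ x u (nabla Y x v)
        + dmap E F φ x (nabla (fun y ↦ nabla Y y (localExt v y)) x u
          - nabla Y x (nabla (localExt v) x u)) := by
  have hy := mem_chart_source E x
  have hv := smoothAt_localExt v hy
  have hYx := hY.self_of_nhds
  have hn := smoothAt_nabla hv hY
  have h1 : ∀ᶠ y in 𝓝 x, nablaAlong φ (fun z ↦ dmap E F φ z (Y z)) y (localExt v y)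
      = secondFundamentalForm (F := F) φ y (localExt v y) (Y y)
        + dmap E F φ y (nabla Y y (localExt v y)) := by
    filter_upwards [hY] with y hy' using nablaAlong_dmap hφ hy' _
  rw [nablaAlong_congr h1, nablaAlong_add hφ (alongDiffAt_sff hφ hv hYx) (alongDiffAt_dmap hφ hn),
    nablaAlong_sff hφ hv hYx, nablaAlong_dmap hφ hn, nablaAlong_dmap hφ hYx, localExt_self, map_sub]
  abel

/-- The covariant derivative of `dφ ∘ J = J^N ∘ dφ`, computed by differentiating this identity in
charts. -/
lemma secondFundamentalForm_end {JM : EndField E M} {JN : EndField F N}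
    (hJ : IsAlmostHermitian JM) (hJN : IsAlmostHermitian JN) (hφ : IsHolomorphic JM JN φ)
    (x : M) (u v : TangentSpace 𝓘(ℝ, E) x) :
    secondFundamentalForm (F := F) φ x u (JM x v) = JN (φ x) (secondFundamentalForm φ x u v)
      + nablaJ JN (φ x) (dmap E F φ x u) (dmap E F φ x v) - dmap E F φ x (nablaJ JM x u v) := by
  have hy := mem_chart_source E x
  have hy' := mem_chart_source F (φ x)
  have hp := mem_coordDomain hy hy'
  have hs := hφ.smooth
  have hc := contDiffAt_mapCoord hs hp
  have hd0 : DifferentiableAt ℝ (mapCoord (F := F) x (φ x) φ) (chartAt E x x) :=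
    hc.differentiableAt (by simp)
  have hd1 : DifferentiableAt ℝ (fderiv ℝ (mapCoord (F := F) x (φ x) φ)) (chartAt E x x) :=
    (hc.fderiv_right (m := ∞) (by simp)).differentiableAt (by simp)
  have hdJ : DifferentiableAt ℝ (endCoord JM x) (chartAt E x x) :=
    (contDiffAt_endCoord hJ hp.1).differentiableAt (by simp)
  have hdJN : DifferentiableAt ℝ (endCoord JN (φ x)) (mapCoord x (φ x) φ (chartAt E x x)) := by
    rw [mapCoord_chartAt hy]
    exact (contDiffAt_endCoord hJN ((chartAt F (φ x)).map_source hy')).differentiableAt (by simp)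
  have hdJN' : DifferentiableAt ℝ (fun p ↦ endCoord JN (φ x) (mapCoord x (φ x) φ p)) (chartAt E x x) :=
    hdJN.comp _ hd0
  have hcomp : fderiv ℝ (fun p ↦ endCoord JN (φ x) (mapCoord x (φ x) φ p)) (chartAt E x x)
      = (fderiv ℝ (endCoord JN (φ x)) (mapCoord x (φ x) φ (chartAt E x x))).comp
        (fderiv ℝ (mapCoord x (φ x) φ) (chartAt E x x)) := fderiv_comp _ hdJN hd0
  have hcomm : ∀ p ∈ coordDomain (E := E) (F := F) x (φ x) φ, ∀ w : E,
      fderiv ℝ (mapCoord x (φ x) φ) p (endCoord JM x p w)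
      = endCoord JN (φ x) (mapCoord x (φ x) φ p) (fderiv ℝ (mapCoord x (φ x) φ) p w) := by
    intro p hp w
    have hq := (chartAt E x).map_target hp.1
    have h := toCoord_dmap (F := F) hs hq hp.2 (JM _ (ofCoord x ((chartAt E x).symm p) w))
    have h' := toCoord_dmap (F := F) hs hq hp.2 (ofCoord x ((chartAt E x).symm p) w)
    rw [(chartAt E x).right_inv hp.1] at h h'
    rw [toCoord_ofCoord hq] at h'
    rw [endCoord_apply, ← h, hφ.commutes, toCoord_end hp.2, ← h']
    rfl
  have h1 : (fun p ↦ fderiv ℝ (mapCoord x (φ x) φ) p (endCoord JM x p (toCoord x x v)))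
      =ᶠ[𝓝 (chartAt E x x)] fun p ↦
      endCoord JN (φ x) (mapCoord x (φ x) φ p) (fderiv ℝ (mapCoord x (φ x) φ) p (toCoord x x v)) := by
    filter_upwards [(isOpen_coordDomain x (φ x) hs.continuous).mem_nhds hp] with p hp
      using hcomm p hp _
  have h2 := congrArg (fun f : E →L[ℝ] F ↦ f (toCoord x x u)) h1.fderiv_eq
  rw [fderiv_clm_apply hd1 (by fun_prop), fderiv_clm_apply hdJ (by fun_prop),
    fderiv_clm_apply hdJN' (by fun_prop), fderiv_clm_apply hd1 (by fun_prop), hcomp] at h2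
  simp at h2
  apply toCoord_injective hy'
  rw [map_sub, map_add, toCoord_end hy', toCoord_nablaJ hJN hy', toCoord_dmap hs hy hy',
    toCoord_dmap hs hy hy', toCoord_dmap hs hy hy', toCoord_nablaJ hJ hy,
    toCoord_secondFundamentalForm hs hy hy', toCoord_secondFundamentalForm hs hy hy', toCoord_end hy,
    ← mapCoord_chartAt hy, hess_apply, hess_apply]
  simp only [map_add, map_sub, hcomm _ hp]
  rw [eq_sub_of_add_eq' h2]
  abel

end SecondOrder

/-! ### Metric traces and pairings -/

section MetricTrace

variable {V W : Type*} [NormedAddCommGroup V] [InnerProductSpace ℝ V] [AddCommGroup W] [Module ℝ W]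
  {ι κ : Type*} [Fintype ι] [Fintype κ]

/-- The metric trace of a bilinear map does not depend on the orthonormal basis. -/
lemma sum_bilin_orthonormalBasis (b : V →ₗ[ℝ] V →ₗ[ℝ] W) (f : OrthonormalBasis ι ℝ V)
    (g : OrthonormalBasis κ ℝ V) : ∑ i, b (f i) (f i) = ∑ k, b (g k) (g k) := by
  have h1 : ∀ i, b (f i) (f i)
      = ∑ k, ∑ l, (inner ℝ (g k) (f i) * inner ℝ (g l) (f i)) • b (g k) (g l) := by
    intro i
    conv_lhs => rw [← g.sum_repr' (f i)]
    simp only [map_sum, map_smul, LinearMap.sum_apply, LinearMap.smul_apply, Finset.smul_sum,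
      smul_smul]
    rw [Finset.sum_comm]
    simp only [mul_comm]
  have h2 : ∀ k l, ∑ i, inner ℝ (g k) (f i) * inner ℝ (g l) (f i) = inner ℝ (g k) (g l) := by
    intro k l
    rw [← f.sum_inner_mul_inner (g k) (g l)]
    simp only [real_inner_comm]
  simp only [h1]
  rw [Finset.sum_comm]
  refine Finset.sum_congr rfl fun k _ ↦ ?_
  rw [Finset.sum_comm]
  classical
  simp only [← Finset.sum_smul, h2, orthonormal_iff_ite.mp g.orthonormal, ite_smul, one_smul,
    zero_smul, Finset.sum_ite_eq, Finset.mem_univ, if_true]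

/-- A symmetric bilinear map is trace-orthogonal to the skew-symmetric endomorphisms. -/
lemma sum_bilin_skew {b : V →ₗ[ℝ] V →ₗ[ℝ] W} (hb : ∀ u v, b u v = b v u)
    (f : OrthonormalBasis ι ℝ V) {w : ι → V}
    (hw : ∀ i j, inner ℝ (w i) (f j) + inner ℝ (f i) (w j) = 0) :
    ∑ i, b (w i) (f i) = 0 := by
  have h1 : ∀ i, b (w i) (f i) = ∑ j, (inner ℝ (f j) (w i) : ℝ) • b (f j) (f i) := by
    intro i
    conv_lhs => rw [← f.sum_repr' (w i)]
    simp only [map_sum, map_smul, LinearMap.sum_apply, LinearMap.smul_apply]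
  -- Interchanging the two indices fixes `b` and changes the sign of the coefficients.
  have h2 : ∑ i, b (w i) (f i) = -∑ i, b (w i) (f i) := by
    conv_lhs => simp only [h1]
    rw [Finset.sum_comm]
    simp only [h1, ← Finset.sum_neg_distrib]
    refine Finset.sum_congr rfl fun j _ ↦ Finset.sum_congr rfl fun i _ ↦ ?_
    rw [← neg_smul, hb]
    congr 1
    have := hw i j
    rw [real_inner_comm (w i) (f j)]
    linarith
  have h3 : (2 : ℝ) • ∑ i, b (w i) (f i) = 0 := by
    rw [two_smul]
    nth_rewrite 2 [h2]
    exact add_neg_cancel _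
  exact (smul_eq_zero.mp h3).resolve_left two_ne_zero

/-- The pairing of a bilinear map with the symmetrization of `n - s ⊗ s / 2`. -/
noncomputable def symmPairing (f : ι → V) (n : V →ₗ[ℝ] V) (s : V) (b : V →ₗ[ℝ] V →ₗ[ℝ] W) : W :=
  ∑ i, (b (f i) (n (f i)) + b (n (f i)) (f i)) - b s s

lemma symmPairing_eq (f : OrthonormalBasis ι ℝ V) (n : V →ₗ[ℝ] V) (s : V)
    (b : V →ₗ[ℝ] V →ₗ[ℝ] W) :
    symmPairing f n s b = ∑ i, ∑ j, (inner ℝ (n (f i)) (f j) + inner ℝ (n (f j)) (f i)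
      - inner ℝ s (f i) * inner ℝ s (f j) : ℝ) • b (f i) (f j) := by
  have h1 : ∀ i, b (f i) (n (f i)) = ∑ j, (inner ℝ (n (f i)) (f j) : ℝ) • b (f i) (f j) := by
    intro i
    conv_lhs => rw [← f.sum_repr' (n (f i))]
    simp only [map_sum, map_smul, real_inner_comm]
  have h2 : ∀ i, b (n (f i)) (f i) = ∑ j, (inner ℝ (n (f i)) (f j) : ℝ) • b (f j) (f i) := by
    intro i
    conv_lhs => rw [← f.sum_repr' (n (f i))]
    simp only [map_sum, map_smul, real_inner_comm, LinearMap.sum_apply, LinearMap.smul_apply]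
  have h3 : b s s = ∑ i, ∑ j, (inner ℝ s (f i) * inner ℝ s (f j) : ℝ) • b (f i) (f j) := by
    conv_lhs => rw [← f.sum_repr' s]
    simp only [map_sum, map_smul, real_inner_comm, LinearMap.sum_apply, LinearMap.smul_apply,
      Finset.smul_sum, smul_smul]
    rw [Finset.sum_comm]
    simp only [mul_comm]
  simp only [symmPairing, h1, h2, h3, Finset.sum_add_distrib, sub_smul, add_smul,
    Finset.sum_sub_distrib]
  congr 2
  rw [Finset.sum_comm]

lemma symmPairing_orthonormalBasis (f : OrthonormalBasis ι ℝ V) (g : OrthonormalBasis κ ℝ V)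
    (n : V →ₗ[ℝ] V) (s : V) (b : V →ₗ[ℝ] V →ₗ[ℝ] W) :
    symmPairing f n s b = symmPairing g n s b := by
  rw [symmPairing, symmPairing]
  congr 1
  exact sum_bilin_orthonormalBasis (b.compl₂ n + b.comp n) f g

/-- The pairing with an isometry-invariant symmetric form is isometry-invariant. -/
lemma symmPairing_comp_isometry (f : OrthonormalBasis ι ℝ V) {n : V →ₗ[ℝ] V} {s : V}
    (e : V ≃ₗᵢ[ℝ] V)
    (h : ∀ u v, inner ℝ (n (e u)) (e v) + inner ℝ (n (e v)) (e u) - inner ℝ s (e u) * inner ℝ s (e v)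
      = (inner ℝ (n u) v + inner ℝ (n v) u - inner ℝ s u * inner ℝ s v : ℝ))
    {b b' : V →ₗ[ℝ] V →ₗ[ℝ] W} (hb : ∀ u v, b' u v = b (e u) (e v)) :
    symmPairing f n s b' = symmPairing f n s b := by
  -- Evaluating the right-hand side in the frame moved by `e` puts `b (e u) (e v)` on both sides;
  -- the coefficients then agree by `h`.
  rw [symmPairing_orthonormalBasis f (f.map e) n s b, symmPairing_eq, symmPairing_eq]
  simp only [OrthonormalBasis.map_apply, h, hb]

end MetricTrace

/-! ### The tensor `quasiKaehlerForm` -/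

section AlmostHermitian

variable {E : Type*} [NormedAddCommGroup E] [NormedSpace ℝ E] [FiniteDimensional ℝ E]
  {M : Type*} [TopologicalSpace M] [ChartedSpace E M] [IsManifold 𝓘(ℝ, E) ∞ M]
  [RiemannianBundle (fun x : M ↦ TangentSpace 𝓘(ℝ, E) x)]
  {J : EndField E M}

/-- `J` at a point as a linear isometry. -/
noncomputable def IsAlmostHermitian.isometryEquiv (hJ : IsAlmostHermitian J) (x : M) :
    TangentSpace 𝓘(ℝ, E) x ≃ₗᵢ[ℝ] TangentSpace 𝓘(ℝ, E) x where
  toFun := J x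
  map_add' := map_add (J x)
  map_smul' := map_smul (J x)
  invFun v := -J x v
  left_inv v := by
    change -J x (J x v) = v
    rw [hJ.sq_eq_neg, neg_neg]
  right_inv v := by
    change J x (-J x v) = v
    rw [map_neg, hJ.sq_eq_neg, neg_neg]
  norm_map' v := by
    change ‖J x v‖ = ‖v‖
    rw [norm_eq_sqrt_real_inner, hJ.isometry, ← norm_eq_sqrt_real_inner]

variable [IsContMDiffRiemannianBundle 𝓘(ℝ, E) ∞ E (fun x : M ↦ TangentSpace 𝓘(ℝ, E) x)]

variable (J) in
/-- The tensor `J (∇_u J) v + (∇_{J u} J) v`, which vanishes on `(1,2)`-symplectic manifolds. -/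
noncomputable def quasiKaehlerForm (x : M) (u v : TangentSpace 𝓘(ℝ, E) x) : TangentSpace 𝓘(ℝ, E) x :=
  J x (nablaJ J x u v) + nablaJ J x (J x u) v

/-- The tensor `quasiKaehlerForm` as a bilinear map. -/
noncomputable def quasiKaehlerBilin (hJ : IsAlmostHermitian J) (x : M) :
    TangentSpace 𝓘(ℝ, E) x →ₗ[ℝ] TangentSpace 𝓘(ℝ, E) x →ₗ[ℝ] TangentSpace 𝓘(ℝ, E) x :=
  (nablaJBilin J hJ x).compr₂ (J x).toLinearMap + (nablaJBilin J hJ x).comp (J x).toLinearMap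

lemma quasiKaehlerBilin_apply (hJ : IsAlmostHermitian J) (x : M) (u v : TangentSpace 𝓘(ℝ, E) x) :
    quasiKaehlerBilin hJ x u v = quasiKaehlerForm J x u v := rfl

/-- With `quasiKaehlerForm_end_right` this gives `D(Ju, Jv) = D(u, v)` and lets `J` move between the
slots, which is what assembles sums over `e_j` and `J e_j` in the third-order condition. -/
lemma quasiKaehlerForm_end_left (hJ : IsAlmostHermitian J) (x : M) (u v : TangentSpace 𝓘(ℝ, E) x) :
    quasiKaehlerForm J x (J x u) v = J x (quasiKaehlerForm J x u v) := by
  have h := (nablaJBilin J hJ x).map_neg₂ u v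
  simp only [nablaJBilin_apply] at h
  rw [quasiKaehlerForm, quasiKaehlerForm, hJ.sq_eq_neg, h, map_add, hJ.sq_eq_neg]
  abel

lemma quasiKaehlerForm_end_right (hJ : IsAlmostHermitian J) (x : M) (u v : TangentSpace 𝓘(ℝ, E) x) :
    quasiKaehlerForm J x u (J x v) = -J x (quasiKaehlerForm J x u v) := by
  rw [quasiKaehlerForm, quasiKaehlerForm, nablaJ_end hJ, nablaJ_end hJ, map_add, map_neg]
  abel

/-- Each half of the tensor has trace `σ`: the first by definition, and the second after replacing
the basis `e_i` by `J e_i` and using that `∇J` anticommutes with `J`. -/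
lemma sum_quasiKaehlerForm (hJ : IsAlmostHermitian J) (x : M) :
    ∑ i, quasiKaehlerForm J x (onb x i) (onb x i) = (2 : ℝ) • sigma J x := by
  have h := sum_bilin_orthonormalBasis ((nablaJBilin J hJ x).comp (J x).toLinearMap)
    (onb x) ((onb x).map (hJ.isometryEquiv x))
  have h1 : ∀ u : TangentSpace 𝓘(ℝ, E) x, (nablaJBilin J hJ x).comp (J x).toLinearMap
      (J x u) (J x u) = J x (nablaJ J x u u) := by
    intro u
    change nablaJBilin J hJ x (J x (J x u)) (J x u) = _
    rw [hJ.sq_eq_neg, LinearMap.map_neg₂, nablaJBilin_apply, nablaJ_end hJ, neg_neg]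
  have h2 : ∑ i, nablaJ J x (J x (onb x i)) (onb x i) = sigma J x := by
    refine h.trans ?_
    rw [sigma, divJ, map_sum]
    exact Finset.sum_congr rfl fun i _ ↦ h1 _
  simp only [quasiKaehlerForm, Finset.sum_add_distrib, h2]
  rw [← map_sum, two_smul]
  rfl

/-- For `z` in `T'` and `w₁, w₂` in `T''`, the tensors `∇_{w_i} J` map `T''` to `T'`, on which the
metric is isotropic. Hence `dΩ(z, w₁, w₂)` reduces to `g(w₁, (∇_z J) w₂)`, and its vanishing is that
of `D`. -/
lemma IsOneTwoSymplectic.quasiKaehlerForm_eq_zero (hJ : IsAlmostHermitian J)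
    (h : IsOneTwoSymplectic J) (x : M) (u v : TangentSpace 𝓘(ℝ, E) x) :
    quasiKaehlerForm J x u v = 0 := by
  have hz : MemT' J ((u, -J x u) : CTangent (E := E) x) := by
    simp only [MemT', complexJ, mulI, map_neg, hJ.sq_eq_neg, neg_neg]
  have hw : ∀ w : TangentSpace 𝓘(ℝ, E) x, MemT'' J ((w, J x w) : CTangent (E := E) x) := by
    intro w
    simp only [MemT'', complexJ, mulI, hJ.sq_eq_neg, Prod.neg_mk, neg_neg]
  have hn : ∀ a b c : TangentSpace 𝓘(ℝ, E) x,
      inner ℝ c (nablaJ J x (-a) b) = -inner ℝ c (nablaJ J x a b) := by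
    intro a b c
    rw [← inner_neg_right]
    exact congrArg _ ((nablaJBilin J hJ x).map_neg₂ a b)
  have hend : ∀ p q r : TangentSpace 𝓘(ℝ, E) x,
      inner ℝ (J x q) (nablaJ J x p r) = inner ℝ q (nablaJ J x p (J x r)) := by
    intro p q r
    rw [hJ.inner_apply, nablaJ_end hJ, inner_neg_right]
  have hn' : ∀ a b c : TangentSpace 𝓘(ℝ, E) x,
      inner ℝ c (nablaJ J x a (-b)) = -inner ℝ c (nablaJ J x a b) := by
    intro a b c
    rw [← inner_neg_right]
    exact congrArg _ (map_neg (nablaJBilin J hJ x a) b)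
  refine ext_inner_left ℝ fun w ↦ ?_
  -- With `J w` in place of `w`, the real part is a multiple of `⟪w, D(u, v)⟫` itself and not of `⟪J
  -- w, D(u, v)⟫`.
  have key := congrArg Complex.re (h x _ _ _ hz (hw (J x w)) (hw v))
  simp only [complexDFundamentalForm, Complex.zero_re, dFundamentalForm_eq hJ, hJ.sq_eq_neg, hn,
    hend, hn', inner_neg_left] at key
  rw [inner_zero_right, quasiKaehlerForm, inner_add_right]
  have e1 := hend u w v
  have e2 := hJ.inner_apply x w (nablaJ J x u v)
  linarith

end AlmostHermitian

/-! ### Holomorphic maps into (1,2)-symplectic manifolds -/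

section Holomorphic

variable {E : Type*} [NormedAddCommGroup E] [NormedSpace ℝ E] [FiniteDimensional ℝ E]
  {M : Type*} [TopologicalSpace M] [ChartedSpace E M] [IsManifold 𝓘(ℝ, E) ∞ M]
  [RiemannianBundle (fun x : M ↦ TangentSpace 𝓘(ℝ, E) x)]
  [IsContMDiffRiemannianBundle 𝓘(ℝ, E) ∞ E (fun x : M ↦ TangentSpace 𝓘(ℝ, E) x)]
  {F : Type*} [NormedAddCommGroup F] [NormedSpace ℝ F] [FiniteDimensional ℝ F]
  {N : Type*} [TopologicalSpace N] [ChartedSpace F N] [IsManifold 𝓘(ℝ, F) ∞ N]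
  [RiemannianBundle (fun p : N ↦ TangentSpace 𝓘(ℝ, F) p)]
  [IsContMDiffRiemannianBundle 𝓘(ℝ, F) ∞ F (fun p : N ↦ TangentSpace 𝓘(ℝ, F) p)]
  {φ : M → N} {J : EndField E M} {JN : EndField F N}

/-- The `J`-invariant part of the second fundamental form of a holomorphic map into a
`(1,2)`-symplectic manifold. -/
lemma secondFundamentalForm_add_end (hJ : IsAlmostHermitian J) (hJN : IsAlmostHermitian JN)
    (hN : IsOneTwoSymplectic JN) (hφ : IsHolomorphic J JN φ) (x : M)
    (u v : TangentSpace 𝓘(ℝ, E) x) :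
    (2 : ℝ) • (secondFundamentalForm (F := F) φ x u v + secondFundamentalForm φ x (J x u) (J x v))
      = -dmap E F φ x (quasiKaehlerForm J x u v + quasiKaehlerForm J x v u) := by
  have key : ∀ u v : TangentSpace 𝓘(ℝ, E) x,
      secondFundamentalForm (F := F) φ x u v + secondFundamentalForm φ x (J x u) (J x v)
      = JN (φ x) (secondFundamentalForm φ x (J x u) v - secondFundamentalForm φ x u (J x v))
        - dmap E F φ x (quasiKaehlerForm J x u v) := by
    intro u v
    have h := hN.quasiKaehlerForm_eq_zero hJN (φ x) (dmap E F φ x u) (dmap E F φ x v)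
    rw [quasiKaehlerForm] at h
    have hc : ∀ w, dmap E F φ x (J x w) = JN (φ x) (dmap E F φ x w) := hφ.commutes x
    rw [map_sub, secondFundamentalForm_end hJ hJN hφ x u v,
      secondFundamentalForm_end hJ hJN hφ x (J x u) v, hc u, map_sub, map_add, hJN.sq_eq_neg,
      quasiKaehlerForm, map_add, hc (nablaJ J x u v), eq_neg_of_add_eq_zero_left h]
    abel
  rw [two_smul]
  nth_rewrite 2 [secondFundamentalForm_comm hφ.smooth x u v,
    secondFundamentalForm_comm hφ.smooth x (J x u) (J x v)]
  rw [key, key, secondFundamentalForm_comm hφ.smooth x (J x v) u,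
    secondFundamentalForm_comm hφ.smooth x v (J x u), map_sub, map_sub, map_add]
  abel

/-- The tension field of a holomorphic map into a `(1,2)`-symplectic manifold. -/
lemma tension_eq (hJ : IsAlmostHermitian J) (hJN : IsAlmostHermitian JN)
    (hN : IsOneTwoSymplectic JN) (hφ : IsHolomorphic J JN φ) (x : M) :
    tension E F φ x = -dmap E F φ x (sigma J x) := by
  have h := sum_bilin_orthonormalBasis (sffBilin (F := F) hφ.smooth x) (onb x)
    ((onb x).map (hJ.isometryEquiv x))
  have h1 : tension E F φ x
      = ∑ i, secondFundamentalForm (F := F) φ x (J x (onb x i)) (J x (onb x i)) := h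
  have h2 : (2 : ℝ) • (tension E F φ x + tension E F φ x)
      = (2 : ℝ) • ((2 : ℝ) • -dmap E F φ x (sigma J x)) := by
    -- One copy of the trace is taken in the basis `e_i` and the other in `J e_i`, so that only the
    -- `J`-invariant part of `B` occurs.
    nth_rewrite 2 [h1]
    rw [tension, ← Finset.sum_add_distrib, Finset.smul_sum]
    simp only [secondFundamentalForm_add_end hJ hJN hN hφ x]
    rw [Finset.sum_neg_distrib, ← map_sum, Finset.sum_add_distrib, sum_quasiKaehlerForm hJ, map_add,
      map_smul]
    simp only [smul_neg, two_smul]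
  rw [← two_smul ℝ] at h2
  exact smul_right_injective _ two_ne_zero (smul_right_injective _ two_ne_zero h2)

end Holomorphic

/-! ### Smooth orthonormal frames -/

section Frame

variable {E : Type*} [NormedAddCommGroup E] [NormedSpace ℝ E] [FiniteDimensional ℝ E]
  {M : Type*} [TopologicalSpace M] [ChartedSpace E M] [IsManifold 𝓘(ℝ, E) ∞ M]

lemma SmoothAt.sub {X Y : VectorField E M} {y : M} (hX : SmoothAt X y) (hY : SmoothAt Y y) :
    SmoothAt (fun z ↦ X z - Y z) y :=
  ContMDiffAt.sub_section hX hY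

lemma SmoothAt.const_smul {X : VectorField E M} {y : M} (hX : SmoothAt X y) (c : ℝ) :
    SmoothAt (fun z ↦ c • X z) y :=
  ContMDiffAt.const_smul_section (a := c) hX

lemma smoothAt_sum {ι : Type*} {s : Finset ι} {X : ι → VectorField E M} {y : M}
    (hX : ∀ i ∈ s, SmoothAt (X i) y) : SmoothAt (fun z ↦ ∑ i ∈ s, X i z) y :=
  ContMDiffAt.sum_section hX

lemma SmoothAt.congr {X Y : VectorField E M} {y : M} (hX : SmoothAt X y)
    (h : ∀ᶠ z in 𝓝 y, Y z = X z) : SmoothAt Y y := by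
  refine ContMDiffAt.congr_of_eventuallyEq hX ?_
  filter_upwards [h] with z hz
  rw [hz]

variable [RiemannianBundle (fun x : M ↦ TangentSpace 𝓘(ℝ, E) x)]

/-- `f` is an orthonormal frame of smooth vector fields near `x`. -/
def IsOrthonormalFrameAt {ι : Type*} [Fintype ι] (f : ι → VectorField E M) (x : M) : Prop :=
  ∀ᶠ y in 𝓝 x, (∀ i, SmoothAt (f i) y) ∧
    ∃ b : OrthonormalBasis ι ℝ (TangentSpace 𝓘(ℝ, E) y), ∀ i, b i = f i y

variable {ι : Type*} [Fintype ι] {f : ι → VectorField E M} {x : M} {J : EndField E M}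

lemma IsOrthonormalFrameAt.smoothAt (hf : IsOrthonormalFrameAt f x) (i : ι) : SmoothAt (f i) x :=
  hf.self_of_nhds.1 i

/-- The frame `e₁, …, eₙ, J e₁, …, J eₙ`. -/
noncomputable def adaptedFrame (J : EndField E M) {n : ℕ} (e : Fin n → VectorField E M) :
    Fin n ⊕ Fin n → VectorField E M :=
  Sum.elim e fun j y ↦ J y (e j y)

lemma IsAdaptedFrameOn.smoothAt {n : ℕ} {e : Fin n → VectorField E M} {U : Set M} (hU : IsOpen U)
    (he : IsAdaptedFrameOn J e U) (j : Fin n) {y : M} (hy : y ∈ U) : SmoothAt (e j) y :=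
  (he.smooth j).contMDiffAt (hU.mem_nhds hy)

variable [IsContMDiffRiemannianBundle 𝓘(ℝ, E) ∞ E (fun x : M ↦ TangentSpace 𝓘(ℝ, E) x)]

lemma IsAdaptedFrameOn.isOrthonormalFrameAt (hJ : IsAlmostHermitian J) {n : ℕ}
    {e : Fin n → VectorField E M} {U : Set M} (hU : IsOpen U) (hx : x ∈ U)
    (he : IsAdaptedFrameOn J e U) : IsOrthonormalFrameAt (adaptedFrame J e) x := by
  filter_upwards [hU.mem_nhds hx] with y hy
  refine ⟨?_, ?_⟩
  · rintro (j | j)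
    · exact he.smoothAt hU j hy
    · exact hJ.smoothAt_apply (he.smoothAt hU j hy)
  · have ho := he.orthonormal y hy
    have hc : Fintype.card (Fin n ⊕ Fin n) = Module.finrank ℝ (TangentSpace 𝓘(ℝ, E) y) := by
      rw [Fintype.card_sum, Fintype.card_fin, ← two_mul]
      exact he.card
    refine ⟨OrthonormalBasis.mk ho (ho.linearIndependent.span_eq_top_of_card_eq_finrank' hc).ge, ?_⟩
    intro i
    rw [OrthonormalBasis.coe_mk]
    cases i <;> rfl

/-- The extension in `nablaJ` depends on the point, so it is first replaced by the field `Y` with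
the Leibniz rule for `J`. -/
lemma smoothAt_nablaJ (hJ : IsAlmostHermitian J) {X Y : VectorField E M} (hX : SmoothAt X x)
    (hY : ∀ᶠ y in 𝓝 x, SmoothAt Y y) : SmoothAt (fun y ↦ nablaJ J y (X y) (Y y)) x := by
  refine ((smoothAt_nabla hX (hY.mono fun y h ↦ hJ.smoothAt_apply h)).sub
    (hJ.smoothAt_apply (smoothAt_nabla hX hY))).congr ?_
  filter_upwards [hY] with y hy
  rw [nabla_end hJ hy, add_sub_cancel_right]

/-- The bases `onb y` need not vary smoothly with `y`; since traces do not depend on the basis, `div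
J` can be computed in a smooth frame. -/
lemma smoothAt_sigma (hJ : IsAlmostHermitian J) (hf : IsOrthonormalFrameAt f x) :
    SmoothAt (sigma J) x := by
  refine hJ.smoothAt_apply ((smoothAt_sum fun i (_ : i ∈ Finset.univ) ↦
    smoothAt_nablaJ hJ (hf.smoothAt i) (hf.mono fun y h ↦ h.1 i)).congr ?_)
  filter_upwards [hf] with y ⟨_, b, hb⟩
  simp only [← hb]
  exact sum_bilin_orthonormalBasis (nablaJBilin J hJ y) _ _

/-- Differentiate `⟪f_i, f_j⟫ = δ_ij`. -/
lemma IsOrthonormalFrameAt.inner_nabla (hf : IsOrthonormalFrameAt f x) (u : TangentSpace 𝓘(ℝ, E) x)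
    (i j : ι) : inner ℝ (nabla (f i) x u) (f j x) + inner ℝ (f i x) (nabla (f j) x u) = 0 := by
  classical
  rw [← mvfderiv_inner (hf.smoothAt i) (hf.smoothAt j)]
  have h : (fun y ↦ inner ℝ (f i y) (f j y)) =ᶠ[𝓝 x] fun _ ↦ if i = j then (1 : ℝ) else 0 := by
    filter_upwards [hf] with y ⟨_, b, hb⟩
    rw [← hb, ← hb, orthonormal_iff_ite.mp b.orthonormal]
  rw [mvfderiv, h.mfderiv_eq, mfderiv_const]
  rfl

end Frame

/-! ### The bitension field when the tension field is `-dφ(σ)` -/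

section BitensionFormula

variable {E : Type*} [NormedAddCommGroup E] [NormedSpace ℝ E] [FiniteDimensional ℝ E]
  {M : Type*} [TopologicalSpace M] [ChartedSpace E M] [IsManifold 𝓘(ℝ, E) ∞ M]
  [RiemannianBundle (fun x : M ↦ TangentSpace 𝓘(ℝ, E) x)]
  [IsContMDiffRiemannianBundle 𝓘(ℝ, E) ∞ E (fun x : M ↦ TangentSpace 𝓘(ℝ, E) x)]
  {F : Type*} [NormedAddCommGroup F] [NormedSpace ℝ F] [FiniteDimensional ℝ F]
  {N : Type*} [TopologicalSpace N] [ChartedSpace F N] [IsManifold 𝓘(ℝ, F) ∞ N]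
  [RiemannianBundle (fun p : N ↦ TangentSpace 𝓘(ℝ, F) p)]
  [IsContMDiffRiemannianBundle 𝓘(ℝ, F) ∞ F (fun p : N ↦ TangentSpace 𝓘(ℝ, F) p)]
  {φ : M → N} {x : M} {ι : Type*} [Fintype ι] {f : ι → VectorField E M} {σ : VectorField E M}

lemma AlongDiffAt.congr {V W : Π x : M, TangentSpace 𝓘(ℝ, F) (φ x)}
    (hV : AlongDiffAt (E := E) φ x V) (h : ∀ᶠ y in 𝓝 x, W y = V y) :
    AlongDiffAt (E := E) φ x W := by
  refine DifferentiableAt.congr_of_eventuallyEq hV ?_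
  filter_upwards [eventually_symm (mem_chart_source E x) h] with p hp
  rw [alongRep, alongRep, hp]

lemma sffDeriv_right (hφ : ContMDiff 𝓘(ℝ, E) 𝓘(ℝ, F) ∞ φ) (u v : TangentSpace 𝓘(ℝ, E) x) :
    (∀ w w', sffDeriv (F := F) φ x u v (w + w') = sffDeriv φ x u v w + sffDeriv φ x u v w')
      ∧ ∀ (c : ℝ) w, sffDeriv (F := F) φ x u v (c • w) = c • sffDeriv φ x u v w := by
  have hy := mem_chart_source E x
  have hy' := mem_chart_source F (φ x)
  have hp := mem_coordDomain hy hy'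
  have hΓ' : DifferentiableAt ℝ (chr (E := F) (φ x)) (mapCoord x (φ x) φ (chartAt E x x)) := by
    rw [mapCoord_chartAt hy]
    exact (contDiffAt_chr ((chartAt F (φ x)).map_source hy')).differentiableAt (by simp)
  have h := fderiv_hess_const (contDiffAt_mapCoord hφ hp)
    ((contDiffAt_chr hp.1).differentiableAt (by simp)) hΓ'
  constructor
  · intro w w'
    rw [sffDeriv, sffDeriv, sffDeriv, ← map_add]
    congr 1
    simp only [hessDeriv, h]
    simp only [map_add]
    abel
  · intro c w
    rw [sffDeriv, sffDeriv, ← map_smul]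
    congr 1
    simp only [hessDeriv, h]
    simp only [map_smul, smul_add, smul_sub]

/-- The covariant derivative of the second fundamental form as a bilinear map. -/
noncomputable def sffDerivBilin (hφ : ContMDiff 𝓘(ℝ, E) 𝓘(ℝ, F) ∞ φ) (x : M)
    (u : TangentSpace 𝓘(ℝ, E) x) :
    TangentSpace 𝓘(ℝ, E) x →ₗ[ℝ] TangentSpace 𝓘(ℝ, E) x →ₗ[ℝ] TangentSpace 𝓘(ℝ, F) (φ x) :=
  LinearMap.mk₂ ℝ (sffDeriv (F := F) φ x u)
    (fun v v' w ↦ by simp only [sffDeriv_comm hφ x u _ w, (sffDeriv_right hφ u w).1])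
    (fun c v w ↦ by simp only [sffDeriv_comm hφ x u _ w, (sffDeriv_right hφ u w).2])
    (fun v ↦ (sffDeriv_right hφ u v).1)
    (fun c v ↦ (sffDeriv_right hφ u v).2 c)

/-- The covariant derivative commutes with the metric trace: in a smooth frame, the terms that
differentiate the frame pair a skew matrix with the symmetric form `B` and vanish. -/
lemma nablaAlong_tension (hφ : ContMDiff 𝓘(ℝ, E) 𝓘(ℝ, F) ∞ φ) (hf : IsOrthonormalFrameAt f x)
    (u : TangentSpace 𝓘(ℝ, E) x) :
    nablaAlong φ (tension E F φ) x u = ∑ i, sffDeriv φ x u (onb x i) (onb x i) := by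
  have h1 : ∀ᶠ y in 𝓝 x, tension E F φ y
      = ∑ i, secondFundamentalForm (F := F) φ y (f i y) (f i y) := by
    filter_upwards [hf] with y ⟨_, b, hb⟩
    simp only [← hb]
    exact sum_bilin_orthonormalBasis (sffBilin (F := F) hφ y) _ _
  obtain ⟨_, b, hb⟩ := hf.self_of_nhds
  have h2 : ∑ i, secondFundamentalForm (F := F) φ x (nabla (f i) x u) (f i x) = 0 := by
    simp only [← hb]
    refine sum_bilin_skew (b := sffBilin (F := F) hφ x) (secondFundamentalForm_comm hφ x) b ?_
    intro i j
    rw [hb, hb]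
    exact hf.inner_nabla u i j
  rw [nablaAlong_congr h1, nablaAlong_sum hφ fun i _ ↦ alongDiffAt_sff hφ (hf.smoothAt i)
    (hf.smoothAt i)]
  simp only [nablaAlong_sff hφ (hf.smoothAt _) (hf.smoothAt _),
    secondFundamentalForm_comm hφ x (f _ x) (nabla _ x u), Finset.sum_add_distrib, h2, add_zero]
  simp only [← hb]
  exact sum_bilin_orthonormalBasis (sffDerivBilin (F := F) hφ x u) _ _

lemma curvature_swap (x : M) (u v w : TangentSpace 𝓘(ℝ, E) x) :
    curvature x u v w = -curvature x v u w := by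
  apply toCoord_injective (mem_chart_source E x)
  rw [map_neg, toCoord_curvature, toCoord_curvature, curv, curv]
  abel

lemma curvature_neg (x : M) (u v w : TangentSpace 𝓘(ℝ, E) x) :
    curvature x (-u) v w = -curvature x u v w := by
  apply toCoord_injective (mem_chart_source E x)
  rw [map_neg, toCoord_curvature, toCoord_curvature, curv, curv]
  simp only [map_neg, _root_.neg_apply]
  abel

/-- The bitension field of a map whose tension field is `-dφ(σ)`. -/
theorem bitension_eq (hφ : ContMDiff 𝓘(ℝ, E) 𝓘(ℝ, F) ∞ φ) (hf : IsOrthonormalFrameAt f x)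
    (hσ : ∀ᶠ y in 𝓝 x, SmoothAt σ y) (hτ : ∀ y, tension E F φ y = -dmap E F φ y (σ y)) :
    bitension E F φ x = -(dmap E F φ x (roughLaplacian σ x + ricci x (σ x) - nabla σ x (σ x))
      + (∑ i, (secondFundamentalForm φ x (onb x i) (nabla σ x (onb x i))
        + secondFundamentalForm φ x (nabla σ x (onb x i)) (onb x i))
        - secondFundamentalForm φ x (σ x) (σ x))) := by
  have hτ' : tension E F φ = fun y ↦ -dmap E F φ y (σ y) := funext hτ
  have hn : ∀ᶠ y in 𝓝 x, ∀ u : TangentSpace 𝓘(ℝ, E) y,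
      nablaAlong φ (tension E F φ) y u = -nablaAlong φ (fun z ↦ dmap E F φ z (σ z)) y u := by
    filter_upwards [hσ] with y hy u
    rw [hτ', nablaAlong_neg hφ (alongDiffAt_dmap hφ hy)]
  have hd : ∀ v : TangentSpace 𝓘(ℝ, E) x, AlongDiffAt (E := E) φ x
      (fun y ↦ nablaAlong φ (fun z ↦ dmap E F φ z (σ z)) y (localExt v y)) := by
    intro v
    have hv := smoothAt_localExt v (mem_chart_source E x)
    refine ((alongDiffAt_sff hφ hv hσ.self_of_nhds).add
      (alongDiffAt_dmap hφ (smoothAt_nabla hv hσ))).congr ?_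
    filter_upwards [hσ] with y hy using nablaAlong_dmap hφ hy _
  have h1 : roughLaplacianAlong E φ (tension E F φ) x
      = -∑ i, (nablaAlong φ (fun y ↦ nablaAlong φ (fun z ↦ dmap E F φ z (σ z)) y
          (localExt (onb x i : TangentSpace 𝓘(ℝ, E) x) y)) x (onb x i)
        - nablaAlong φ (fun z ↦ dmap E F φ z (σ z)) x (nabla (localExt (onb x i)) x (onb x i))) := by
    rw [roughLaplacianAlong, ← Finset.sum_neg_distrib]
    refine Finset.sum_congr rfl fun i _ ↦ ?_
    rw [nablaAlong_congr (hn.mono fun y hy ↦ hy _), nablaAlong_neg hφ (hd _), hn.self_of_nhds]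
    abel
  -- Symmetry and the Codazzi equation move `σ` into the slot of differentiation, where the trace
  -- becomes `∇_σ τ`. The curvature of `N` that appears is the term `ricciAlong` of the bitension
  -- field, with the sign that makes the two cancel.
  have h2 : ∑ i, sffDeriv φ x (onb x i : TangentSpace 𝓘(ℝ, E) x) (onb x i) (σ x)
      = -secondFundamentalForm φ x (σ x) (σ x) - dmap E F φ x (nabla σ x (σ x))
        + dmap E F φ x (ricci x (σ x)) + ricciAlong E φ x (tension E F φ x) := by
    have h3 : ∀ v : TangentSpace 𝓘(ℝ, E) x, sffDeriv (F := F) φ x v v (σ x)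
        = sffDeriv φ x (σ x) v v + dmap E F φ x (curvature x (σ x) v v)
          + curvature (φ x) (tension E F φ x) (dmap E F φ x v) (dmap E F φ x v) := by
      intro v
      rw [sffDeriv_comm hφ, ← sub_add_cancel (sffDeriv (F := F) φ x v (σ x) v)
        (sffDeriv φ x (σ x) v v), sffDeriv_sub hφ, hτ, curvature_neg,
        curvature_swap (φ x) (dmap E F φ x v), curvature_swap x v, map_neg]
      abel
    simp only [h3, Finset.sum_add_distrib]
    rw [← nablaAlong_tension hφ hf, hn.self_of_nhds, nablaAlong_dmap hφ hσ.self_of_nhds, ricci,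
      ricciAlong, map_sum]
    abel
  simp only [nablaAlong_nablaAlong_dmap hφ hσ] at h1
  rw [bitension, h1]
  simp only [Finset.sum_add_distrib, h2, secondFundamentalForm_comm hφ x (nabla σ x _) _, map_sum,
    map_add, map_sub, roughLaplacian]
  abel

end BitensionFormula

/-! ### `∇Y` as an endomorphism -/

section Connection

variable {E : Type*} [NormedAddCommGroup E] [NormedSpace ℝ E] [FiniteDimensional ℝ E]
  {M : Type*} [TopologicalSpace M] [ChartedSpace E M] [IsManifold 𝓘(ℝ, E) ∞ M]
  [RiemannianBundle (fun x : M ↦ TangentSpace 𝓘(ℝ, E) x)]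
  [IsContMDiffRiemannianBundle 𝓘(ℝ, E) ∞ E (fun x : M ↦ TangentSpace 𝓘(ℝ, E) x)]
  {x : M}

/-- The covariant derivative of a smooth vector field as an endomorphism. -/
noncomputable def nablaLinear {Y : VectorField E M} (hY : SmoothAt Y x) :
    TangentSpace 𝓘(ℝ, E) x →ₗ[ℝ] TangentSpace 𝓘(ℝ, E) x where
  toFun := nabla Y x
  map_add' u v := toCoord_injective (mem_chart_source E x) (by
    simp only [toCoord_nabla (mem_chart_source E x) hY, map_add, _root_.add_apply]; abel)
  map_smul' c u := toCoord_injective (mem_chart_source E x) (by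
    simp only [toCoord_nabla (mem_chart_source E x) hY, map_smul, _root_.smul_apply, smul_add,
      RingHom.id_apply])

lemma nablaLinear_apply {Y : VectorField E M} (hY : SmoothAt Y x) (u : TangentSpace 𝓘(ℝ, E) x) :
    nablaLinear hY u = nabla Y x u := rfl

lemma nabla_zero (x : M) (u : TangentSpace 𝓘(ℝ, E) x) : nabla (fun _ : M ↦ 0) x u = 0 := by
  have h0 : coordRep x (fun y : M ↦ (0 : TangentSpace 𝓘(ℝ, E) y)) = fun _ ↦ 0 := by
    funext p; exact map_zero _
  have hs : SmoothAt (fun y : M ↦ (0 : TangentSpace 𝓘(ℝ, E) y)) x :=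
    smoothAt_of_contDiffAt (mem_chart_source E x) (by rw [h0]; exact contDiffAt_const)
  apply toCoord_injective (mem_chart_source E x)
  rw [toCoord_nabla (mem_chart_source E x) hs, h0]
  simp

end Connection

/-! ### Complexified tangent vectors and their types -/

section ComplexTangent

variable {E : Type*} [NormedAddCommGroup E] [NormedSpace ℝ E] [FiniteDimensional ℝ E]
  {M : Type*} [TopologicalSpace M] [ChartedSpace E M] [IsManifold 𝓘(ℝ, E) ∞ M]
  [RiemannianBundle (fun x : M ↦ TangentSpace 𝓘(ℝ, E) x)]
  [IsContMDiffRiemannianBundle 𝓘(ℝ, E) ∞ E (fun x : M ↦ TangentSpace 𝓘(ℝ, E) x)]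
  {x : M} {J : EndField E M}

/-- Twice the real part of the `T'M`-component of a complex tangent vector. -/
noncomputable def rePart' (J : EndField E M) (x : M) : CTangent (E := E) x →ₗ[ℝ] TangentSpace 𝓘(ℝ, E) x :=
  LinearMap.fst ℝ _ _ + (J x).toLinearMap ∘ₗ LinearMap.snd ℝ _ _

lemma rePart'_mk (a b : TangentSpace 𝓘(ℝ, E) x) : rePart' J x (a, b) = a + J x b := rfl

lemma rePart'_eq_zero {z : CTangent (E := E) x} (h : part' J z = 0) : rePart' J x z = 0 := by
  have h1 : (1 / 2 : ℝ) • (z.1 - -J x z.2) = 0 := congrArg Prod.fst h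
  have h2 := (smul_eq_zero.mp h1).resolve_left (by norm_num)
  rwa [sub_neg_eq_add] at h2

/-- The `T'M`-component of the derivative of a `T''M`-field in the direction of a `T'M`-vector. -/
lemma rePart'_cnabla (hJ : IsAlmostHermitian J) {X : VectorField E M} (hX : SmoothAt X x)
    (u : TangentSpace 𝓘(ℝ, E) x) :
    rePart' J x (cnabla (fun y ↦ (X y, J y (X y))) x (u, -J x u)) = quasiKaehlerForm J x u (X x) := by
  have hn : ∀ v : TangentSpace 𝓘(ℝ, E) x, nabla X x (-v) = -nabla X x v :=
    fun v ↦ map_neg (nablaLinear hX) v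
  have hA : nablaJ J x (-J x u) (X x) = -nablaJ J x (J x u) (X x) :=
    (nablaJBilin J hJ x).map_neg₂ _ _
  rw [cnabla, rePart'_mk]
  simp only [nabla_end hJ hX, hn, hA, map_add, map_neg, hJ.sq_eq_neg, quasiKaehlerForm]
  abel

lemma cnabla_ofReal (Y : VectorField E M) (x : M) (z : CTangent (E := E) x) :
    cnabla (fun y ↦ ofReal (Y y)) x z = (nabla Y x z.1, nabla Y x z.2) := by
  simp only [cnabla, ofReal, nabla_zero, sub_zero, zero_add]

/-- Writes the `T''`-component as `(X, J X)` with a real vector `X`, the shape required by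
`rePart'_cnabla`; `part'_eq` does the same with `(u, -J u)` for directions. -/
lemma part''_eq (hJ : IsAlmostHermitian J) (z : CTangent (E := E) x) :
    part'' J z = ((1 / 2 : ℝ) • (z.1 - J x z.2), J x ((1 / 2 : ℝ) • (z.1 - J x z.2))) := by
  refine Prod.ext ?_ ?_
  · change (1 / 2 : ℝ) • (z.1 + -J x z.2) = _
    rw [sub_eq_add_neg]
  · change (1 / 2 : ℝ) • (z.2 + J x z.1) = J x ((1 / 2 : ℝ) • (z.1 - J x z.2))
    rw [map_smul, map_sub, hJ.sq_eq_neg, sub_neg_eq_add, add_comm]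

lemma part'_eq (hJ : IsAlmostHermitian J) (z : CTangent (E := E) x) :
    part' J z = ((1 / 2 : ℝ) • (z.1 + J x z.2), -J x ((1 / 2 : ℝ) • (z.1 + J x z.2))) := by
  refine Prod.ext ?_ ?_
  · change (1 / 2 : ℝ) • (z.1 - -J x z.2) = _
    rw [sub_neg_eq_add]
  · change (1 / 2 : ℝ) • (z.2 - J x z.1) = -J x ((1 / 2 : ℝ) • (z.1 + J x z.2))
    rw [map_smul, map_add, hJ.sq_eq_neg, ← smul_neg, neg_add, neg_neg, sub_eq_add_neg, add_comm]

lemma hermitianVector_eq (J : EndField E M) (e : VectorField E M) (y : M) :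
    hermitianVector J e y = ((Real.sqrt 2)⁻¹ • e y, -J y ((Real.sqrt 2)⁻¹ • e y)) := by
  refine Prod.ext ?_ ?_
  · change (Real.sqrt 2)⁻¹ • (e y - -0) = _
    rw [neg_zero, sub_zero]
  · change (Real.sqrt 2)⁻¹ • (0 - J y (e y)) = -J y ((Real.sqrt 2)⁻¹ • e y)
    rw [map_smul, zero_sub, smul_neg]

lemma cconj_hermitianVector (J : EndField E M) (e : VectorField E M) (y : M) :
    cconj (hermitianVector J e y) = ((Real.sqrt 2)⁻¹ • e y, J y ((Real.sqrt 2)⁻¹ • e y)) := by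
  rw [hermitianVector_eq, cconj, neg_neg]

/-- The first-order condition says that the symmetric form
`⟪∇_u σ, v⟫ + ⟪∇_v σ, u⟫ - ⟪σ, u⟫ ⟪σ, v⟫` is `J`-invariant. -/
lemma SymmetricCondition.invariant (hJ : IsAlmostHermitian J) (h : SymmetricCondition J)
    (hσ : SmoothAt (sigma J) x) (u v : TangentSpace 𝓘(ℝ, E) x) :
    inner ℝ (nabla (sigma J) x (J x u)) (J x v) + inner ℝ (nabla (sigma J) x (J x v)) (J x u)
      - inner ℝ (sigma J x) (J x u) * inner ℝ (sigma J x) (J x v)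
    = (inner ℝ (nabla (sigma J) x u) v + inner ℝ (nabla (sigma J) x v) u
      - inner ℝ (sigma J x) u * inner ℝ (sigma J x) v : ℝ) := by
  have hm : ∀ u : TangentSpace 𝓘(ℝ, E) x, MemT' J ((u, -J x u) : CTangent (E := E) x) := by
    intro u
    simp only [MemT', complexJ, mulI, map_neg, hJ.sq_eq_neg, neg_neg]
  have hn : ∀ v : TangentSpace 𝓘(ℝ, E) x, nabla (sigma J) x (-v) = -nabla (sigma J) x v :=
    fun v ↦ map_neg (nablaLinear hσ) v
  -- The vectors `u - iJu` and `v - iJv` lie in `T'`; the real part of the condition is the value of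
  -- the symmetric form at `(u, v)` minus its value at `(Ju, Jv)`.
  have key := congrArg Complex.re (h x _ _ (hm u) (hm v))
  simp only [cnabla_ofReal] at key
  simp only [Complex.add_re, Complex.mul_re, complexMetric, ofReal, hn,
    inner_neg_left, inner_neg_right, inner_zero_left, neg_neg] at key
  linarith

end ComplexTangent

/-! ### The two conditions as statements about `symmPairing` -/

section Conditions

variable {E : Type*} [NormedAddCommGroup E] [NormedSpace ℝ E] [FiniteDimensional ℝ E]
  {M : Type*} [TopologicalSpace M] [ChartedSpace E M] [IsManifold 𝓘(ℝ, E) ∞ M]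
  [RiemannianBundle (fun x : M ↦ TangentSpace 𝓘(ℝ, E) x)]
  [IsContMDiffRiemannianBundle 𝓘(ℝ, E) ∞ E (fun x : M ↦ TangentSpace 𝓘(ℝ, E) x)]
  {x : M} {J : EndField E M}

/-- Each term in the inner bracket is a derivative of a `T''`-field in a `T'`-direction, so its
`T'`-component is a value of `D`, and the sums over `e_j` and `J e_j` build up the pairing. Taking
real parts of the condition suffices. -/
lemma VectorConditionAt.eq_symmPairing (hJ : IsAlmostHermitian J) (hσ : ∀ y, SmoothAt (sigma J) y)
    {n : ℕ} {e : Fin n → VectorField E M} {U : Set M} (hU : IsOpen U) (hx : x ∈ U)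
    (he : IsAdaptedFrameOn J e U) (h : VectorConditionAt J e x) :
    (2 : ℝ) • (roughLaplacian (sigma J) x + ricci x (sigma J x) - nabla (sigma J) x (sigma J x))
      = symmPairing (onb x) (nablaLinear (hσ x)) (sigma J x) (quasiKaehlerBilin hJ x) := by
  have hs : ((Real.sqrt 2)⁻¹ * (Real.sqrt 2)⁻¹ : ℝ) = 1 / 2 := by
    rw [← mul_inv, Real.mul_self_sqrt (by norm_num)]
    norm_num
  set s : ℝ := (Real.sqrt 2)⁻¹
  set D := quasiKaehlerBilin hJ x with hD
  have hDl : ∀ u v, D (J x u) v = J x (D u v) := quasiKaehlerForm_end_left hJ x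
  have hDr : ∀ u v, D u (J x v) = -J x (D u v) := quasiKaehlerForm_end_right hJ x
  have hes : ∀ j, SmoothAt (fun y ↦ s • e j y) x := fun j ↦ (he.smoothAt hU j hx).const_smul s
  have hns : ∀ (c : ℝ) (v : TangentSpace 𝓘(ℝ, E) x),
      nabla (sigma J) x (c • v) = c • nabla (sigma J) x v := map_smul (nablaLinear (hσ x))
  have hnn : ∀ v : TangentSpace 𝓘(ℝ, E) x, nabla (sigma J) x (-v) = -nabla (sigma J) x v :=
    fun v ↦ map_neg (nablaLinear (hσ x)) v
  have hZ : ∀ j y, hermitianVector J (e j) y = (s • e j y, -J y (s • e j y)) :=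
    fun j ↦ hermitianVector_eq J (e j)
  have hZc : ∀ j y, cconj (hermitianVector J (e j) y) = (s • e j y, J y (s • e j y)) :=
    fun j ↦ cconj_hermitianVector J (e j)
  -- The factor `1/4` is `1/2` from the two factors `1/√2` of the frame times `1/2` from the
  -- projection to `T''`. Moving `J` across `D` turns the contribution of the imaginary part into
  -- the term for `J e_j`.
  have t1 : ∀ j, rePart' J x (cnabla (fun y ↦ part'' J (cnabla (fun y ↦ ofReal (sigma J y)) y
      (cconj (hermitianVector J (e j) y)))) x (hermitianVector J (e j) x))
      = (1 / 4 : ℝ) • (D (e j x) (nabla (sigma J) x (e j x))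
        + D (J x (e j x)) (nabla (sigma J) x (J x (e j x)))) := by
    intro j
    simp only [hZc]
    simp only [cnabla_ofReal, part''_eq hJ, hZ]
    rw [rePart'_cnabla hJ (X := fun y ↦ (1 / 2 : ℝ) • (nabla (sigma J) y (s • e j y)
      - J y (nabla (sigma J) y (J y (s • e j y))))), ← quasiKaehlerBilin_apply hJ, ← hD]
    · simp only [map_smul, hns, map_sub, LinearMap.smul_apply, hDr, hDl]
      rw [smul_smul s s, smul_smul s s, hs, ← smul_sub, sub_neg_eq_add, smul_smul]
      norm_num
    · exact ((smoothAt_nabla (hes j) (.of_forall hσ)).sub (hJ.smoothAt_apply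
        (smoothAt_nabla (hJ.smoothAt_apply (hes j)) (.of_forall hσ)))).const_smul _
  have t2 : ∀ j, rePart' J x (cnabla (fun y ↦ cconj (hermitianVector J (e j) y)) x
      (part' J (cnabla (fun y ↦ ofReal (sigma J y)) x (hermitianVector J (e j) x))))
      = (1 / 4 : ℝ) • (D (nabla (sigma J) x (e j x)) (e j x)
        + D (nabla (sigma J) x (J x (e j x))) (J x (e j x))) := by
    intro j
    simp only [hZc]
    simp only [cnabla_ofReal, part'_eq hJ, hZ]
    rw [rePart'_cnabla hJ (X := fun y ↦ s • e j y) (hes j), ← quasiKaehlerBilin_apply hJ, ← hD]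
    simp only [map_smul, hns, hnn, map_add, map_neg, LinearMap.smul_apply, LinearMap.add_apply,
      LinearMap.neg_apply, hDr, hDl]
    rw [smul_comm s (1 / 2 : ℝ), ← smul_neg, ← smul_add, smul_smul s s, hs, smul_smul]
    norm_num
  have t3 : rePart' J x (cnabla (fun y ↦ part'' J (ofReal (sigma J y))) x
      (part' J (ofReal (sigma J x)))) = (1 / 4 : ℝ) • D (sigma J x) (sigma J x) := by
    simp only [ofReal, part'_eq hJ, part''_eq hJ, map_zero, sub_zero, add_zero]
    rw [rePart'_cnabla hJ (X := fun y ↦ (1 / 2 : ℝ) • sigma J y) ((hσ x).const_smul _),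
      ← quasiKaehlerBilin_apply hJ, ← hD]
    simp only [map_smul, LinearMap.smul_apply]
    rw [smul_smul]
    norm_num
  obtain ⟨_, b, hb⟩ := (he.isOrthonormalFrameAt hJ hU hx).self_of_nhds
  rw [symmPairing_orthonormalBasis (onb x) b, symmPairing, Fintype.sum_sum_type]
  simp only [hb, adaptedFrame, Sum.elim_inl, Sum.elim_inr, nablaLinear_apply]
  have key := rePart'_eq_zero h
  rw [map_sub, map_smul, map_sub, map_sum] at key
  simp only [map_add, t1, t2, t3] at key
  rw [ofReal, rePart'_mk, map_zero, add_zero, sub_eq_zero] at key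
  rw [key]
  simp only [← Finset.smul_sum, ← smul_add, ← smul_sub, smul_smul, Finset.sum_add_distrib]
  norm_num
  abel

variable {F : Type*} [NormedAddCommGroup F] [NormedSpace ℝ F] [FiniteDimensional ℝ F]
  {N : Type*} [TopologicalSpace N] [ChartedSpace F N] [IsManifold 𝓘(ℝ, F) ∞ N]
  [RiemannianBundle (fun p : N ↦ TangentSpace 𝓘(ℝ, F) p)]
  [IsContMDiffRiemannianBundle 𝓘(ℝ, F) ∞ F (fun p : N ↦ TangentSpace 𝓘(ℝ, F) p)]
  {φ : M → N} {JN : EndField F N}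

/-- By the first-order condition, `B` and `B(J·, J·)` have the same pairing. Hence `2P(B)` is the
pairing with `B + B(J·, J·)`, which `D` determines; the order of the arguments of `D` is immaterial,
as the pairing is symmetric. -/
lemma symmPairing_sffBilin (hJ : IsAlmostHermitian J) (hsym : SymmetricCondition J)
    (hσ : SmoothAt (sigma J) x) (hJN : IsAlmostHermitian JN) (hN : IsOneTwoSymplectic JN)
    (hφ : IsHolomorphic J JN φ) :
    (2 : ℝ) • symmPairing (onb x) (nablaLinear hσ) (sigma J x) (sffBilin (F := F) hφ.smooth x)
      = -dmap E F φ x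
        (symmPairing (onb x) (nablaLinear hσ) (sigma J x) (quasiKaehlerBilin hJ x)) := by
  have h := symmPairing_comp_isometry (onb x) (n := nablaLinear hσ) (s := sigma J x)
    (hJ.isometryEquiv x) (hsym.invariant hJ hσ) (b := sffBilin (F := F) hφ.smooth x)
    (b' := (sffBilin (F := F) hφ.smooth x).compl₁₂ (J x).toLinearMap (J x).toLinearMap)
    (fun _ _ ↦ rfl)
  have hB : ∀ u v, (2 : ℝ) • (sffBilin (F := F) hφ.smooth x u v
      + (sffBilin (F := F) hφ.smooth x).compl₁₂ (J x).toLinearMap (J x).toLinearMap u v)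
      = -dmap E F φ x (quasiKaehlerBilin hJ x u v + quasiKaehlerBilin hJ x v u) :=
    secondFundamentalForm_add_end hJ hJN hN hφ x
  refine smul_right_injective _ (two_ne_zero (α := ℝ)) ?_
  change (2 : ℝ) • (2 : ℝ) • _ = (2 : ℝ) • _
  rw [two_smul ℝ (symmPairing _ _ _ _)]
  -- Only one of the two copies is replaced by the pairing with `B(J·, J·)`, which creates the sum
  -- `B + B(J·, J·)`.
  nth_rewrite 2 [← h]
  simp only [symmPairing]
  rw [sub_add_sub_comm, ← Finset.sum_add_distrib, smul_sub, hB, Finset.smul_sum]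
  have h1 : ∀ u v, (2 : ℝ) • (sffBilin (F := F) hφ.smooth x u v + sffBilin (F := F) hφ.smooth x v u
      + ((sffBilin (F := F) hφ.smooth x).compl₁₂ (J x).toLinearMap (J x).toLinearMap u v
        + (sffBilin (F := F) hφ.smooth x).compl₁₂ (J x).toLinearMap (J x).toLinearMap v u))
      = (2 : ℝ) • -dmap E F φ x (quasiKaehlerBilin hJ x u v + quasiKaehlerBilin hJ x v u) := by
    intro u v
    rw [add_add_add_comm, smul_add, hB, hB, add_comm (quasiKaehlerBilin hJ x v u), two_smul]
  simp only [h1]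
  rw [← Finset.smul_sum, Finset.sum_neg_distrib, ← map_sum, map_add, map_sub]
  simp only [two_smul]
  abel

end Conditions

end BiharmonicHolomorphic

theorem theorem1
    {E : Type*} [NormedAddCommGroup E] [NormedSpace ℝ E] [FiniteDimensional ℝ E]
    {M : Type*} [TopologicalSpace M] [ChartedSpace E M] [IsManifold 𝓘(ℝ, E) ∞ M]
    [RiemannianBundle (fun x : M ↦ TangentSpace 𝓘(ℝ, E) x)]
    [IsContMDiffRiemannianBundle 𝓘(ℝ, E) ∞ E (fun x : M ↦ TangentSpace 𝓘(ℝ, E) x)]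
    (J : EndField E M) (hJ : IsAlmostHermitian J)
    (hsym : SymmetricCondition J) (hvec : VectorCondition J)
    {F : Type*} [NormedAddCommGroup F] [NormedSpace ℝ F] [FiniteDimensional ℝ F]
    {N : Type*} [TopologicalSpace N] [ChartedSpace F N] [IsManifold 𝓘(ℝ, F) ∞ N]
    [RiemannianBundle (fun p : N ↦ TangentSpace 𝓘(ℝ, F) p)]
    [IsContMDiffRiemannianBundle 𝓘(ℝ, F) ∞ F (fun p : N ↦ TangentSpace 𝓘(ℝ, F) p)]
    (JN : EndField F N) (hJN : IsAlmostHermitian JN) (hN : IsOneTwoSymplectic JN)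
    (φ : M → N) (hφ : IsHolomorphic J JN φ) :
    IsBiharmonic E F φ := by
  intro x
  -- The local Hermitian frames supplied by the third-order condition also provide the smoothness of
  -- `σ` at every point.
  have hσ : ∀ y, SmoothAt (sigma J) y := fun y ↦ by
    obtain ⟨U, n, e, hU, hy, he, -⟩ := hvec y
    exact smoothAt_sigma hJ (he.isOrthonormalFrameAt hJ hU hy)
  obtain ⟨U, n, e, hU, hx, he, hv⟩ := hvec x
  have h1 := bitension_eq hφ.smooth (he.isOrthonormalFrameAt hJ hU hx) (.of_forall hσ)
    (tension_eq hJ hJN hN hφ)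
  have h2 := congrArg (dmap E F φ x) (hv.eq_symmPairing hJ hσ hU hx he)
  have h3 := symmPairing_sffBilin hJ hsym (hσ x) hJN hN hφ
  rw [map_smul] at h2
  rw [← h2, ← smul_neg] at h3
  have h4 := smul_right_injective _ (two_ne_zero (α := ℝ)) h3
  rw [h1, neg_eq_zero]
  -- Up to sign, `τ₂(φ)` is `dφ(tr ∇²σ + Ric σ - ∇_σ σ) + P(B)`, and both summands are expressed by
  -- `dφ(P(D))/2` with opposite signs.
  exact add_eq_zero_iff_neg_eq.mpr h4.symm
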